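/- Let $\Gamma\subset\mathbb R^3$ be a compact oriented piecewise $C^2$ surface, possibly with boundary: a finite union of (possibly curved) closed triangles, each the image of the triangle $\{(s,t):s,t\ge 0,\ s+t\le 1\}$ under a $C^2$ map $\varphi$ that is an injective immersion on it. Two different triangles meet only in vertices and in common edges; a common edge is parametrized affinely (as an edge of the reference triangle) in the same way by both triangles, and receives opposite directions from them. Let $n=\partial_s\varphi\times\partial_t\varphi/|\partial_s\varphi\times\partial_t\varphi|$ be the unit normal and $ds$ the surface area. Let $\partial\Gamma$ be the union of the edges that belong to only one triangle, directed counterclockwise as seen from the tip of $n$, with vectorial line element $d\zeta$; $\Gamma$ is closed if there are no such edges. Let $\lambda,\mu\in\mathbb R$ with $\mu\neq0$ and $\lambda+2\mu\ne 0$, and let $$U_{ij}(x,y)=\frac{1}{8\pi\mu(\lambda+2\mu)}\left[\frac{\lambda+3\mu}{|x-y|}\delta_{ij}+(\lambda+\mu)\frac{(x_i-y_i)(x_j-y_j)}{|x-y|^3}\right]$$ be the Kelvin tensor. For a vector field $w$ let $\mathcal T w=\sigma(w)n$, $\sigma(w)=\lambda(\operatorname{div}w)I+\mu(\nabla w+(\nabla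 w)^\top)$, be the traction; $\mathcal T_yU(x,y)$ is obtained by applying $\mathcal T$ to each column of $y\mapsto U(x,y)$. The double layer potential of a field $u:\Gamma\to\mathbb R^3$ is the Cauchy principal value $$(\mathcal K u)(x)=\lim_{\varepsilon\to0^+}\int_{\{y\in\Gamma:\,|x-y|>\varepsilon\}}(\mathcal T_yU(x,y))^\top u(y)\,ds_y .$$ Let $\mathcal M_y$ be the matrix of Günter derivatives $(\mathcal M_y)_{ij}=n_j\partial_{y_i}-n_i\partial_{y_j}$, so that $(\mathcal M_y\cdot u)_i=\sum_j(n_j\partial_{y_i}-n_i\partial_{y_j})u_j$ (only tangential derivatives occur), and let $U\circledast u$ be the matrix whose $k$-th column is $U_{;k}\times u$, where $U_{;k}$ is the $k$-th column of $U$. Let $\tilde u:\Gamma\to\mathbb R^3$ be continuous, and $C^1$ on each closed triangle, and let $v\in L^2(\Gamma;\mathbb R^3)$. Then $(\mathcal K\tilde u)(x)$ exists for almost every $x\in\Gamma$, and, with $\langle f,g\rangle=\int_\Gamma f\cdot g\,ds$, $$\begin{aligned}\langle\mathcal K\tilde u,v\rangle={}&2\mu\int_\Gamma v(x)\cdot\int_\Gamma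 U(x,y)\,(\mathcal M_y\cdot\tilde u(y))\,ds_y\,ds_x-\frac1{4\pi}\int_\Gamma v(x)\cdot\int_\Gamma\frac{1}{|x-y|}(\mathcal M_y\cdot\tilde u(y))\,ds_y\,ds_x\\&+\frac1{4\pi}\int_\Gamma v(x)\cdot\int_\Gamma\frac{\partial}{\partial n(y)}\frac1{|x-y|}\,\tilde u(y)\,ds_y\,ds_x-\frac1{4\pi}\int_\Gamma v(x)\cdot\int_{\partial\Gamma}\frac1{|x-y|}\,(\tilde u(y)\times d\zeta_y)\,ds_x\\&+2\mu\int_\Gamma v(x)\cdot\int_{\partial\Gamma}[U(x,y)\circledast\tilde u(y)]^\top\cdot d\zeta_y\,ds_x .\end{aligned}$$ Here the three inner surface integrals converge absolutely for every $x\in\Gamma$ (they are weakly singular), the two inner line integrals converge absolutely for almost every $x\in\Gamma$, and all outer integrals over $x$, on both sides, converge absolutely. If $\Gamma$ is closed, then both terms with line integrals vanish. -/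

import Mathlib

open MeasureTheory Filter Topology Set
open scoped Matrix RealInnerProductSpace

noncomputable section

/-- Euclidean three-space. -/
abbrev E3 : Type := EuclideanSpace ℝ (Fin 3)

/-- The standard basis vectors of `E3`. -/
def e3 (i : Fin 3) : E3 := EuclideanSpace.single i 1

/-- The cross product of `E3`. -/
def cross (a b : E3) : E3 := WithLp.toLp 2 (crossProduct a.ofLp b.ofLp)

/-- A matrix acting on a vector of `E3`. -/
def matApply (A : Matrix (Fin 3) (Fin 3) ℝ) (a : E3) : E3 := WithLp.toLp 2 (A *ᵥ a.ofLp)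

/-! ### Linear elasticity -/

/-- The stress tensor `σ(w) = lam (div w) I + mu (∇w + (∇w)ᵀ)` of a displacement field `w`
at the point `y`. -/
def stress (lam mu : ℝ) (w : E3 → E3) (y : E3) : Matrix (Fin 3) (Fin 3) ℝ :=
  Matrix.of fun i j =>
    lam * (∑ l, (fderiv ℝ w y (e3 l)) l) * (if i = j then 1 else 0)
      + mu * ((fderiv ℝ w y (e3 j)) i + (fderiv ℝ w y (e3 i)) j)

/-- The traction `σ(w, y) n`. -/
def traction (lam mu : ℝ) (n : E3) (w : E3 → E3) (y : E3) : E3 :=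
  matApply (stress lam mu w y) n

/-- The Kelvin tensor `U(x, y)`. -/
def kelvin (lam mu : ℝ) (x y : E3) : Matrix (Fin 3) (Fin 3) ℝ :=
  Matrix.of fun i j =>
    1 / (8 * Real.pi * mu * (lam + 2 * mu)) *
      ((lam + 3 * mu) / ‖x - y‖ * (if i = j then 1 else 0)
        + (lam + mu) * ((x i - y i) * (x j - y j) / ‖x - y‖ ^ 3))

/-- The `k`-th column of the Kelvin tensor. -/
def kelvinCol (lam mu : ℝ) (x : E3) (k : Fin 3) (y : E3) : E3 :=
  WithLp.toLp 2 fun i => kelvin lam mu x y i k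

/-- The matrix `𝒯_y U(x, y)`, the traction operator (with normal `n` at `y`) being applied to each
column of `y ↦ U(x, y)`. -/
def tractionKelvin (lam mu : ℝ) (x y n : E3) : Matrix (Fin 3) (Fin 3) ℝ :=
  Matrix.of fun i k => (traction lam mu n (kelvinCol lam mu x k) y) i

/-- The matrix `U ⊛ a`, whose `k`-th column is `U_{;k} × a`. -/
def kelvinCross (lam mu : ℝ) (x y a : E3) : Matrix (Fin 3) (Fin 3) ℝ :=
  Matrix.of fun i k => (cross (kelvinCol lam mu x k y) a) i

/-! ### Piecewise `C²` oriented surfaces -/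

/-- The closed reference triangle. -/
def refTriangle : Set (ℝ × ℝ) := {p | 0 ≤ p.1 ∧ 0 ≤ p.2 ∧ p.1 + p.2 ≤ 1}

/-- The vertices of the reference triangle, in counterclockwise order. -/
def refVertex : Fin 3 → ℝ × ℝ := ![(0, 0), (1, 0), (0, 1)]

/-- The `i`-th edge of the reference triangle, run through counterclockwise for `t ∈ [0, 1]`. -/
def refEdge (i : Fin 3) (t : ℝ) : ℝ × ℝ := AffineMap.lineMap (refVertex i) (refVertex (i + 1)) t

/-- The edge `i` of the parametrized triangle `f` and the edge `j` of the parametrized triangle `g`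
are the same curve, run through in opposite directions. -/
def OppositeEdges (f g : ℝ × ℝ → E3) (i j : Fin 3) : Prop :=
  ∀ t ∈ Icc (0 : ℝ) 1, f (refEdge i t) = g (refEdge j (1 - t))

/-- A compact, oriented, piecewise `C²` surface in `ℝ³`, possibly with boundary: a conforming
and coherently oriented union of finitely many (possibly curved) closed triangles.
Every triangle is the image of the reference triangle under a `C²` map that is an injective
immersion there (the values of the map off the reference triangle play no role).
Two different triangles may meet only in vertices and in common edges; the orientations that a
common edge gets from its two triangles are opposite. -/
structure Surface where
  /-- the number of triangles -/
  numFaces : ℕ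
  /-- the parametrizations of the triangles -/
  chart : Fin numFaces → ℝ × ℝ → E3
  contDiff_chart : ∀ k, ContDiff ℝ 2 (chart k)
  injOn_chart : ∀ k, InjOn (chart k) refTriangle
  immersion_chart : ∀ k, ∀ p ∈ refTriangle, Function.Injective (fderiv ℝ (chart k) p)
  conforming : ∀ k l, k ≠ l → ∀ p ∈ refTriangle, ∀ q ∈ refTriangle, chart k p = chart l q →
    (p ∈ range refVertex ∧ q ∈ range refVertex) ∨
    ∃ i j, OppositeEdges (chart k) (chart l) i j ∧ p ∈ refEdge i '' Icc 0 1

namespace Surface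

variable (Γ : Surface)

/-- The `k`-th triangle of the surface, as a set of points. -/
def face (k : Fin Γ.numFaces) : Set E3 := Γ.chart k '' refTriangle

/-- The surface as a set of points. -/
def carrier : Set E3 := ⋃ k, Γ.face k

/-- The vector `∂₁φ × ∂₂φ` of the parametrization `φ` of the `k`-th triangle. -/
def normalVec (k : Fin Γ.numFaces) (p : ℝ × ℝ) : E3 :=
  cross (fderiv ℝ (Γ.chart k) p (1, 0)) (fderiv ℝ (Γ.chart k) p (0, 1))

/-- The unit normal `n(y)` at `y = φ(p)`, for the parametrization `φ` of the `k`-th triangle. -/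
def normal (k : Fin Γ.numFaces) (p : ℝ × ℝ) : E3 :=
  ‖Γ.normalVec k p‖⁻¹ • Γ.normalVec k p

/-- The surface area element of the `k`-th triangle, in the parameter domain. -/
def faceArea (k : Fin Γ.numFaces) : Measure (ℝ × ℝ) :=
  (volume.restrict refTriangle).withDensity fun p => ENNReal.ofReal ‖Γ.normalVec k p‖

/-- The surface area measure `ds` of the surface. -/
def area : Measure E3 := ∑ k, (Γ.faceArea k).map (Γ.chart k)

/-- The surface integral `∫_Γ F ds_y` of an integrand that may depend on the point `y` and on the
normal at `y`; it is given in terms of the parameters `(k, p)`, with `y = Γ.chart k p`. -/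
def integral (F : Fin Γ.numFaces → ℝ × ℝ → E3) : E3 := ∑ k, ∫ p, F k p ∂(Γ.faceArea k)

/-- Absolute convergence of `∫_Γ F ds_y`. -/
def IntegrableOn (F : Fin Γ.numFaces → ℝ × ℝ → E3) : Prop := ∀ k, Integrable (F k) (Γ.faceArea k)

/-- The `i`-th edge of the `k`-th triangle, run through in the direction that the orientation of
the triangle induces, that is counterclockwise as seen from the tip of the normal. -/
def edge (a : Fin Γ.numFaces × Fin 3) (t : ℝ) : E3 := Γ.chart a.1 (refEdge a.2 t)

/-- The edge is also an edge of another triangle of the surface. -/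
def IsInteriorEdge (a : Fin Γ.numFaces × Fin 3) : Prop :=
  ∃ l j, l ≠ a.1 ∧ OppositeEdges (Γ.chart a.1) (Γ.chart l) a.2 j

open Classical in
/-- The edges that make up the boundary curve `∂Γ`. -/
def boundaryEdges : Finset (Fin Γ.numFaces × Fin 3) :=
  Finset.univ.filter fun a => ¬ Γ.IsInteriorEdge a

/-- The surface is closed: every edge belongs to two triangles. -/
def IsClosedSurface : Prop := ∀ a, Γ.IsInteriorEdge a

/-- The line integral `∫_{∂Γ} F(y, dζ_y)` of an integrand that is linear in the vectorial line
element `dζ_y`. -/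
def lineIntegral (F : E3 → E3 → E3) : E3 :=
  ∑ a ∈ Γ.boundaryEdges, ∫ t in (0 : ℝ)..1, F (Γ.edge a t) (deriv (Γ.edge a) t)

/-- Absolute convergence of `∫_{∂Γ} F(y, dζ_y)`. -/
def LineIntegrable (F : E3 → E3 → E3) : Prop :=
  ∀ a ∈ Γ.boundaryEdges,
    IntervalIntegrable (fun t => F (Γ.edge a t) (deriv (Γ.edge a) t)) volume 0 1

/-- `u` is continuous on the surface and `C¹` on each of its closed triangles. (As the triangles
are finitely many closed sets, continuity on the surface follows from continuity on each
of them.) -/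
def PiecewiseC1 (u : E3 → E3) : Prop := ∀ k, ContDiffOn ℝ 1 u (Γ.face k)

/-- The entry `ℳ_{ij} = n_j ∂_i - n_i ∂_j` of the matrix of Günter derivatives, applied to the
component `c` of `u`, at the point `y = Γ.chart k p`. Only tangential derivatives enter
here: the value depends on nothing but `u` on the triangle, although the derivative of `u`
within the triangle is determined only in the directions tangent to it. -/
def gunterEntry (u : E3 → E3) (k : Fin Γ.numFaces) (p : ℝ × ℝ) (i j c : Fin 3) : ℝ :=
  Γ.normal k p j * (fderivWithin ℝ u (Γ.face k) (Γ.chart k p) (e3 i)) c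
    - Γ.normal k p i * (fderivWithin ℝ u (Γ.face k) (Γ.chart k p) (e3 j)) c

/-- The Günter derivative `ℳ_y · u(y)` at `y = Γ.chart k p`. -/
def gunter (u : E3 → E3) (k : Fin Γ.numFaces) (p : ℝ × ℝ) : E3 :=
  WithLp.toLp 2 fun i => ∑ j, Γ.gunterEntry u k p i j j

/-! ### The double layer potential -/

/-- The integral `∫ (𝒯_y U(x, y))ᵀ u(y) ds_y` over the part of the surface outside of the
closed ball of radius `ε` about `x`. -/
def truncatedDoubleLayer (lam mu : ℝ) (u : E3 → E3) (x : E3) (ε : ℝ) : E3 :=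
  ∑ k, ∫ p in {p | ε < ‖x - Γ.chart k p‖},
    matApply (tractionKelvin lam mu x (Γ.chart k p) (Γ.normal k p))ᵀ (u (Γ.chart k p))
      ∂(Γ.faceArea k)

/-- `L` is the Cauchy principal value of `∫_Γ (𝒯_y U(x, y))ᵀ u(y) ds_y`. -/
def HasDoubleLayer (lam mu : ℝ) (u : E3 → E3) (x L : E3) : Prop :=
  Tendsto (Γ.truncatedDoubleLayer lam mu u x) (𝓝[>] 0) (𝓝 L)

/-- The elastostatic double layer potential `(𝒦 u)(x)`, as a Cauchy principal value. -/
def doubleLayer (lam mu : ℝ) (u : E3 → E3) (x : E3) : E3 :=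
  limUnder (𝓝[>] 0) (Γ.truncatedDoubleLayer lam mu u x)

/-! ### The terms of the regularized form -/

/-- The integrand `U(x, y) · (ℳ_y · u(y))`. -/
def elasticSLIntegrand (lam mu : ℝ) (u : E3 → E3) (x : E3) (k : Fin Γ.numFaces) (p : ℝ × ℝ) : E3 :=
  matApply (kelvin lam mu x (Γ.chart k p)) (Γ.gunter u k p)

/-- The integrand `|x - y|⁻¹ (ℳ_y · u(y))`. -/
def laplaceSLIntegrand (u : E3 → E3) (x : E3) (k : Fin Γ.numFaces) (p : ℝ × ℝ) : E3 :=
  (1 / ‖x - Γ.chart k p‖) • Γ.gunter u k p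

/-- The integrand `(∂/∂n(y) |x - y|⁻¹) u(y)`. -/
def laplaceDLIntegrand (u : E3 → E3) (x : E3) (k : Fin Γ.numFaces) (p : ℝ × ℝ) : E3 :=
  (fderiv ℝ (fun y : E3 => 1 / ‖x - y‖) (Γ.chart k p) (Γ.normal k p)) • u (Γ.chart k p)

end Surface

/-- The integrand `|x - y|⁻¹ (u(y) × dζ_y)`. -/
def laplaceLineIntegrand (u : E3 → E3) (x y dζ : E3) : E3 :=
  (1 / ‖x - y‖) • cross (u y) dζ

/-- The integrand `[U ⊛ u(y)]ᵀ · dζ_y`. -/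
def kelvinLineIntegrand (lam mu : ℝ) (u : E3 → E3) (x y dζ : E3) : E3 :=
  matApply (kelvinCross lam mu x y (u y))ᵀ dζ

end

/-!
The proof rests on Stokes' theorem on each curved triangle (`stokes_triangle`), in the form of an
integration by parts with Günter derivatives, in which the mixed second derivatives of the `C²`
parametrization cancel. Write `z = x - y` and `r = |z|`. Paired with a constant vector `b`, the
kernel of the double layer potential splits (`inner_tractionKelvin`) into three parts: a tangential
derivative of `1 / r`, which is the only strongly singular one; the normal derivative of `1 / r`;
and the dyad `z ⊗ z / r⁵` times `n · z`. The latter two are weakly singular, because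
`|n · z| ≤ C r²` for `y` on the triangle (`exists_inner_nvec_le`).

* The tangential part is integrated by parts after cutting off the ball of radius `ε`
  (`integral_truncated_by_parts`). The cut-off integrand is the tangential derivative of
  `1 / max r ε`, which is constant inside of the ball; hence the curve `r = ε` contributes nothing,
  and there is no need to know what this curve looks like. As `1 / max r ε` is only Lipschitz, it is
  first approximated by functions whose derivative vanishes at `r = ε`. Letting `ε → 0` gives the
  principal value (`tendsto_integral_truncated`).
* The dyadic part is turned into the Günter derivative of `u`, paired with `z ⊗ z / r³`, by a
  second integration by parts (`integral_dyad_by_parts`). Here the kernel is smoothed by `r² + δ²`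
  in place of `r²`.

Together they give, on a single triangle and for `x` off its edges, the regularized form with a line
integral over all three edges (`tendsto_truncatedFace`). It also holds for `x` off the triangle, so
that the triangles of the surface can be added up for every `x` that lies on no edge at all, hence
for almost every `x`. The line integrals over interior edges cancel in pairs
(`sum_faceLineIntegral`); conformity and coherent orientation make the triangle on the other side of
an edge unique (`oppositeEdges_unique`).

The identity is then integrated against `v ∈ L²`, for which all five terms have to be square
integrable in `x`. The surface integrals are bounded uniformly in `x`: the parametrizations are
bi-Lipschitz (`exists_lower_lipschitz`), and comparison with the point of the triangle that is
nearest to `x` bounds the kernels by functions of the parameters alone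
(`exists_integral_weakKernel_le`, `exists_integral_solidAngle_le`). The line integrals have a
logarithmic singularity at the edges. They are square integrable because
`r⁻¹ r'⁻¹ ≤ C |t - t'|^(-1/2) (r^(-3/2) + r'^(-3/2))` for two points of an edge with parameters
`t`, `t'` (`inv_mul_inv_le`), where the last factor has bounded integrals over the surface
(`lintegral_sq_edge_lt_top`).
-/

/-! ### Vector algebra in three-space -/

lemma inner_eq_sum3 (a b : E3) : ⟪a, b⟫ = a 0 * b 0 + a 1 * b 1 + a 2 * b 2 := by
  simp [PiLp.inner_apply, Fin.sum_univ_three, mul_comm]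

@[simp] lemma cross_apply_zero (a b : E3) : cross a b 0 = a 1 * b 2 - a 2 * b 1 := by
  simp [cross, crossProduct]

@[simp] lemma cross_apply_one (a b : E3) : cross a b 1 = a 2 * b 0 - a 0 * b 2 := by
  simp [cross, crossProduct]

@[simp] lemma cross_apply_two (a b : E3) : cross a b 2 = a 0 * b 1 - a 1 * b 0 := by
  simp [cross, crossProduct]

lemma e3_ext {a b : E3} (h0 : a 0 = b 0) (h1 : a 1 = b 1) (h2 : a 2 = b 2) : a = b := by
  ext i; fin_cases i <;> assumption

/-- The cross product as a continuous bilinear map. -/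
noncomputable def crossL : E3 →L[ℝ] E3 →L[ℝ] E3 :=
  LinearMap.toContinuousBilinearMap <| LinearMap.mk₂ ℝ cross
    (fun a b c => by apply e3_ext <;> simp <;> ring)
    (fun a b c => by apply e3_ext <;> simp <;> ring)
    (fun a b c => by apply e3_ext <;> simp <;> ring)
    (fun a b c => by apply e3_ext <;> simp <;> ring)

lemma crossL_apply (a b : E3) : crossL a b = cross a b := rfl

lemma continuous_cross : Continuous fun q : E3 × E3 => cross q.1 q.2 :=
  crossL.continuous₂

lemma ContinuousOn.cross {α : Type*} [TopologicalSpace α] {f g : α → E3} {s : Set α}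
    (hf : ContinuousOn f s) (hg : ContinuousOn g s) :
    ContinuousOn (fun a => _root_.cross (f a) (g a)) s :=
  continuous_cross.comp_continuousOn (hf.prodMk hg)

lemma MeasureTheory.AEStronglyMeasurable.cross {α : Type*} [MeasurableSpace α] {m : Measure α}
    {f g : α → E3} (hf : AEStronglyMeasurable f m) (hg : AEStronglyMeasurable g m) :
    AEStronglyMeasurable (fun a => _root_.cross (f a) (g a)) m :=
  continuous_cross.comp_aestronglyMeasurable (hf.prodMk hg)

lemma norm_cross_le (a b : E3) : ‖cross a b‖ ≤ ‖a‖ * ‖b‖ := by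
  have h : ‖cross a b‖ ^ 2 = ‖a‖ ^ 2 * ‖b‖ ^ 2 - ⟪a, b⟫ ^ 2 := by
    simp only [← real_inner_self_eq_norm_sq, inner_eq_sum3, cross_apply_zero, cross_apply_one,
      cross_apply_two]
    ring
  refine le_of_sq_le_sq ?_ (by positivity)
  nlinarith [sq_nonneg ⟪a, b⟫]

lemma inner_cross_left (a b : E3) : ⟪cross a b, a⟫ = 0 := by
  simp only [inner_eq_sum3, cross_apply_zero, cross_apply_one, cross_apply_two]; ring

lemma inner_cross_right (a b : E3) : ⟪cross a b, b⟫ = 0 := by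
  simp only [inner_eq_sum3, cross_apply_zero, cross_apply_one, cross_apply_two]; ring

/-- The cross product of two linearly independent vectors does not vanish. -/
lemma cross_ne_zero {a b : E3} (h : ∀ s t : ℝ, s • a + t • b = 0 → s = 0 ∧ t = 0) :
    cross a b ≠ 0 := by
  intro h0
  have c0 : a 1 * b 2 - a 2 * b 1 = 0 := by rw [← cross_apply_zero, h0]; rfl
  have c1 : a 2 * b 0 - a 0 * b 2 = 0 := by rw [← cross_apply_one, h0]; rfl
  have c2 : a 0 * b 1 - a 1 * b 0 = 0 := by rw [← cross_apply_two, h0]; rfl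
  have key : ∀ i : Fin 3, a i = 0 := by
    intro i
    have := (h (b i) (-a i) (by
      apply e3_ext <;> fin_cases i <;> simp <;> linarith)).2
    linarith
  have ha : a = 0 := e3_ext (key 0) (key 1) (key 2)
  have := (h 1 0 (by simp [ha])).1
  norm_num at this

/-! ### The reference triangle -/

lemma isClosed_refTriangle : IsClosed refTriangle :=
  (isClosed_le continuous_const continuous_fst).inter
    ((isClosed_le continuous_const continuous_snd).inter
      (isClosed_le (continuous_fst.add continuous_snd) continuous_const))

lemma refTriangle_subset_Icc : refTriangle ⊆ Icc (0, 0) (1, 1) := by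
  rintro ⟨s, t⟩ ⟨h1, h2, h3⟩
  simp only at h1 h2 h3
  exact ⟨⟨h1, h2⟩, ⟨by simp only; linarith, by simp only; linarith⟩⟩

lemma isCompact_refTriangle : IsCompact refTriangle :=
  isCompact_Icc.of_isClosed_subset isClosed_refTriangle refTriangle_subset_Icc

lemma measurableSet_refTriangle : MeasurableSet refTriangle := isClosed_refTriangle.measurableSet

lemma convex_refTriangle : Convex ℝ refTriangle := by
  rintro ⟨s, t⟩ ⟨h1, h2, h3⟩ ⟨s', t'⟩ ⟨h1', h2', h3'⟩ a b ha hb hab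
  simp only at h1 h2 h3 h1' h2' h3'
  refine ⟨?_, ?_, ?_⟩ <;> simp
  · positivity
  · positivity
  · nlinarith

/-- The open reference triangle. -/
def refInterior : Set (ℝ × ℝ) := {p | 0 < p.1 ∧ 0 < p.2 ∧ p.1 + p.2 < 1}

lemma isOpen_refInterior : IsOpen refInterior :=
  (isOpen_lt continuous_const continuous_fst).inter
    ((isOpen_lt continuous_const continuous_snd).inter
      (isOpen_lt (continuous_fst.add continuous_snd) continuous_const))

lemma refInterior_subset : refInterior ⊆ refTriangle := fun _ h => ⟨h.1.le, h.2.1.le, h.2.2.le⟩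

lemma refTriangle_mem_nhds {p : ℝ × ℝ} (hp : p ∈ refInterior) : refTriangle ∈ 𝓝 p :=
  mem_of_superset (isOpen_refInterior.mem_nhds hp) refInterior_subset

lemma uniqueDiffOn_refTriangle : UniqueDiffOn ℝ refTriangle :=
  uniqueDiffOn_convex convex_refTriangle
    ⟨(1/4, 1/4), mem_interior_iff_mem_nhds.2 (refTriangle_mem_nhds (by norm_num [refInterior]))⟩

lemma volume_refTriangle_lt_top : volume refTriangle < ⊤ := isCompact_refTriangle.measure_lt_top

/-- The direction of the edge `i` of the reference triangle. -/
def refDir (i : Fin 3) : ℝ × ℝ := refVertex (i + 1) - refVertex i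

lemma refEdge_eq (i : Fin 3) (t : ℝ) : refEdge i t = refVertex i + t • refDir i := by
  simp [refEdge, AffineMap.lineMap_apply, refDir, add_comm]

lemma refEdge_zero (t : ℝ) : refEdge 0 t = (t, 0) := by
  simp [refEdge_eq, refDir, refVertex]

lemma refEdge_one (t : ℝ) : refEdge 1 t = (1 - t, t) := by
  simp [refEdge_eq, refDir, refVertex]; ring

lemma refEdge_two (t : ℝ) : refEdge 2 t = (0, 1 - t) := by
  simp [refEdge_eq, refDir, refVertex]; ring

lemma refDir_zero : refDir 0 = (1, 0) := by simp [refDir, refVertex]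

lemma refDir_one : refDir 1 = (-1, 1) := by simp [refDir, refVertex]

lemma refDir_two : refDir 2 = (0, -1) := by simp [refDir, refVertex]

lemma refEdge_mem (i : Fin 3) {t : ℝ} (ht : t ∈ Icc (0 : ℝ) 1) : refEdge i t ∈ refTriangle := by
  obtain ⟨h0, h1⟩ := ht
  fin_cases i
  · simp [refEdge_zero, refTriangle, h0, h1]
  · simp [refEdge_one, refTriangle, h0, h1]
  · simp [refEdge_two, refTriangle, h0, h1]

lemma continuous_refEdge (i : Fin 3) : Continuous (refEdge i) := by
  have : refEdge i = fun t => refVertex i + t • refDir i := funext (refEdge_eq i)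
  rw [this]; fun_prop

lemma hasDerivAt_refEdge (i : Fin 3) (t : ℝ) : HasDerivAt (refEdge i) (refDir i) t := by
  have : refEdge i = fun t => refVertex i + t • refDir i := funext (refEdge_eq i)
  rw [this]
  simpa using ((hasDerivAt_id t).smul_const (refDir i)).const_add (refVertex i)

/-! ### Stokes' theorem on a parametrized triangle -/

lemma integral_refTriangle_fst {g : ℝ × ℝ → ℝ} (hg : IntegrableOn g refTriangle) :
    ∫ p in refTriangle, g p = ∫ t in (0 : ℝ)..1, ∫ s in (0 : ℝ)..(1 - t), g (s, t) := by
  rw [← integral_indicator measurableSet_refTriangle,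
    Measure.volume_eq_prod, integral_prod_symm _
      ((integrable_indicator_iff measurableSet_refTriangle).2 hg),
    intervalIntegral.integral_of_le zero_le_one, ← integral_Icc_eq_integral_Ioc,
    ← integral_indicator measurableSet_Icc]
  congr 1
  ext t
  by_cases ht : t ∈ Icc (0 : ℝ) 1
  · rw [indicator_of_mem ht, intervalIntegral.integral_of_le (by linarith [ht.2]),
      ← integral_Icc_eq_integral_Ioc, ← integral_indicator measurableSet_Icc]
    congr 1
    ext s
    by_cases hs : s ∈ Icc (0 : ℝ) (1 - t)
    · rw [indicator_of_mem hs, indicator_of_mem]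
      exact ⟨hs.1, ht.1, by simp only; linarith [hs.2]⟩
    · rw [indicator_of_notMem hs, indicator_of_notMem]
      exact fun h => hs ⟨h.1, by linarith [h.2.2]⟩
  · rw [indicator_of_notMem ht]
    have : (fun s => refTriangle.indicator g (s, t)) = 0 := by
      ext s
      rw [indicator_of_notMem]
      · rfl
      · exact fun h => ht ⟨h.2.1, by have := h.1; have := h.2.2; simp only at *; linarith⟩
    simp [this]

lemma refTriangle_swap (p : ℝ × ℝ) : p.swap ∈ refTriangle ↔ p ∈ refTriangle := by
  simp only [refTriangle, mem_ofPred_eq, Prod.fst_swap, Prod.snd_swap, add_comm p.2 p.1]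
  tauto

lemma integral_refTriangle_snd {g : ℝ × ℝ → ℝ} (hg : IntegrableOn g refTriangle) :
    ∫ p in refTriangle, g p = ∫ s in (0 : ℝ)..1, ∫ t in (0 : ℝ)..(1 - s), g (s, t) := by
  have hpre : Prod.swap ⁻¹' refTriangle = refTriangle := by
    ext p; exact refTriangle_swap p
  have hmp : MeasurePreserving (Prod.swap : ℝ × ℝ → ℝ × ℝ) volume volume := by
    simpa [Measure.volume_eq_prod] using
      (Measure.measurePreserving_swap (μ := (volume : Measure ℝ)) (ν := (volume : Measure ℝ)))
  have hemb : MeasurableEmbedding (Prod.swap : ℝ × ℝ → ℝ × ℝ) :=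
    MeasurableEquiv.prodComm.measurableEmbedding
  have h1 := hmp.setIntegral_preimage_emb hemb g refTriangle
  have h2 : IntegrableOn (g ∘ Prod.swap) refTriangle := by
    have := (hmp.integrableOn_comp_preimage hemb (f := g) (s := refTriangle)).2 hg
    rwa [hpre] at this
  rw [← h1, hpre]
  exact integral_refTriangle_fst h2

/-- A function with a derivative that is continuous up to the boundary of the reference triangle,
integrated along the horizontal lines. -/
lemma integral_deriv_fst {F : ℝ × ℝ → ℝ} {F' : ℝ × ℝ → ℝ × ℝ →L[ℝ] ℝ}
    (hF : ∀ p ∈ refTriangle, HasFDerivWithinAt F (F' p) refTriangle p)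
    (hF' : ContinuousOn F' refTriangle) :
    ∫ p in refTriangle, F' p (1, 0) = ∫ t in (0 : ℝ)..1, (F (1 - t, t) - F (0, t)) := by
  have hc : ContinuousOn (fun p => F' p (1, 0)) refTriangle := hF'.clm_apply continuousOn_const
  rw [integral_refTriangle_fst (hc.integrableOn_compact isCompact_refTriangle)]
  refine intervalIntegral.integral_congr_ae ?_
  have h1 : ∀ᵐ t : ℝ, t ≠ 1 := by simp [ae_iff]
  filter_upwards [h1] with t ht1 ht
  rw [uIoc_of_le zero_le_one] at ht
  have ht' : 0 < 1 - t := by rcases ht.2.lt_or_eq with h | h; · linarith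
                             · exact absurd h ht1
  have hmaps : MapsTo (fun s : ℝ => (s, t)) (Icc 0 (1 - t)) refTriangle :=
    fun s hs => ⟨hs.1, ht.1.le, by simp only; linarith [hs.2]⟩
  have hcont : ContinuousOn (fun s : ℝ => (s, t)) (Icc 0 (1 - t)) := by fun_prop
  refine intervalIntegral.integral_eq_sub_of_hasDerivAt_of_le (f := fun s => F (s, t)) ht'.le ?_
    ?_ ?_
  · exact ContinuousOn.comp (t := refTriangle) (fun p hp => (hF p hp).continuousWithinAt) hcont
      hmaps
  · intro s hs
    have hp : (s, t) ∈ refInterior := ⟨hs.1, ht.1, by simp only; linarith [hs.2]⟩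
    have hd := (hF _ (refInterior_subset hp)).hasFDerivAt (refTriangle_mem_nhds hp)
    have hl : HasDerivAt (fun s : ℝ => (s, t)) (1, 0) s :=
      (hasDerivAt_id s).prodMk (hasDerivAt_const s t)
    exact hd.comp_hasDerivAt s hl
  · refine ContinuousOn.intervalIntegrable ?_
    rw [uIcc_of_le ht'.le]
    exact hc.comp hcont hmaps

lemma integral_deriv_snd {F : ℝ × ℝ → ℝ} {F' : ℝ × ℝ → ℝ × ℝ →L[ℝ] ℝ}
    (hF : ∀ p ∈ refTriangle, HasFDerivWithinAt F (F' p) refTriangle p)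
    (hF' : ContinuousOn F' refTriangle) :
    ∫ p in refTriangle, F' p (0, 1) = ∫ s in (0 : ℝ)..1, (F (s, 1 - s) - F (s, 0)) := by
  have hc : ContinuousOn (fun p => F' p (0, 1)) refTriangle := hF'.clm_apply continuousOn_const
  rw [integral_refTriangle_snd (hc.integrableOn_compact isCompact_refTriangle)]
  refine intervalIntegral.integral_congr_ae ?_
  have h1 : ∀ᵐ t : ℝ, t ≠ 1 := by simp [ae_iff]
  filter_upwards [h1] with s hs1 hs
  rw [uIoc_of_le zero_le_one] at hs
  have hs' : 0 < 1 - s := by rcases hs.2.lt_or_eq with h | h; · linarith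
                             · exact absurd h hs1
  have hmaps : MapsTo (fun t : ℝ => (s, t)) (Icc 0 (1 - s)) refTriangle :=
    fun t ht => ⟨hs.1.le, ht.1, by simp only; linarith [ht.2]⟩
  have hcont : ContinuousOn (fun t : ℝ => (s, t)) (Icc 0 (1 - s)) := by fun_prop
  refine intervalIntegral.integral_eq_sub_of_hasDerivAt_of_le (f := fun t => F (s, t)) hs'.le ?_
    ?_ ?_
  · exact ContinuousOn.comp (t := refTriangle) (fun p hp => (hF p hp).continuousWithinAt) hcont
      hmaps
  · intro t ht
    have hp : (s, t) ∈ refInterior := ⟨hs.1, ht.1, by simp only; linarith [ht.2]⟩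
    have hd := (hF _ (refInterior_subset hp)).hasFDerivAt (refTriangle_mem_nhds hp)
    have hl : HasDerivAt (fun t : ℝ => (s, t)) (0, 1) t :=
      (hasDerivAt_const t s).prodMk (hasDerivAt_id t)
    exact hd.comp_hasDerivAt t hl
  · refine ContinuousOn.intervalIntegrable ?_
    rw [uIcc_of_le hs'.le]
    exact hc.comp hcont hmaps

/-- The first tangent vector `∂₁φ` of a parametrization `φ`. -/
noncomputable def tan₁ (φ : ℝ × ℝ → E3) (p : ℝ × ℝ) : E3 := fderiv ℝ φ p (1, 0)

/-- The second tangent vector `∂₂φ` of a parametrization `φ`. -/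
noncomputable def tan₂ (φ : ℝ × ℝ → E3) (p : ℝ × ℝ) : E3 := fderiv ℝ φ p (0, 1)

/-- The normal vector `∂₁φ × ∂₂φ` of a parametrization `φ`. -/
noncomputable def nvec (φ : ℝ × ℝ → E3) (p : ℝ × ℝ) : E3 := cross (tan₁ φ p) (tan₂ φ p)

/-- The integral `∮ V · dζ` of a vector field `V` along the positively oriented boundary of a
parametrized triangle; the field is given in terms of the parameters. -/
noncomputable def circulation (φ : ℝ × ℝ → E3) (V : ℝ × ℝ → E3) : ℝ :=
  ∑ i, ∫ t in (0 : ℝ)..1, ⟪V (refEdge i t), deriv (fun τ => φ (refEdge i τ)) t⟫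

section Stokes

variable {φ : ℝ × ℝ → E3}

lemma contDiff_fderiv (hφ : ContDiff ℝ 2 φ) : ContDiff ℝ 1 (fderiv ℝ φ) :=
  hφ.fderiv_right (by norm_num)

lemma contDiff_tan₁ (hφ : ContDiff ℝ 2 φ) : ContDiff ℝ 1 (tan₁ φ) :=
  (contDiff_fderiv hφ).clm_apply contDiff_const

lemma contDiff_tan₂ (hφ : ContDiff ℝ 2 φ) : ContDiff ℝ 1 (tan₂ φ) :=
  (contDiff_fderiv hφ).clm_apply contDiff_const

lemma contDiff_nvec (hφ : ContDiff ℝ 2 φ) : ContDiff ℝ 1 (nvec φ) :=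
  (crossL.isBoundedBilinearMap.contDiff).comp ((contDiff_tan₁ hφ).prodMk (contDiff_tan₂ hφ))

lemma fderiv_apply_eq_tan (p : ℝ × ℝ) (a b : ℝ) :
    fderiv ℝ φ p (a, b) = a • tan₁ φ p + b • tan₂ φ p := by
  have : ((a, b) : ℝ × ℝ) = a • (1, 0) + b • (0, 1) := by simp
  rw [this, map_add, map_smul, map_smul]; rfl

lemma deriv_edge (hφ : ContDiff ℝ 2 φ) (i : Fin 3) (t : ℝ) :
    deriv (fun τ => φ (refEdge i τ)) t = fderiv ℝ φ (refEdge i t) (refDir i) :=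
  ((hφ.differentiable (by norm_num) _).hasFDerivAt.comp_hasDerivAt t
    (hasDerivAt_refEdge i t)).deriv

lemma continuous_deriv_edge (hφ : ContDiff ℝ 2 φ) (i : Fin 3) :
    Continuous (deriv (fun τ => φ (refEdge i τ))) := by
  have : deriv (fun τ => φ (refEdge i τ)) = fun t => fderiv ℝ φ (refEdge i t) (refDir i) :=
    funext (deriv_edge hφ i)
  rw [this]
  exact ((contDiff_fderiv hφ).continuous.comp (continuous_refEdge i)).clm_apply continuous_const

/-- Stokes' theorem. The mixed second derivatives of the parametrization cancel, which is why it
has to be twice continuously differentiable. -/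
theorem stokes_triangle (hφ : ContDiff ℝ 2 φ) {V : ℝ × ℝ → E3} {V' : ℝ × ℝ → ℝ × ℝ →L[ℝ] E3}
    (hV : ∀ p ∈ refTriangle, HasFDerivWithinAt V (V' p) refTriangle p)
    (hV' : ContinuousOn V' refTriangle) :
    ∫ p in refTriangle, (⟪V' p (1, 0), tan₂ φ p⟫ - ⟪V' p (0, 1), tan₁ φ p⟫) = circulation φ V := by
  have hVc : ContinuousOn V refTriangle := fun p hp => (hV p hp).continuousWithinAt
  -- the product rule for `⟪V, ψ⟫`, `ψ` a tangent vector
  have prod : ∀ ψ : ℝ × ℝ → E3, ContDiff ℝ 1 ψ →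
      (∀ p ∈ refTriangle, HasFDerivWithinAt (fun p => ⟪V p, ψ p⟫)
        ((fderivInnerCLM ℝ (V p, ψ p)).comp ((V' p).prod (fderiv ℝ ψ p))) refTriangle p) ∧
      ContinuousOn (fun p => (fderivInnerCLM ℝ (V p, ψ p)).comp ((V' p).prod (fderiv ℝ ψ p)))
        refTriangle := by
    intro ψ hψ
    refine ⟨fun p hp => (hV p hp).inner ℝ
      (hψ.differentiable (by norm_num) p).hasFDerivAt.hasFDerivWithinAt, ?_⟩
    have h1 : Continuous fun q : E3 × E3 => fderivInnerCLM ℝ q :=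
      (isBoundedBilinearMap_inner (𝕜 := ℝ) (E := E3)).isBoundedLinearMap_deriv.continuous
    have h2 := hψ.continuous.continuousOn (s := refTriangle)
    have h3 := (hψ.continuous_fderiv (by norm_num)).continuousOn (s := refTriangle)
    have h4 : ContinuousOn (fun p => (V' p).prod (fderiv ℝ ψ p)) refTriangle :=
      (ContinuousLinearMap.prodₗᵢ ℝ).continuous.comp_continuousOn (hV'.prodMk h3)
    exact (h1.comp_continuousOn (hVc.prodMk h2)).clm_comp h4
  obtain ⟨hP, hPc⟩ := prod _ (contDiff_tan₂ hφ)
  obtain ⟨hQ, hQc⟩ := prod _ (contDiff_tan₁ hφ)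
  have e1 := integral_deriv_fst hP hPc
  have e2 := integral_deriv_snd hQ hQc
  have i1 : IntegrableOn (fun p => ((fderivInnerCLM ℝ (V p, tan₂ φ p)).comp
      ((V' p).prod (fderiv ℝ (tan₂ φ) p))) (1, 0)) refTriangle :=
    (hPc.clm_apply continuousOn_const).integrableOn_compact isCompact_refTriangle
  have i2 : IntegrableOn (fun p => ((fderivInnerCLM ℝ (V p, tan₁ φ p)).comp
      ((V' p).prod (fderiv ℝ (tan₁ φ) p))) (0, 1)) refTriangle :=
    (hQc.clm_apply continuousOn_const).integrableOn_compact isCompact_refTriangle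
  have hsymm : ∀ p, fderiv ℝ (tan₂ φ) p (1, 0) = fderiv ℝ (tan₁ φ) p (0, 1) := by
    intro p
    have hd : DifferentiableAt ℝ (fderiv ℝ φ) p :=
      (contDiff_fderiv hφ).differentiable (by norm_num) p
    have h1 : ∀ a b : ℝ × ℝ, fderiv ℝ (fun q => fderiv ℝ φ q a) p b
        = fderiv ℝ (fderiv ℝ φ) p b a := by
      intro a b
      rw [fderiv_clm_apply hd (differentiableAt_const a)]
      simp
    have hs : IsSymmSndFDerivAt ℝ φ p := hφ.contDiffAt.isSymmSndFDerivAt (by simp)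
    change fderiv ℝ (fun q => fderiv ℝ φ q (0, 1)) p (1, 0)
      = fderiv ℝ (fun q => fderiv ℝ φ q (1, 0)) p (0, 1)
    rw [h1, h1]
    exact hs.eq _ _
  have hint : ∀ p, ⟪V' p (1, 0), tan₂ φ p⟫ - ⟪V' p (0, 1), tan₁ φ p⟫
      = ((fderivInnerCLM ℝ (V p, tan₂ φ p)).comp ((V' p).prod (fderiv ℝ (tan₂ φ) p))) (1, 0)
        - ((fderivInnerCLM ℝ (V p, tan₁ φ p)).comp
          ((V' p).prod (fderiv ℝ (tan₁ φ) p))) (0, 1) := by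
    intro p
    simp only [ContinuousLinearMap.comp_apply, ContinuousLinearMap.prod_apply,
      fderivInnerCLM_apply, hsymm]
    ring
  simp only [hint]
  rw [integral_sub i1 i2, e1, e2, circulation, Fin.sum_univ_three]
  simp only [deriv_edge hφ]
  simp only [refEdge_zero, refEdge_one, refEdge_two, refDir_zero, refDir_one,
    refDir_two, fderiv_apply_eq_tan]
  have c1 := (contDiff_tan₁ hφ).continuous
  have c2 := (contDiff_tan₂ hφ).continuous
  have cV : ∀ (i : Fin 3) (ψ : ℝ × ℝ → E3), Continuous ψ →
      IntervalIntegrable (fun t => ⟪V (refEdge i t), ψ (refEdge i t)⟫) volume 0 1 := by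
    intro i ψ hψ
    refine ContinuousOn.intervalIntegrable ?_
    rw [uIcc_of_le zero_le_one]
    exact (hVc.comp (continuous_refEdge i).continuousOn fun t ht => refEdge_mem i ht).inner
      (hψ.comp (continuous_refEdge i)).continuousOn
  have a0 := cV 0 _ c1
  have a1 := cV 1 _ c1
  have a1' := cV 1 _ c2
  have a2 := cV 2 _ c2
  simp only [refEdge_zero, refEdge_one, refEdge_two] at a0 a1 a1' a2
  have b2 : IntervalIntegrable (fun t => ⟪V (0, t), tan₂ φ (0, t)⟫) volume 0 1 := by
    simpa using (a2.comp_sub_left 1).symm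
  have b1 : IntervalIntegrable (fun t => ⟪V (t, 1 - t), tan₁ φ (t, 1 - t)⟫) volume 0 1 := by
    simpa using (a1.comp_sub_left 1).symm
  have f2 : ∫ t in (0:ℝ)..1, ⟪V (0, 1 - t), tan₂ φ (0, 1 - t)⟫
      = ∫ t in (0:ℝ)..1, ⟪V (0, t), tan₂ φ (0, t)⟫ := by
    simpa using intervalIntegral.integral_comp_sub_left
      (fun t => ⟪V (0, t), tan₂ φ (0, t)⟫) (a := 0) (b := 1) 1
  have f1 : ∫ t in (0:ℝ)..1, ⟪V (1 - t, t), tan₁ φ (1 - t, t)⟫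
      = ∫ t in (0:ℝ)..1, ⟪V (t, 1 - t), tan₁ φ (t, 1 - t)⟫ := by
    simpa using intervalIntegral.integral_comp_sub_left
      (fun t => ⟪V (t, 1 - t), tan₁ φ (t, 1 - t)⟫) (a := 0) (b := 1) 1
  simp only [inner_add_right, inner_smul_right, one_mul, zero_mul, add_zero, zero_add, neg_mul,
    neg_add_eq_sub]
  rw [intervalIntegral.integral_sub a1' b2, intervalIntegral.integral_sub b1 a0,
    intervalIntegral.integral_sub a1' a1, intervalIntegral.integral_neg, f2, f1]
  ring

end Stokes

/-! ### Integration by parts with Günter derivatives -/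

/-- The Günter derivative of a field `w` on a parametrized triangle, multiplied by the area density:
`∂₂w × ∂₁φ - ∂₁w × ∂₂φ`, the derivative `w'` of the field being taken in the parameters. -/
noncomputable def gunterDensity (φ : ℝ × ℝ → E3) (w' : ℝ × ℝ → ℝ × ℝ →L[ℝ] E3) (p : ℝ × ℝ) : E3 :=
  cross (w' p (0, 1)) (tan₁ φ p) - cross (w' p (1, 0)) (tan₂ φ p)

section IntegrationByParts

variable {φ : ℝ × ℝ → E3} {w : ℝ × ℝ → E3} {w' : ℝ × ℝ → ℝ × ℝ →L[ℝ] E3}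

lemma continuousOn_gunterDensity (hφ : ContDiff ℝ 2 φ) (hw' : ContinuousOn w' refTriangle) :
    ContinuousOn (gunterDensity φ w') refTriangle :=
  ((hw'.clm_apply continuousOn_const).cross (contDiff_tan₁ hφ).continuous.continuousOn).sub
    ((hw'.clm_apply continuousOn_const).cross (contDiff_tan₂ hφ).continuous.continuousOn)

/-- Integration by parts for a continuously differentiable field `G` on `ℝ³`: Stokes' theorem for
the field `G × w`. -/
theorem integral_gunter_by_parts (hφ : ContDiff ℝ 2 φ)
    (hw : ∀ p ∈ refTriangle, HasFDerivWithinAt w (w' p) refTriangle p)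
    (hw' : ContinuousOn w' refTriangle) {G : E3 → E3} {G' : E3 → E3 →L[ℝ] E3}
    (hG : ∀ y, HasFDerivAt G (G' y) y) (hG' : Continuous G') :
    ∫ p in refTriangle, (⟪cross (G' (φ p) (tan₁ φ p)) (w p), tan₂ φ p⟫
        - ⟪cross (G' (φ p) (tan₂ φ p)) (w p), tan₁ φ p⟫)
      = circulation φ (fun p => cross (G (φ p)) (w p))
        + ∫ p in refTriangle, ⟪gunterDensity φ w' p, G (φ p)⟫ := by
  have hwc : ContinuousOn w refTriangle := fun p hp => (hw p hp).continuousWithinAt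
  have hGc : Continuous G := continuous_iff_continuousAt.2 fun y => (hG y).continuousAt
  have hφc := hφ.continuous
  have c1 := (contDiff_tan₁ hφ).continuous
  have c2 := (contDiff_tan₂ hφ).continuous
  let V' : ℝ × ℝ → ℝ × ℝ →L[ℝ] E3 := fun p =>
    (crossL (G (φ p))).comp (w' p) + (crossL.flip (w p)).comp ((G' (φ p)).comp (fderiv ℝ φ p))
  have hV : ∀ p ∈ refTriangle,
      HasFDerivWithinAt (fun p => cross (G (φ p)) (w p)) (V' p) refTriangle p := by
    intro p hp
    have h1 : HasFDerivWithinAt (fun p => G (φ p)) ((G' (φ p)).comp (fderiv ℝ φ p))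
        refTriangle p :=
      ((hG (φ p)).comp p (hφ.differentiable (by norm_num) p).hasFDerivAt).hasFDerivWithinAt
    exact (crossL.hasFDerivWithinAt_of_bilinear h1 (hw p hp)).congr_fderiv
      (ContinuousLinearMap.ext fun v => rfl)
  have hV' : ContinuousOn V' refTriangle := by
    refine ContinuousOn.add ?_ ?_
    · exact (crossL.continuous.comp (hGc.comp hφc)).continuousOn.clm_comp hw'
    · refine (crossL.flip.continuous.comp_continuousOn hwc).clm_comp ?_
      exact ((hG'.comp hφc).clm_comp (contDiff_fderiv hφ).continuous).continuousOn
  rw [← stokes_triangle hφ hV hV', ← integral_add]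
  · refine integral_congr_ae (Eventually.of_forall fun p => ?_)
    simp only [V', gunterDensity, _root_.add_apply, ContinuousLinearMap.comp_apply,
      ContinuousLinearMap.flip_apply, crossL_apply, ← tan₁.eq_1 φ p, ← tan₂.eq_1 φ p]
    simp only [inner_eq_sum3, cross_apply_zero, cross_apply_one, cross_apply_two, PiLp.add_apply,
      PiLp.sub_apply]
    ring
  · refine ContinuousOn.integrableOn_compact isCompact_refTriangle ?_
    exact ((hV'.clm_apply continuousOn_const).inner c2.continuousOn).sub
      ((hV'.clm_apply continuousOn_const).inner c1.continuousOn)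
  · refine ContinuousOn.integrableOn_compact isCompact_refTriangle ?_
    exact (continuousOn_gunterDensity hφ hw').inner (hGc.comp hφc).continuousOn

lemma hasFDerivAt_comp_norm_sub_sq {h : ℝ → ℝ} {d : ℝ} (x y : E3)
    (hh : HasDerivAt h d (‖x - y‖ ^ 2)) :
    HasFDerivAt (fun y => h (‖x - y‖ ^ 2)) ((-2 * d) • innerSL ℝ (x - y)) y := by
  have h1 : HasFDerivAt (fun y : E3 => x - y) (-ContinuousLinearMap.id ℝ E3) y :=
    (hasFDerivAt_id y).const_sub x
  have h2 := h1.norm_sq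
  refine (hh.comp_hasFDerivAt y h2).congr_fderiv ?_
  ext v
  simp
  ring

lemma continuous_comp_norm_sub_sq {h : ℝ → ℝ} (hh : ContinuousOn h (Ici 0)) (x : E3) :
    Continuous fun y : E3 => h (‖x - y‖ ^ 2) :=
  hh.comp_continuous (by fun_prop) fun y => mem_Ici.2 (sq_nonneg _)

/-- Integration by parts with a radial function `h(|x - y|²)`. -/
theorem integral_by_parts_radial (hφ : ContDiff ℝ 2 φ)
    (hw : ∀ p ∈ refTriangle, HasFDerivWithinAt w (w' p) refTriangle p)
    (hw' : ContinuousOn w' refTriangle) (x b : E3) {h h' : ℝ → ℝ}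
    (hh : ∀ q, 0 ≤ q → HasDerivAt h (h' q) q) (hh' : ContinuousOn h' (Ici 0)) :
    ∫ p in refTriangle, -2 * h' (‖x - φ p‖ ^ 2) *
        (⟪nvec φ p, b⟫ * ⟪x - φ p, w p⟫ - ⟪nvec φ p, w p⟫ * ⟪x - φ p, b⟫)
      = circulation φ (fun p => h (‖x - φ p‖ ^ 2) • cross b (w p))
        + ∫ p in refTriangle, h (‖x - φ p‖ ^ 2) * ⟪gunterDensity φ w' p, b⟫ := by
  have key := integral_gunter_by_parts hφ hw hw' (G := fun y => h (‖x - y‖ ^ 2) • b)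
    (G' := fun y => ((-2 * h' (‖x - y‖ ^ 2)) • innerSL ℝ (x - y)).smulRight b)
    (fun y => (hasFDerivAt_comp_norm_sub_sq x y (hh _ (sq_nonneg _))).smul_const b) (by
      have := continuous_comp_norm_sub_sq hh' x
      have aux : ∀ H : E3 → ℝ, Continuous H → Continuous fun y => (-2 * H y) • innerSL ℝ (x - y) :=
        fun H hH => by fun_prop
      exact (ContinuousLinearMap.smulRightL ℝ E3 E3).continuous₂.comp
        ((aux _ this).prodMk continuous_const))
  have e1 : ∀ p, cross (h (‖x - φ p‖ ^ 2) • b) (w p) = h (‖x - φ p‖ ^ 2) • cross b (w p) := by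
    intro p; apply e3_ext <;> simp <;> ring
  simp only [e1, inner_smul_right] at key
  rw [← key]
  refine integral_congr_ae (Eventually.of_forall fun p => ?_)
  simp only [ContinuousLinearMap.smulRight_apply, _root_.smul_apply, innerSL_apply_apply,
    nvec, inner_eq_sum3, cross_apply_zero, cross_apply_one, cross_apply_two, PiLp.smul_apply,
    smul_eq_mul]
  ring

/-- Integration by parts with the dyad `g(|x - y|²) (x - y) ⊗ (x - y)`. In the derivative, the terms
other than the last one carry the factor `(x - y) · n`. -/
theorem integral_by_parts_dyad (hφ : ContDiff ℝ 2 φ)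
    (hw : ∀ p ∈ refTriangle, HasFDerivWithinAt w (w' p) refTriangle p)
    (hw' : ContinuousOn w' refTriangle) (x b : E3) {g g' : ℝ → ℝ}
    (hg : ∀ q, 0 ≤ q → HasDerivAt g (g' q) q) (hg' : ContinuousOn g' (Ici 0)) :
    ∫ p in refTriangle, (⟪nvec φ p, x - φ p⟫ * (-2 * g' (‖x - φ p‖ ^ 2) *
          (⟪x - φ p, b⟫ * ⟪x - φ p, w p⟫) - g (‖x - φ p‖ ^ 2) * ⟪w p, b⟫)
        + ⟪nvec φ p, w p⟫ * ⟪x - φ p, b⟫ *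
          (3 * g (‖x - φ p‖ ^ 2) + 2 * ‖x - φ p‖ ^ 2 * g' (‖x - φ p‖ ^ 2)))
      = circulation φ (fun p => (g (‖x - φ p‖ ^ 2) * ⟪x - φ p, b⟫) • cross (x - φ p) (w p))
        + ∫ p in refTriangle, g (‖x - φ p‖ ^ 2) * ⟪x - φ p, b⟫ *
          ⟪gunterDensity φ w' p, x - φ p⟫ := by
  have hgc := continuous_comp_norm_sub_sq
    (fun q hq => (hg q hq).continuousAt.continuousWithinAt : ContinuousOn g (Ici 0)) x
  have hgc' := continuous_comp_norm_sub_sq hg' x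
  have hz : ∀ y, HasFDerivAt (fun y : E3 => x - y) (-ContinuousLinearMap.id ℝ E3) y :=
    fun y => (hasFDerivAt_id y).const_sub x
  have hzb : ∀ y, HasFDerivAt (fun y : E3 => ⟪x - y, b⟫) (-innerSL ℝ b) y := fun y =>
    ((innerSL ℝ b).hasFDerivAt.comp y (hz y)).congr_of_eventuallyEq
      (Eventually.of_forall fun y => by simp [real_inner_comm]) |>.congr_fderiv (by ext v; simp)
  have key := integral_gunter_by_parts hφ hw hw'
    (G := fun y => (g (‖x - y‖ ^ 2) * ⟪x - y, b⟫) • (x - y))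
    (G' := fun y => (g (‖x - y‖ ^ 2) * ⟪x - y, b⟫) • (-ContinuousLinearMap.id ℝ E3) +
      (g (‖x - y‖ ^ 2) • (-innerSL ℝ b) +
        ⟪x - y, b⟫ • ((-2 * g' (‖x - y‖ ^ 2)) • innerSL ℝ (x - y))).smulRight (x - y))
    (fun y => ((hasFDerivAt_comp_norm_sub_sq x y (hg _ (sq_nonneg _))).mul (hzb y)).smul (hz y)) (by
      have h1 : ∀ H H' : E3 → ℝ, Continuous H → Continuous H' → Continuous fun y : E3 =>
        (H y • (-innerSL ℝ b) + ⟪x - y, b⟫ • ((-2 * H' y) • innerSL ℝ (x - y))) :=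
        fun H H' hH hH' => by fun_prop
      have h2 : ∀ H : E3 → ℝ, Continuous H → Continuous fun y : E3 => (H y * ⟪x - y, b⟫) •
        (-ContinuousLinearMap.id ℝ E3) := fun H hH => by fun_prop
      exact (h2 _ hgc).add ((ContinuousLinearMap.smulRightL ℝ E3 E3).continuous₂.comp
        ((h1 _ _ hgc hgc').prodMk (continuous_const.sub continuous_id))))
  have e1 : ∀ p, cross ((g (‖x - φ p‖ ^ 2) * ⟪x - φ p, b⟫) • (x - φ p)) (w p)
      = (g (‖x - φ p‖ ^ 2) * ⟪x - φ p, b⟫) • cross (x - φ p) (w p) := by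
    intro p; apply e3_ext <;> simp <;> ring
  simp only [e1, inner_smul_right] at key
  rw [← key]
  refine integral_congr_ae (Eventually.of_forall fun p => ?_)
  have hq : ‖x - φ p‖ ^ 2 = (x - φ p) 0 ^ 2 + (x - φ p) 1 ^ 2 + (x - φ p) 2 ^ 2 := by
    rw [← real_inner_self_eq_norm_sq, inner_eq_sum3]; ring
  beta_reduce
  generalize g (‖x - φ p‖ ^ 2) = a
  generalize g' (‖x - φ p‖ ^ 2) = a'
  rw [hq]
  generalize x - φ p = z
  simp only [ContinuousLinearMap.smulRight_apply, _root_.smul_apply, innerSL_apply_apply,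
    _root_.add_apply, _root_.neg_apply, ContinuousLinearMap.id_apply,
    nvec, inner_eq_sum3, cross_apply_zero, cross_apply_one, cross_apply_two, PiLp.smul_apply,
    PiLp.add_apply, PiLp.neg_apply, smul_eq_mul]
  ring

end IntegrationByParts

/-! ### Passage to the limit in the regularized kernels -/

section Limits

variable {φ : ℝ × ℝ → E3} {w : ℝ × ℝ → E3} {x : E3}

/-- Dominated convergence for boundary integrals. -/
lemma tendsto_circulation_smul (hφ : ContDiff ℝ 2 φ) {ι : Type*} {l : Filter ι}
    [l.IsCountablyGenerated] {c : ι → ℝ × ℝ → ℝ} {c₀ : ℝ × ℝ → ℝ} {U : ℝ × ℝ → E3} (C : ℝ)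
    (hU : ContinuousOn U refTriangle) (hc : ∀ᶠ j in l, ContinuousOn (c j) refTriangle)
    (hb : ∀ᶠ j in l, ∀ i, ∀ t ∈ Icc (0 : ℝ) 1, |c j (refEdge i t)| ≤ C)
    (hl : ∀ i, ∀ t ∈ Icc (0 : ℝ) 1, Tendsto (fun j => c j (refEdge i t)) l
      (𝓝 (c₀ (refEdge i t)))) :
    Tendsto (fun j => circulation φ (fun p => c j p • U p)) l
      (𝓝 (circulation φ (fun p => c₀ p • U p))) := by
  refine tendsto_finsetSum _ fun i _ => ?_
  have he : ContinuousOn (refEdge i) (Icc 0 1) := (continuous_refEdge i).continuousOn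
  have hm : MapsTo (refEdge i) (Icc 0 1) refTriangle := fun t ht => refEdge_mem i ht
  have hd := (continuous_deriv_edge hφ i).continuousOn (s := Icc 0 1)
  have hUd : ContinuousOn (fun t => ⟪U (refEdge i t), deriv (fun τ => φ (refEdge i τ)) t⟫)
      (Icc 0 1) := (hU.comp he hm).inner hd
  simp only [inner_smul_left, RCLike.conj_to_real]
  refine intervalIntegral.tendsto_integral_filter_of_dominated_convergence
    (fun t => C * |⟪U (refEdge i t), deriv (fun τ => φ (refEdge i τ)) t⟫|) ?_ ?_ ?_ ?_
  · filter_upwards [hc] with j hj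
    rw [uIoc_of_le zero_le_one]
    exact (((hj.comp he hm).mul hUd).mono Ioc_subset_Icc_self).aestronglyMeasurable
      measurableSet_Ioc
  · filter_upwards [hb] with j hj
    refine Eventually.of_forall fun t ht => ?_
    rw [uIoc_of_le zero_le_one] at ht
    rw [Real.norm_eq_abs, abs_mul]
    exact mul_le_mul_of_nonneg_right (hj i t (Ioc_subset_Icc_self ht)) (abs_nonneg _)
  · refine ContinuousOn.intervalIntegrable ?_
    rw [uIcc_of_le zero_le_one]
    exact continuousOn_const.mul hUd.abs
  · refine Eventually.of_forall fun t ht => ?_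
    rw [uIoc_of_le zero_le_one] at ht
    exact (hl i t (Ioc_subset_Icc_self ht)).mul_const _

/-- Dominated convergence with a weakly singular majorant. -/
lemma tendsto_integral_weaklySingular {ι : Type*} {l : Filter ι} [l.IsCountablyGenerated]
    (hint : IntegrableOn (fun p => ‖x - φ p‖⁻¹) refTriangle)
    (hnull : ∀ᵐ p ∂volume.restrict refTriangle, φ p ≠ x)
    {f : ι → ℝ × ℝ → ℝ} {f₀ : ℝ × ℝ → ℝ} (K : ℝ)
    (hc : ∀ᶠ j in l, ContinuousOn (f j) refTriangle)
    (hb : ∀ᶠ j in l, ∀ p ∈ refTriangle, φ p ≠ x → |f j p| ≤ K * ‖x - φ p‖⁻¹)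
    (hl : ∀ p ∈ refTriangle, φ p ≠ x → Tendsto (fun j => f j p) l (𝓝 (f₀ p))) :
    Tendsto (fun j => ∫ p in refTriangle, f j p) l (𝓝 (∫ p in refTriangle, f₀ p)) := by
  have hT := ae_restrict_mem (μ := volume) measurableSet_refTriangle
  refine tendsto_integral_filter_of_dominated_convergence (fun p => K * ‖x - φ p‖⁻¹) ?_ ?_
    (hint.const_mul K) ?_
  · filter_upwards [hc] with j hj
    exact hj.aestronglyMeasurable measurableSet_refTriangle
  · filter_upwards [hb] with j hj
    filter_upwards [hT, hnull] with p hp hpx using hj p hp hpx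
  · filter_upwards [hT, hnull] with p hp hpx using hl p hp hpx

lemma exists_pos_le_edge_dist (hφ : Continuous φ)
    (hedge : ∀ i, ∀ t ∈ Icc (0 : ℝ) 1, φ (refEdge i t) ≠ x) :
    ∃ δ > 0, ∀ i, ∀ t ∈ Icc (0 : ℝ) 1, δ ≤ ‖x - φ (refEdge i t)‖ := by
  have h : ∀ i, ∃ δ > 0, ∀ t ∈ Icc (0 : ℝ) 1, δ ≤ ‖x - φ (refEdge i t)‖ := by
    intro i
    have hc : ContinuousOn (fun t => ‖x - φ (refEdge i t)‖) (Icc 0 1) :=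
      (continuous_const.sub (hφ.comp (continuous_refEdge i))).norm.continuousOn
    obtain ⟨t₀, ht₀, hmin⟩ := isCompact_Icc.exists_isMinOn (nonempty_Icc.2 zero_le_one) hc
    exact ⟨_, norm_pos_iff.2 (sub_ne_zero.2 (hedge i t₀ ht₀).symm), fun t ht => hmin ht⟩
  choose δ hδ hle using h
  refine ⟨min (δ 0) (min (δ 1) (δ 2)), by simp [hδ], fun i t ht => le_trans ?_ (hle i t ht)⟩
  fin_cases i <;> simp

lemma exists_norm_le_refTriangle {E : Type*} [NormedAddCommGroup E] {f : ℝ × ℝ → E}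
    (hf : ContinuousOn f refTriangle) : ∃ K, 0 ≤ K ∧ ∀ p ∈ refTriangle, ‖f p‖ ≤ K := by
  obtain ⟨K, hK⟩ := isCompact_refTriangle.exists_bound_of_continuousOn hf
  exact ⟨max K 0, le_max_right _ _, fun p hp => (hK p hp).trans (le_max_left _ _)⟩

/-- A function that is stopped at a point where its derivative vanishes is differentiable. -/
lemma hasDerivAt_comp_max {F F' : ℝ → ℝ} {a : ℝ} (hF : ∀ q, a ≤ q → HasDerivAt F (F' q) q)
    (h0 : F' a = 0) (q : ℝ) : HasDerivAt (fun q => F (max q a)) (F' (max q a)) q := by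
  rcases lt_trichotomy q a with h | rfl | h
  · rw [max_eq_right h.le, h0]
    refine (hasDerivAt_const q (F a)).congr_of_eventuallyEq ?_
    filter_upwards [eventually_lt_nhds h] with s hs
    rw [max_eq_right hs.le]
  · rw [max_self, ← hasDerivWithinAt_univ, ← Iic_union_Ici (a := q)]
    refine HasDerivWithinAt.union ?_ ?_
    · rw [h0]
      refine (hasDerivWithinAt_const q _ (F q)).congr (fun s hs => ?_) (by simp)
      rw [max_eq_right hs]
    · exact (hF q le_rfl).hasDerivWithinAt.congr (fun s hs => by rw [max_eq_left hs]) (by simp)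
  · rw [max_eq_left h.le]
    refine (hF q h.le).congr_of_eventuallyEq ?_
    filter_upwards [eventually_gt_nhds h] with s hs
    rw [max_eq_left hs.le]

/-- The derivative of `s⁻¹ - εⁿ s⁻⁽ⁿ⁺¹⁾ / (n + 1)` as a function of `q = s²`. It vanishes at
`s = ε`, so that the function can be stopped there, and for `s > ε` it tends to the derivative of `s⁻¹` as
`n → ∞`. -/
lemma hasDerivAt_smoothing (ε : ℝ) (n : ℕ) {q : ℝ} (hq : 0 < q) :
    HasDerivAt (fun q => (√q)⁻¹ - ε ^ n / (n + 1) * ((√q) ^ (n + 1))⁻¹)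
      (-(1 / 2) * ((√q) ^ 3)⁻¹ * (1 - (ε / √q) ^ n)) q := by
  have hs : 0 < √q := Real.sqrt_pos.2 hq
  have h1 := Real.hasDerivAt_sqrt hq.ne'
  have h2 := h1.fun_inv hs.ne'
  have h3 := ((h1.fun_pow (n + 1)).fun_inv (pow_ne_zero _ hs.ne')).const_mul (ε ^ n / (n + 1))
  refine (h2.sub h3).congr_deriv ?_
  have hn : (n : ℝ) + 1 ≠ 0 := by positivity
  simp only [Nat.add_sub_cancel, Nat.cast_add, Nat.cast_one, div_pow]
  field_simp
  ring

/-- The part of the surface integral over `|x - y| > ε`, integrated by parts. There is no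
contribution of the curve `|x - y| = ε`, as the function `1 / max |x - y| ε` is constant where
`|x - y| ≤ ε`. -/
lemma integral_truncated_by_parts (hφ : ContDiff ℝ 2 φ) (hw : ContDiffOn ℝ 1 w refTriangle)
    (x b : E3) {ε : ℝ} (hε : 0 < ε) :
    ∫ p in refTriangle, {p | ε < ‖x - φ p‖}.indicator (fun p => (‖x - φ p‖ ^ 3)⁻¹ *
        (⟪nvec φ p, b⟫ * ⟪x - φ p, w p⟫ - ⟪nvec φ p, w p⟫ * ⟪x - φ p, b⟫)) p
      = circulation φ (fun p => (max ‖x - φ p‖ ε)⁻¹ • cross b (w p))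
        + ∫ p in refTriangle, (max ‖x - φ p‖ ε)⁻¹ *
          ⟪gunterDensity φ (fderivWithin ℝ w refTriangle) p, b⟫ := by
  have hwd : ∀ p ∈ refTriangle, HasFDerivWithinAt w (fderivWithin ℝ w refTriangle p)
      refTriangle p := fun p hp => (hw.differentiableOn (by norm_num) p hp).hasFDerivWithinAt
  have hwc := hw.continuousOn_fderivWithin uniqueDiffOn_refTriangle (by norm_num)
  have hφc := hφ.continuous
  -- in terms of `q = |x - y|²`, the function `1 / max |x - y| ε` stops at `q = ε²`
  have hm : ∀ y : E3, √(max (‖x - y‖ ^ 2) (ε ^ 2)) = max ‖x - y‖ ε := by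
    intro y
    rcases le_total ‖x - y‖ ε with h | h
    · rw [max_eq_right h, max_eq_right (by gcongr), Real.sqrt_sq hε.le]
    · rw [max_eq_left h, max_eq_left (by gcongr), Real.sqrt_sq (norm_nonneg _)]
  have hparts : ∀ n : ℕ, _ := fun n : ℕ =>
    integral_by_parts_radial hφ hwd hwc x b
      (h := fun q => (√(max q (ε ^ 2)))⁻¹ - ε ^ n / (n + 1) * ((√(max q (ε ^ 2))) ^ (n + 1))⁻¹)
      (h' := fun q => -(1 / 2) * ((√(max q (ε ^ 2))) ^ 3)⁻¹ * (1 - (ε / √(max q (ε ^ 2))) ^ n))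
      (fun q _ => hasDerivAt_comp_max (a := ε ^ 2)
        (fun q hq => hasDerivAt_smoothing ε n (lt_of_lt_of_le (by positivity) hq))
        (by rw [Real.sqrt_sq hε.le]; simp [hε.ne']) q)
      (by
        have : ∀ q, √(max q (ε ^ 2)) ≠ 0 := fun q =>
          (Real.sqrt_pos.2 (lt_max_of_lt_right (by positivity))).ne'
        refine Continuous.continuousOn ?_
        have h3 : Continuous fun q => ((√(max q (ε ^ 2))) ^ 3)⁻¹ :=
          Continuous.inv₀ (by fun_prop) fun q => pow_ne_zero _ (this q)
        have h1 : Continuous fun q => ε / √(max q (ε ^ 2)) :=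
          Continuous.div (by fun_prop) (by fun_prop) this
        fun_prop)
  simp only [hm] at hparts
  have mpos : ∀ p, 0 < max ‖x - φ p‖ ε := fun p => lt_max_of_lt_right hε
  have hquot : ∀ p, 0 ≤ ε / max ‖x - φ p‖ ε ∧ ε / max ‖x - φ p‖ ε ≤ 1 := fun p =>
    ⟨(div_pos hε (mpos p)).le, (div_le_one (mpos p)).2 (le_max_right _ _)⟩
  have hmc : Continuous fun p => max ‖x - φ p‖ ε := by fun_prop
  have hrest : ∀ (n : ℕ) p, ε ^ n / ((n : ℝ) + 1) * ((max ‖x - φ p‖ ε) ^ (n + 1))⁻¹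
      = (max ‖x - φ p‖ ε)⁻¹ * ((ε / max ‖x - φ p‖ ε) ^ n * (1 / ((n : ℝ) + 1))) := by
    intro n p
    have := (mpos p).ne'
    rw [div_pow]
    field_simp
    ring
  have hsmall : ∀ p, Tendsto (fun n : ℕ => (ε / max ‖x - φ p‖ ε) ^ n * (1 / ((n : ℝ) + 1))) atTop
      (𝓝 0) := by
    intro p
    refine squeeze_zero (fun n => ?_) (fun n => ?_) tendsto_one_div_add_atTop_nhds_zero_nat
    · have := (hquot p).1; positivity
    · have : (ε / max ‖x - φ p‖ ε) ^ n ≤ 1 := pow_le_one₀ (hquot p).1 (hquot p).2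
      have h2 : (0 : ℝ) ≤ 1 / ((n : ℝ) + 1) := by positivity
      nlinarith
  have hcoef : ∀ p, Tendsto (fun n : ℕ => (max ‖x - φ p‖ ε)⁻¹
      - ε ^ n / ((n : ℝ) + 1) * ((max ‖x - φ p‖ ε) ^ (n + 1))⁻¹) atTop
      (𝓝 (max ‖x - φ p‖ ε)⁻¹) := by
    intro p
    simp only [hrest]
    simpa using ((hsmall p).const_mul (max ‖x - φ p‖ ε)⁻¹).const_sub (max ‖x - φ p‖ ε)⁻¹
  have hcoefb : ∀ (n : ℕ) p, |(max ‖x - φ p‖ ε)⁻¹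
      - ε ^ n / ((n : ℝ) + 1) * ((max ‖x - φ p‖ ε) ^ (n + 1))⁻¹| ≤ ε⁻¹ := by
    intro n p
    rw [hrest]
    have h1 : (ε / max ‖x - φ p‖ ε) ^ n ≤ 1 := pow_le_one₀ (hquot p).1 (hquot p).2
    have h2 : 1 / ((n : ℝ) + 1) ≤ 1 := by
      rw [div_le_one (by positivity)]; linarith [(Nat.cast_nonneg n : (0 : ℝ) ≤ n)]
    have h3 : (ε / max ‖x - φ p‖ ε) ^ n * (1 / ((n : ℝ) + 1)) ≤ 1 :=
      mul_le_one₀ h1 (by positivity) h2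
    have h4 : 0 ≤ (ε / max ‖x - φ p‖ ε) ^ n * (1 / ((n : ℝ) + 1)) :=
      mul_nonneg (pow_nonneg (hquot p).1 n) (by positivity)
    have h5 : (max ‖x - φ p‖ ε)⁻¹ ≤ ε⁻¹ := inv_anti₀ hε (le_max_right _ _)
    have h6 : 0 < (max ‖x - φ p‖ ε)⁻¹ := inv_pos.2 (mpos p)
    rw [abs_le]
    constructor <;> nlinarith
  have hcoefc : ∀ n : ℕ, Continuous fun p => (max ‖x - φ p‖ ε)⁻¹
      - ε ^ n / ((n : ℝ) + 1) * ((max ‖x - φ p‖ ε) ^ (n + 1))⁻¹ := by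
    intro n
    exact (hmc.inv₀ fun p => (mpos p).ne').sub
      (continuous_const.mul ((hmc.pow _).inv₀ fun p => pow_ne_zero _ (mpos p).ne'))
  have wc := hw.continuousOn
  have nc := (contDiff_nvec hφ).continuous.continuousOn (s := refTriangle)
  have zc : ContinuousOn (fun p => x - φ p) refTriangle := (continuous_const.sub hφc).continuousOn
  have gc : ContinuousOn (fun p => ⟪gunterDensity φ (fderivWithin ℝ w refTriangle) p, b⟫)
      refTriangle := (continuousOn_gunterDensity hφ hwc).inner (continuousOn_const (c := b))
  have ac : ContinuousOn (fun p => ⟪nvec φ p, b⟫ * ⟪x - φ p, w p⟫ - ⟪nvec φ p, w p⟫ *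
      ⟪x - φ p, b⟫) refTriangle :=
    ((nc.inner continuousOn_const).mul (zc.inner wc)).sub
      ((nc.inner wc).mul (zc.inner continuousOn_const))
  have hT := ae_restrict_mem (μ := volume) measurableSet_refTriangle
  -- the limits of both sides, as `n → ∞`
  have hR1 := tendsto_circulation_smul (l := atTop) (c₀ := fun p => (max ‖x - φ p‖ ε)⁻¹) hφ ε⁻¹
    ((continuousOn_const (c := b)).cross wc)
    (Eventually.of_forall fun n : ℕ => (hcoefc n).continuousOn)
    (Eventually.of_forall fun n i t _ => hcoefb n (refEdge i t)) (fun i t _ => hcoef (refEdge i t))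
  have hR2 : Tendsto (fun n : ℕ => ∫ p in refTriangle, ((max ‖x - φ p‖ ε)⁻¹
      - ε ^ n / ((n : ℝ) + 1) * ((max ‖x - φ p‖ ε) ^ (n + 1))⁻¹) *
        ⟪gunterDensity φ (fderivWithin ℝ w refTriangle) p, b⟫) atTop
      (𝓝 (∫ p in refTriangle, (max ‖x - φ p‖ ε)⁻¹ *
        ⟪gunterDensity φ (fderivWithin ℝ w refTriangle) p, b⟫)) := by
    refine tendsto_integral_of_dominated_convergence
      (fun p => ε⁻¹ * |⟪gunterDensity φ (fderivWithin ℝ w refTriangle) p, b⟫|) (fun n => ?_)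
      ((gc.abs.integrableOn_compact isCompact_refTriangle).const_mul _) (fun n => ?_) ?_
    · exact ((hcoefc n).continuousOn.mul gc).aestronglyMeasurable measurableSet_refTriangle
    · refine Eventually.of_forall fun p => ?_
      rw [Real.norm_eq_abs, abs_mul]
      exact mul_le_mul_of_nonneg_right (hcoefb n p) (abs_nonneg _)
    · exact Eventually.of_forall fun p => (hcoef p).mul_const _
  have hL : Tendsto (fun n : ℕ => ∫ p in refTriangle, -2 * (-(1 / 2) * ((max ‖x - φ p‖ ε) ^ 3)⁻¹ *
      (1 - (ε / max ‖x - φ p‖ ε) ^ n)) * (⟪nvec φ p, b⟫ * ⟪x - φ p, w p⟫ - ⟪nvec φ p, w p⟫ *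
      ⟪x - φ p, b⟫)) atTop
      (𝓝 (∫ p in refTriangle, {p | ε < ‖x - φ p‖}.indicator (fun p => (‖x - φ p‖ ^ 3)⁻¹ *
        (⟪nvec φ p, b⟫ * ⟪x - φ p, w p⟫ - ⟪nvec φ p, w p⟫ * ⟪x - φ p, b⟫)) p)) := by
    refine tendsto_integral_of_dominated_convergence
      (fun p => (ε ^ 3)⁻¹ * |⟪nvec φ p, b⟫ * ⟪x - φ p, w p⟫ - ⟪nvec φ p, w p⟫ * ⟪x - φ p, b⟫|)
      (fun n => ?_) ((ac.abs.integrableOn_compact isCompact_refTriangle).const_mul _)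
      (fun n => ?_) ?_
    · refine ContinuousOn.aestronglyMeasurable ?_ measurableSet_refTriangle
      refine ContinuousOn.mul (Continuous.continuousOn ?_) ac
      have h3 : Continuous fun p => ((max ‖x - φ p‖ ε) ^ 3)⁻¹ :=
        (hmc.pow _).inv₀ fun p => pow_ne_zero _ (mpos p).ne'
      have h1 : Continuous fun p => ε / max ‖x - φ p‖ ε :=
        continuous_const.div hmc fun p => (mpos p).ne'
      fun_prop
    · refine Eventually.of_forall fun p => ?_
      rw [Real.norm_eq_abs, abs_mul]
      refine mul_le_mul_of_nonneg_right ?_ (abs_nonneg _)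
      have h1 : (ε / max ‖x - φ p‖ ε) ^ n ≤ 1 := pow_le_one₀ (hquot p).1 (hquot p).2
      have h2 : 0 ≤ (ε / max ‖x - φ p‖ ε) ^ n := pow_nonneg (hquot p).1 n
      have h3 : ((max ‖x - φ p‖ ε) ^ 3)⁻¹ ≤ (ε ^ 3)⁻¹ :=
        inv_anti₀ (by positivity) (by gcongr; exact le_max_right _ _)
      have h4 : 0 ≤ ((max ‖x - φ p‖ ε) ^ 3)⁻¹ := by have := mpos p; positivity
      rw [abs_of_nonneg (by nlinarith)]
      nlinarith
    · refine Eventually.of_forall fun p => ?_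
      by_cases hp : ε < ‖x - φ p‖
      · rw [indicator_of_mem (by exact hp)]
        rw [max_eq_left hp.le]
        refine Tendsto.mul_const _ ?_
        have hlt : ε / ‖x - φ p‖ < 1 := (div_lt_one (hε.trans hp)).2 hp
        have h0 := tendsto_pow_atTop_nhds_zero_of_lt_one (div_nonneg hε.le (norm_nonneg _)) hlt
        have := ((h0.const_sub 1).const_mul (-(1 / 2) * (‖x - φ p‖ ^ 3)⁻¹)).const_mul (-2)
        convert this using 2
        ring
      · rw [indicator_of_notMem (by exact hp), max_eq_right (not_lt.1 hp)]
        simp [div_self hε.ne']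
  exact tendsto_nhds_unique hL ((hR1.add hR2).congr fun n => (hparts n).symm)

/-- The principal value of the tangential derivatives of `1 / |x - y|`. The only place where the
boundary of the triangle has to keep away from `x` is the limit of the line integral. -/
theorem tendsto_integral_truncated (hφ : ContDiff ℝ 2 φ) (hw : ContDiffOn ℝ 1 w refTriangle)
    (b : E3) (hint : IntegrableOn (fun p => ‖x - φ p‖⁻¹) refTriangle)
    (hnull : ∀ᵐ p ∂volume.restrict refTriangle, φ p ≠ x)
    (hedge : ∀ i, ∀ t ∈ Icc (0 : ℝ) 1, φ (refEdge i t) ≠ x) :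
    Tendsto (fun ε => ∫ p in refTriangle, {p | ε < ‖x - φ p‖}.indicator
        (fun p => (‖x - φ p‖ ^ 3)⁻¹ *
          (⟪nvec φ p, b⟫ * ⟪x - φ p, w p⟫ - ⟪nvec φ p, w p⟫ * ⟪x - φ p, b⟫)) p) (𝓝[>] 0)
      (𝓝 (circulation φ (fun p => ‖x - φ p‖⁻¹ • cross b (w p))
        + ∫ p in refTriangle, ‖x - φ p‖⁻¹ *
          ⟪gunterDensity φ (fderivWithin ℝ w refTriangle) p, b⟫)) := by
  have hwc := hw.continuousOn_fderivWithin uniqueDiffOn_refTriangle (by norm_num)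
  have hφc := hφ.continuous
  have gc : ContinuousOn (fun p => ⟪gunterDensity φ (fderivWithin ℝ w refTriangle) p, b⟫)
      refTriangle := (continuousOn_gunterDensity hφ hwc).inner (continuousOn_const (c := b))
  obtain ⟨δ, hδ, hle⟩ := exists_pos_le_edge_dist hφc hedge
  obtain ⟨K, hK0, hK⟩ := exists_norm_le_refTriangle gc
  have hpos : ∀ᶠ ε : ℝ in 𝓝[>] 0, 0 < ε := eventually_mem_nhdsWithin
  have hcont : ∀ᶠ ε : ℝ in 𝓝[>] 0, ContinuousOn (fun p => (max ‖x - φ p‖ ε)⁻¹) refTriangle := by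
    filter_upwards [hpos] with ε hε
    exact (Continuous.inv₀ (by fun_prop) fun p => (lt_max_of_lt_right hε).ne').continuousOn
  have hlim : ∀ p, φ p ≠ x → Tendsto (fun ε => (max ‖x - φ p‖ ε)⁻¹) (𝓝[>] 0)
      (𝓝 ‖x - φ p‖⁻¹) := by
    intro p hp
    have h0 : 0 < ‖x - φ p‖ := norm_pos_iff.2 (sub_ne_zero.2 hp.symm)
    have h1 : Tendsto (fun ε : ℝ => max ‖x - φ p‖ ε) (𝓝[>] 0) (𝓝 (max ‖x - φ p‖ 0)) :=
      ((continuous_const.max continuous_id).tendsto 0).mono_left nhdsWithin_le_nhds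
    rw [max_eq_left h0.le] at h1
    exact h1.inv₀ h0.ne'
  refine Tendsto.congr' (f₁ := fun ε => circulation φ (fun p => (max ‖x - φ p‖ ε)⁻¹ • cross b (w p))
        + ∫ p in refTriangle, (max ‖x - φ p‖ ε)⁻¹ *
          ⟪gunterDensity φ (fderivWithin ℝ w refTriangle) p, b⟫) ?_ (Tendsto.add ?_ ?_)
  · filter_upwards [hpos] with ε hε using (integral_truncated_by_parts hφ hw x b hε).symm
  · refine tendsto_circulation_smul hφ δ⁻¹ ((continuousOn_const (c := b)).cross hw.continuousOn)
      hcont ?_ fun i t ht => hlim _ (hedge i t ht)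
    filter_upwards [hpos] with ε hε i t ht
    rw [abs_of_pos (inv_pos.2 (lt_max_of_lt_right hε))]
    exact inv_anti₀ hδ ((hle i t ht).trans (le_max_left _ _))
  · refine tendsto_integral_weaklySingular hint hnull K ?_ ?_
      fun p hp hpx => (hlim p hpx).mul_const _
    · filter_upwards [hcont] with ε hε using hε.mul gc
    · filter_upwards [hpos] with ε hε p hp hpx
      have h0 : 0 < ‖x - φ p‖ := norm_pos_iff.2 (sub_ne_zero.2 hpx.symm)
      rw [abs_mul, mul_comm, abs_of_pos (inv_pos.2 (lt_max_of_lt_right hε))]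
      exact mul_le_mul (hK p hp) (inv_anti₀ h0 (le_max_left _ _)) (by positivity) hK0

end Limits

/-! ### Integration by parts with the dyadic kernel -/

section DyadLimit

variable {φ : ℝ × ℝ → E3} {w : ℝ × ℝ → E3} {x : E3}

lemma continuousOn_inv_sqrt_add_pow {δ : ℝ} (hδ : 0 < δ) (n : ℕ) :
    ContinuousOn (fun q => ((√(q + δ ^ 2)) ^ n)⁻¹) (Ici 0) := by
  refine ContinuousOn.inv₀ (by fun_prop) fun q hq => pow_ne_zero _ ?_
  have : 0 ≤ q := hq
  exact (Real.sqrt_pos.2 (by positivity)).ne'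

lemma hasDerivAt_sqrt_add_inv_cube {δ q : ℝ} (hδ : 0 < δ) (hq : 0 ≤ q) :
    HasDerivAt (fun q => ((√(q + δ ^ 2)) ^ 3)⁻¹) (-(3 / 2) * ((√(q + δ ^ 2)) ^ 5)⁻¹) q := by
  have h0 : 0 < q + δ ^ 2 := by positivity
  have hs := Real.sqrt_pos.2 h0
  have h1 := ((hasDerivAt_id q).add_const (δ ^ 2)).sqrt h0.ne'
  refine ((h1.fun_pow 3).fun_inv (pow_ne_zero _ hs.ne')).congr_deriv ?_
  simp only [id]
  field_simp
  norm_num [mul_comm]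

set_option maxHeartbeats 1000000 in
/-- Integration by parts with the dyad `(x - y) ⊗ (x - y) / |x - y|³`. Its Günter derivative is
weakly singular. The kernel is regularized by `|x - y|² + δ²` in place of `|x - y|²`; what the
regularization adds to the derivative is, up to a term with the factor `(x - y) · n`, a tangential
gradient of the radial function `δ² (|x - y|² + δ²)^(-3/2)`, and it is integrated by parts once
more, against the normal part of `w`. -/
theorem integral_dyad_by_parts (hφ : ContDiff ℝ 2 φ) (hw : ContDiffOn ℝ 1 w refTriangle)
    (hN0 : ∀ p ∈ refTriangle, nvec φ p ≠ 0)
    (b : E3) (hint : IntegrableOn (fun p => ‖x - φ p‖⁻¹) refTriangle)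
    (hnull : ∀ᵐ p ∂volume.restrict refTriangle, φ p ≠ x)
    (hedge : ∀ i, ∀ t ∈ Icc (0 : ℝ) 1, φ (refEdge i t) ≠ x)
    {C : ℝ} (hN : ∀ p ∈ refTriangle, |⟪nvec φ p, x - φ p⟫| ≤ C * ‖x - φ p‖ ^ 2) :
    ∫ p in refTriangle, ⟪nvec φ p, x - φ p⟫ * (3 * (‖x - φ p‖ ^ 5)⁻¹ *
        (⟪x - φ p, b⟫ * ⟪x - φ p, w p⟫) - (‖x - φ p‖ ^ 3)⁻¹ * ⟪w p, b⟫)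
      = circulation φ (fun p => ((‖x - φ p‖ ^ 3)⁻¹ * ⟪x - φ p, b⟫) • cross (x - φ p) (w p))
        + ∫ p in refTriangle, (‖x - φ p‖ ^ 3)⁻¹ * ⟪x - φ p, b⟫ *
          ⟪gunterDensity φ (fderivWithin ℝ w refTriangle) p, x - φ p⟫ := by
  have diff : ∀ {v : ℝ × ℝ → E3}, ContDiffOn ℝ 1 v refTriangle → ∀ p ∈ refTriangle,
      HasFDerivWithinAt v (fderivWithin ℝ v refTriangle p) refTriangle p :=
    fun hv p hp => (hv.differentiableOn (by norm_num) p hp).hasFDerivWithinAt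
  have dcont : ∀ {v : ℝ × ℝ → E3}, ContDiffOn ℝ 1 v refTriangle →
      ContinuousOn (fderivWithin ℝ v refTriangle) refTriangle :=
    fun hv => hv.continuousOn_fderivWithin uniqueDiffOn_refTriangle (by norm_num)
  have hφc := hφ.continuous
  have nC1 := (contDiff_nvec hφ).contDiffOn (s := refTriangle)
  have nc := nC1.continuousOn
  have wc := hw.continuousOn
  have zc : ContinuousOn (fun p => x - φ p) refTriangle := (continuous_const.sub hφc).continuousOn
  -- the normal part of `w`
  set v : ℝ × ℝ → E3 := fun p => (⟪nvec φ p, w p⟫ / ‖nvec φ p‖ ^ 2) • nvec φ p with hv_def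
  have hv : ContDiffOn ℝ 1 v refTriangle :=
    (((nC1.inner ℝ hw).div (nC1.norm_sq ℝ)
      fun p hp => pow_ne_zero _ (norm_ne_zero_iff.2 (hN0 p hp))).smul nC1)
  have vc := hv.continuousOn
  have nv : ∀ p ∈ refTriangle, ⟪nvec φ p, v p⟫ = ⟪nvec φ p, w p⟫ := by
    intro p hp
    have := norm_ne_zero_iff.2 (hN0 p hp)
    simp only [hv_def, inner_smul_right, real_inner_self_eq_norm_sq]
    field_simp
  have zv : ∀ p, ⟪x - φ p, v p⟫
      = ⟪nvec φ p, w p⟫ / ‖nvec φ p‖ ^ 2 * ⟪nvec φ p, x - φ p⟫ := by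
    intro p
    simp only [hv_def, inner_smul_right, real_inner_comm]
  set a : ℝ × ℝ → ℝ := fun p => ⟪nvec φ p, b⟫ * (⟪nvec φ p, w p⟫ / ‖nvec φ p‖ ^ 2) with ha_def
  have ac : ContinuousOn a refTriangle :=
    (nc.inner continuousOn_const).mul ((nc.inner wc).div (nc.norm.pow 2)
      fun p hp => pow_ne_zero _ (norm_ne_zero_iff.2 (hN0 p hp)))
  set m := gunterDensity φ (fderivWithin ℝ w refTriangle) with hm_def
  set m' := gunterDensity φ (fderivWithin ℝ v refTriangle) with hm'_def
  have mc : ContinuousOn m refTriangle := continuousOn_gunterDensity hφ (dcont hw)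
  have mc' : ContinuousOn m' refTriangle := continuousOn_gunterDensity hφ (dcont hv)
  -- `s δ p` is the regularized distance
  set s : ℝ → ℝ × ℝ → ℝ := fun δ p => √(‖x - φ p‖ ^ 2 + δ ^ 2) with hs_def
  have spos : ∀ {δ : ℝ}, 0 < δ → ∀ p, 0 < s δ p := fun hδ p => Real.sqrt_pos.2 (by positivity)
  have ssq : ∀ (δ : ℝ) p, s δ p ^ 2 = ‖x - φ p‖ ^ 2 + δ ^ 2 :=
    fun δ p => Real.sq_sqrt (by positivity)
  have sle : ∀ (δ : ℝ) p, ‖x - φ p‖ ≤ s δ p := fun δ p => by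
    apply Real.le_sqrt_of_sq_le; nlinarith [sq_nonneg δ]
  have sc : ∀ {δ : ℝ}, 0 < δ → ∀ n : ℕ, ContinuousOn (fun p => (s δ p ^ n)⁻¹) refTriangle :=
    fun {δ} hδ n => (Continuous.inv₀ (by fun_prop)
      fun p => pow_ne_zero _ (spos hδ p).ne').continuousOn
  have slim : ∀ p, Tendsto (fun δ => s δ p) (𝓝[>] 0) (𝓝 ‖x - φ p‖) := by
    intro p
    have h : Continuous fun δ => s δ p := by fun_prop
    have h0 : s 0 p = ‖x - φ p‖ := by simp [hs_def]
    have := (h.tendsto 0).mono_left (nhdsWithin_le_nhds (s := Ioi (0 : ℝ)))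
    rwa [h0] at this
  have slimn : ∀ p, φ p ≠ x → ∀ n : ℕ,
      Tendsto (fun δ => (s δ p ^ n)⁻¹) (𝓝[>] 0) (𝓝 (‖x - φ p‖ ^ n)⁻¹) := fun p hp n =>
    ((slim p).pow n).inv₀ (pow_ne_zero _ (norm_ne_zero_iff.2 (sub_ne_zero.2 hp.symm)))
  have dlim : Tendsto (fun δ : ℝ => δ ^ 2) (𝓝[>] 0) (𝓝 0) := by
    have := ((continuous_pow (M := ℝ) 2).tendsto 0).mono_left
      (nhdsWithin_le_nhds (s := Ioi (0 : ℝ)))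
    simpa using this
  have hpos : ∀ᶠ δ : ℝ in 𝓝[>] 0, 0 < δ := eventually_mem_nhdsWithin
  -- the regularized identity
  have hreg : ∀ δ : ℝ, 0 < δ →
      ∫ p in refTriangle, ⟪nvec φ p, x - φ p⟫ * (3 * (s δ p ^ 5)⁻¹ *
        (⟪x - φ p, b⟫ * ⟪x - φ p, w p⟫) - (s δ p ^ 3)⁻¹ * ⟪w p, b⟫
          + 3 * δ ^ 2 * (s δ p ^ 5)⁻¹ * a p)
      = (circulation φ (fun p => (s δ p ^ 3)⁻¹ • (⟪x - φ p, b⟫ • cross (x - φ p) (w p)))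
        + ∫ p in refTriangle, (s δ p ^ 3)⁻¹ * ⟪x - φ p, b⟫ * ⟪m p, x - φ p⟫)
        + (circulation φ (fun p => (δ ^ 2 * (s δ p ^ 3)⁻¹) • cross b (v p))
        + ∫ p in refTriangle, δ ^ 2 * (s δ p ^ 3)⁻¹ * ⟪m' p, b⟫) := by
    intro δ hδ
    have h1 := integral_by_parts_dyad hφ (diff hw) (dcont hw) x b
      (fun q hq => hasDerivAt_sqrt_add_inv_cube hδ hq)
      (continuousOn_const.mul (continuousOn_inv_sqrt_add_pow hδ 5))
    have h2 := integral_by_parts_radial hφ (diff hv) (dcont hv) x b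
      (fun q hq => (hasDerivAt_sqrt_add_inv_cube hδ hq).const_mul (δ ^ 2))
      (continuousOn_const.mul (continuousOn_const.mul (continuousOn_inv_sqrt_add_pow hδ 5)))
    simp only [smul_smul]
    refine Eq.trans ?_ (congrArg₂ (· + ·) h1 h2)
    rw [← integral_add]
    · refine setIntegral_congr_fun measurableSet_refTriangle fun p hp => ?_
      have e2 : ‖x - φ p‖ ^ 2 = s δ p ^ 2 - δ ^ 2 := by rw [ssq]; ring
      have hs0 := (spos hδ p).ne'
      simp only [nv p hp, zv p, ha_def]
      change _ = ⟪nvec φ p, x - φ p⟫ * (-2 * (-(3 / 2) * (s δ p ^ 5)⁻¹) *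
          (⟪x - φ p, b⟫ * ⟪x - φ p, w p⟫) - (s δ p ^ 3)⁻¹ * ⟪w p, b⟫)
        + ⟪nvec φ p, w p⟫ * ⟪x - φ p, b⟫ *
          (3 * (s δ p ^ 3)⁻¹ + 2 * ‖x - φ p‖ ^ 2 * (-(3 / 2) * (s δ p ^ 5)⁻¹))
        + -2 * (δ ^ 2 * (-(3 / 2) * (s δ p ^ 5)⁻¹)) * (⟪nvec φ p, b⟫ *
          (⟪nvec φ p, w p⟫ / ‖nvec φ p‖ ^ 2 * ⟪nvec φ p, x - φ p⟫)
          - ⟪nvec φ p, w p⟫ * ⟪x - φ p, b⟫)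
      have e3 : (s δ p ^ 3)⁻¹ = s δ p ^ 2 * (s δ p ^ 5)⁻¹ := by field_simp
      rw [e2, e3]
      ring
    · refine ContinuousOn.integrableOn_compact isCompact_refTriangle ?_
      have s5 := sc hδ 5
      have s3 := sc hδ 3
      exact ((nc.inner zc).mul (((continuousOn_const.mul (continuousOn_const.mul s5)).mul
        ((zc.inner continuousOn_const).mul (zc.inner wc))).sub
        (s3.mul (wc.inner continuousOn_const)))).add
        (((nc.inner wc).mul (zc.inner continuousOn_const)).mul ((continuousOn_const.mul s3).add
        ((continuousOn_const.mul (zc.norm.pow 2)).mul (continuousOn_const.mul s5))))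
    · refine ContinuousOn.integrableOn_compact isCompact_refTriangle ?_
      exact (continuousOn_const.mul (continuousOn_const.mul (continuousOn_const.mul (sc hδ 5)))).mul
        (((nc.inner continuousOn_const).mul (zc.inner vc)).sub
        ((nc.inner vc).mul (zc.inner continuousOn_const)))
  -- all terms are weakly singular, uniformly in `δ`, because powers of `|x - y|` and of `δ` are
  -- bounded by powers of the regularized distance
  obtain ⟨d, hd, hle⟩ := exists_pos_le_edge_dist hφc hedge
  obtain ⟨Kw, hKw0, hKw⟩ := exists_norm_le_refTriangle wc
  obtain ⟨Ka, hKa0, hKa⟩ := exists_norm_le_refTriangle ac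
  obtain ⟨Km, hKm0, hKm⟩ := exists_norm_le_refTriangle mc
  obtain ⟨Km', hKm0', hKm'⟩ := exists_norm_le_refTriangle mc'
  have sinv : ∀ {δ : ℝ}, 0 < δ → ∀ p, φ p ≠ x → (s δ p)⁻¹ ≤ ‖x - φ p‖⁻¹ := fun hδ p hp =>
    inv_anti₀ (norm_pos_iff.2 (sub_ne_zero.2 hp.symm)) (sle _ p)
  have s3le : ∀ {δ : ℝ}, 0 < δ → ∀ p, ‖x - φ p‖ ^ 2 * (s δ p ^ 3)⁻¹ ≤ (s δ p)⁻¹ := by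
    intro δ hδ p
    have h0 := spos hδ p
    have e : (s δ p)⁻¹ = s δ p ^ 2 * (s δ p ^ 3)⁻¹ := by field_simp
    rw [e]
    gcongr
    exact sle δ p
  have s5le : ∀ {δ : ℝ}, 0 < δ → ∀ p,
      ‖x - φ p‖ ^ 2 * (‖x - φ p‖ ^ 2 * (s δ p ^ 5)⁻¹) ≤ (s δ p)⁻¹ := by
    intro δ hδ p
    have h0 := spos hδ p
    have e : (s δ p)⁻¹ = s δ p ^ 2 * (s δ p ^ 2 * (s δ p ^ 5)⁻¹) := by field_simp
    rw [e]
    gcongr <;> exact sle δ p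
  have dle : ∀ (δ : ℝ) p, δ ^ 2 ≤ s δ p ^ 2 := fun δ p => by
    rw [ssq]; nlinarith [sq_nonneg ‖x - φ p‖]
  have d3le : ∀ {δ : ℝ}, 0 < δ → ∀ p, δ ^ 2 * (s δ p ^ 3)⁻¹ ≤ (s δ p)⁻¹ := by
    intro δ hδ p
    have h0 := spos hδ p
    have e : (s δ p)⁻¹ = s δ p ^ 2 * (s δ p ^ 3)⁻¹ := by field_simp
    rw [e]
    gcongr ?_ * _
    exact dle δ p
  have d5le : ∀ {δ : ℝ}, 0 < δ → ∀ p, ‖x - φ p‖ ^ 2 * (δ ^ 2 * (s δ p ^ 5)⁻¹) ≤ (s δ p)⁻¹ := by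
    intro δ hδ p
    have h0 := spos hδ p
    have e : (s δ p)⁻¹ = s δ p ^ 2 * (s δ p ^ 2 * (s δ p ^ 5)⁻¹) := by field_simp
    rw [e]
    gcongr ?_ ^ 2 * (?_ * _)
    · exact sle δ p
    · exact dle δ p
  have L0 : Tendsto (fun δ => ∫ p in refTriangle, ⟪nvec φ p, x - φ p⟫ * (3 * (s δ p ^ 5)⁻¹ *
        (⟪x - φ p, b⟫ * ⟪x - φ p, w p⟫) - (s δ p ^ 3)⁻¹ * ⟪w p, b⟫
          + 3 * δ ^ 2 * (s δ p ^ 5)⁻¹ * a p)) (𝓝[>] 0)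
      (𝓝 (∫ p in refTriangle, ⟪nvec φ p, x - φ p⟫ * (3 * (‖x - φ p‖ ^ 5)⁻¹ *
        (⟪x - φ p, b⟫ * ⟪x - φ p, w p⟫) - (‖x - φ p‖ ^ 3)⁻¹ * ⟪w p, b⟫
          + 3 * 0 * (‖x - φ p‖ ^ 5)⁻¹ * a p))) := by
    refine tendsto_integral_weaklySingular hint hnull (|C| * (4 * (‖b‖ * Kw) + 3 * Ka)) ?_ ?_ ?_
    · filter_upwards [hpos] with δ hδ
      exact (nc.inner zc).mul ((((continuousOn_const.mul (sc hδ 5)).mul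
        ((zc.inner continuousOn_const).mul (zc.inner wc))).sub
        ((sc hδ 3).mul (wc.inner continuousOn_const))).add
        ((continuousOn_const.mul (sc hδ 5)).mul ac))
    · filter_upwards [hpos] with δ hδ p hp hpx
      have r0 : 0 ≤ ‖x - φ p‖ := norm_nonneg _
      have i0 := spos hδ p
      have b1 : |⟪nvec φ p, x - φ p⟫| ≤ |C| * ‖x - φ p‖ ^ 2 :=
        (hN p hp).trans (mul_le_mul_of_nonneg_right (le_abs_self C) (sq_nonneg _))
      have b2 : |⟪x - φ p, b⟫| ≤ ‖x - φ p‖ * ‖b‖ := abs_real_inner_le_norm _ _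
      have b3 : |⟪x - φ p, w p⟫| ≤ ‖x - φ p‖ * Kw :=
        (abs_real_inner_le_norm _ _).trans (mul_le_mul_of_nonneg_left (hKw p hp) r0)
      have b4 : |⟪w p, b⟫| ≤ Kw * ‖b‖ :=
        (abs_real_inner_le_norm _ _).trans (mul_le_mul_of_nonneg_right (hKw p hp) (norm_nonneg _))
      have b5 : |a p| ≤ Ka := hKa p hp
      have t1 : |3 * (s δ p ^ 5)⁻¹ * (⟪x - φ p, b⟫ * ⟪x - φ p, w p⟫)|
          ≤ 3 * (s δ p ^ 5)⁻¹ * ((‖x - φ p‖ * ‖b‖) * (‖x - φ p‖ * Kw)) := by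
        rw [abs_mul, abs_mul ⟪x - φ p, b⟫, abs_of_pos (by positivity : 0 < 3 * (s δ p ^ 5)⁻¹)]
        gcongr
      have t2 : |(s δ p ^ 3)⁻¹ * ⟪w p, b⟫| ≤ (s δ p ^ 3)⁻¹ * (Kw * ‖b‖) := by
        rw [abs_mul, abs_of_pos (by positivity : 0 < (s δ p ^ 3)⁻¹)]
        gcongr
      have t3 : |3 * δ ^ 2 * (s δ p ^ 5)⁻¹ * a p| ≤ 3 * δ ^ 2 * (s δ p ^ 5)⁻¹ * Ka := by
        rw [abs_mul, abs_of_pos (by positivity : 0 < 3 * δ ^ 2 * (s δ p ^ 5)⁻¹)]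
        gcongr
      have t4 := (abs_add_le (3 * (s δ p ^ 5)⁻¹ * (⟪x - φ p, b⟫ * ⟪x - φ p, w p⟫)
        - (s δ p ^ 3)⁻¹ * ⟪w p, b⟫) (3 * δ ^ 2 * (s δ p ^ 5)⁻¹ * a p))
      have t5 := abs_sub (3 * (s δ p ^ 5)⁻¹ * (⟪x - φ p, b⟫ * ⟪x - φ p, w p⟫))
        ((s δ p ^ 3)⁻¹ * ⟪w p, b⟫)
      rw [abs_mul]
      calc _ ≤ (|C| * ‖x - φ p‖ ^ 2) * (3 * (s δ p ^ 5)⁻¹ * ((‖x - φ p‖ * ‖b‖) * (‖x - φ p‖ * Kw))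
              + (s δ p ^ 3)⁻¹ * (Kw * ‖b‖) + 3 * δ ^ 2 * (s δ p ^ 5)⁻¹ * Ka) := by
            refine mul_le_mul b1 (by linarith) (abs_nonneg _) (by positivity)
        _ = |C| * (3 * (‖b‖ * Kw) * (‖x - φ p‖ ^ 2 * (‖x - φ p‖ ^ 2 * (s δ p ^ 5)⁻¹))
              + (‖b‖ * Kw) * (‖x - φ p‖ ^ 2 * (s δ p ^ 3)⁻¹)
              + 3 * Ka * (‖x - φ p‖ ^ 2 * (δ ^ 2 * (s δ p ^ 5)⁻¹))) := by ring
        _ ≤ |C| * (3 * (‖b‖ * Kw) * ‖x - φ p‖⁻¹ + (‖b‖ * Kw) * ‖x - φ p‖⁻¹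
              + 3 * Ka * ‖x - φ p‖⁻¹) := by
            gcongr
            · exact (s5le hδ p).trans (sinv hδ p hpx)
            · exact (s3le hδ p).trans (sinv hδ p hpx)
            · exact (d5le hδ p).trans (sinv hδ p hpx)
        _ = _ := by ring
    · intro p hp hpx
      exact ((((slimn p hpx 5).const_mul 3).mul_const _).sub ((slimn p hpx 3).mul_const _)).add
        (((dlim.const_mul 3).mul (slimn p hpx 5)).mul_const _) |>.const_mul _
  have L1 : Tendsto (fun δ => circulation φ
      (fun p => (s δ p ^ 3)⁻¹ • (⟪x - φ p, b⟫ • cross (x - φ p) (w p)))) (𝓝[>] 0)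
      (𝓝 (circulation φ
        (fun p => (‖x - φ p‖ ^ 3)⁻¹ • (⟪x - φ p, b⟫ • cross (x - φ p) (w p))))) := by
    have hzb : ContinuousOn (fun p => ⟪x - φ p, b⟫) refTriangle := zc.inner continuousOn_const
    have hU : ContinuousOn (fun p => ⟪x - φ p, b⟫ • cross (x - φ p) (w p)) refTriangle :=
      hzb.smul (zc.cross wc)
    refine tendsto_circulation_smul hφ (d ^ 3)⁻¹ hU ?_ ?_ fun i t ht => slimn _ (hedge i t ht) 3
    · filter_upwards [hpos] with δ hδ using sc hδ 3
    · filter_upwards [hpos] with δ hδ i t ht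
      have := spos hδ (refEdge i t)
      rw [abs_of_pos (by positivity)]
      have := (hle i t ht).trans (sle δ _)
      gcongr
  have L2 : Tendsto (fun δ => ∫ p in refTriangle, (s δ p ^ 3)⁻¹ * ⟪x - φ p, b⟫ * ⟪m p, x - φ p⟫)
      (𝓝[>] 0) (𝓝 (∫ p in refTriangle, (‖x - φ p‖ ^ 3)⁻¹ * ⟪x - φ p, b⟫ * ⟪m p, x - φ p⟫)) := by
    refine tendsto_integral_weaklySingular hint hnull (‖b‖ * Km) ?_ ?_ ?_
    · filter_upwards [hpos] with δ hδ
      exact ((sc hδ 3).mul (zc.inner continuousOn_const)).mul (mc.inner zc)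
    · filter_upwards [hpos] with δ hδ p hp hpx
      have i0 := spos hδ p
      rw [abs_mul, abs_mul, abs_of_pos (by positivity : 0 < (s δ p ^ 3)⁻¹)]
      calc _ ≤ (s δ p ^ 3)⁻¹ * (‖x - φ p‖ * ‖b‖) * (Km * ‖x - φ p‖) := by
            gcongr
            · exact abs_real_inner_le_norm _ _
            · exact (abs_real_inner_le_norm _ _).trans
                (mul_le_mul_of_nonneg_right (hKm p hp) (norm_nonneg _))
        _ = ‖b‖ * Km * (‖x - φ p‖ ^ 2 * (s δ p ^ 3)⁻¹) := by ring
        _ ≤ _ := by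
            gcongr
            exact (s3le hδ p).trans (sinv hδ p hpx)
    · intro p hp hpx
      exact ((slimn p hpx 3).mul_const _).mul_const _
  have L3 : Tendsto (fun δ => circulation φ (fun p => (δ ^ 2 * (s δ p ^ 3)⁻¹) • cross b (v p)))
      (𝓝[>] 0) (𝓝 (circulation φ (fun p => (0 * (‖x - φ p‖ ^ 3)⁻¹) • cross b (v p)))) := by
    refine tendsto_circulation_smul (c₀ := fun p => 0 * (‖x - φ p‖ ^ 3)⁻¹) hφ d⁻¹
      ((continuousOn_const (c := b)).cross vc) ?_ ?_
      fun i t ht => dlim.mul (slimn _ (hedge i t ht) 3)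
    · filter_upwards [hpos] with δ hδ using continuousOn_const.mul (sc hδ 3)
    · filter_upwards [hpos] with δ hδ i t ht
      have := spos hδ (refEdge i t)
      rw [abs_of_pos (by positivity)]
      exact (d3le hδ _).trans (inv_anti₀ hd ((hle i t ht).trans (sle δ _)))
  have L4 : Tendsto (fun δ => ∫ p in refTriangle, δ ^ 2 * (s δ p ^ 3)⁻¹ * ⟪m' p, b⟫)
      (𝓝[>] 0) (𝓝 (∫ p in refTriangle, 0 * (‖x - φ p‖ ^ 3)⁻¹ * ⟪m' p, b⟫)) := by
    refine tendsto_integral_weaklySingular hint hnull (Km' * ‖b‖) ?_ ?_ ?_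
    · filter_upwards [hpos] with δ hδ
      exact (continuousOn_const.mul (sc hδ 3)).mul (mc'.inner continuousOn_const)
    · filter_upwards [hpos] with δ hδ p hp hpx
      have i0 := spos hδ p
      rw [abs_mul, abs_of_pos (by positivity : 0 < δ ^ 2 * (s δ p ^ 3)⁻¹), mul_comm]
      refine mul_le_mul ?_ ((d3le hδ p).trans (sinv hδ p hpx)) (by positivity) (by positivity)
      exact (abs_real_inner_le_norm _ _).trans
        (mul_le_mul_of_nonneg_right (hKm' p hp) (norm_nonneg _))
    · intro p hp hpx
      exact (dlim.mul (slimn p hpx 3)).mul_const _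
  have hfin := tendsto_nhds_unique (L0.congr' (by
    filter_upwards [hpos] with δ hδ using hreg δ hδ)) ((L1.add L2).add (L3.add L4))
  have hz : circulation φ (fun p => (0 : E3)) = 0 := by simp [circulation]
  simp only [mul_zero, zero_mul, add_zero, zero_smul, hz, integral_zero, smul_smul] at hfin
  exact hfin

end DyadLimit

/-! ### Immersed triangles and weakly singular integrals -/

/-- The weakly singular kernel `r^(-3/2)`; it is zero at `r = 0`. -/
noncomputable def weakKernel (r : ℝ) : ℝ := (√r ^ 3)⁻¹

lemma weakKernel_nonneg (r : ℝ) : 0 ≤ weakKernel r := by unfold weakKernel; positivity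

lemma measurable_weakKernel : Measurable weakKernel := by unfold weakKernel; fun_prop

lemma weakKernel_anti {a b : ℝ} (ha : 0 < a) (h : a ≤ b) : weakKernel b ≤ weakKernel a := by
  have := Real.sqrt_pos.2 ha
  unfold weakKernel
  gcongr

lemma inv_le_one_add_weakKernel {r : ℝ} (hr : 0 ≤ r) : r⁻¹ ≤ 1 + weakKernel r := by
  rcases le_total 1 r with h | h
  · exact (inv_le_one_of_one_le₀ h).trans (by linarith [weakKernel_nonneg r])
  · rcases hr.eq_or_lt with rfl | h0
    · simp [weakKernel]
    · have hs := Real.sqrt_pos.2 h0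
      have h1 : √r ≤ 1 := Real.sqrt_le_one.2 h
      have h2 : r⁻¹ ≤ weakKernel r := by
        unfold weakKernel
        refine inv_anti₀ (by positivity) ?_
        calc √r ^ 3 ≤ √r ^ 2 := pow_le_pow_of_le_one hs.le h1 (by norm_num)
          _ = r := Real.sq_sqrt hr
      linarith

lemma integrable_weakKernel_plane :
    Integrable (fun p : ℝ × ℝ => (Iic (1 : ℝ)).indicator weakKernel ‖p‖) := by
  rw [integrable_fun_norm_addHaar volume (f := (Iic (1 : ℝ)).indicator weakKernel)]
  have h1 : IntegrableOn (fun y : ℝ => y ^ (-(1 / 2) : ℝ)) (Ioc 0 1) := by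
    have := intervalIntegral.intervalIntegrable_rpow' (a := 0) (b := 1)
      (r := (-(1 / 2) : ℝ)) (by norm_num)
    rwa [intervalIntegrable_iff_integrableOn_Ioc_of_le zero_le_one] at this
  have h2 : IntegrableOn ((Ioc (0 : ℝ) 1).indicator fun y : ℝ => y ^ (-(1 / 2) : ℝ)) (Ioi 0) :=
    (h1.integrable_indicator measurableSet_Ioc).integrableOn
  refine h2.congr_fun (fun y hy => ?_) measurableSet_Ioi
  have hy0 : 0 < y := hy
  by_cases hy1 : y ≤ 1
  · rw [indicator_of_mem (show y ∈ Ioc (0 : ℝ) 1 from ⟨hy0, hy1⟩)]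
    simp only [Module.finrank_prod, Module.finrank_self, smul_eq_mul]
    rw [indicator_of_mem (by exact hy1), weakKernel, Real.rpow_neg hy0.le, ← Real.sqrt_eq_rpow]
    have hs := Real.sqrt_pos.2 hy0
    have e : y = √y ^ 2 := (Real.sq_sqrt hy0.le).symm
    norm_num
    nth_rewrite 2 [e]
    field_simp
  · rw [indicator_of_notMem (fun h => hy1 h.2), indicator_of_notMem (by exact hy1)]
    simp

lemma norm_sub_le_one_of_mem_refTriangle {p q : ℝ × ℝ} (hp : p ∈ refTriangle)
    (hq : q ∈ refTriangle) : ‖p - q‖ ≤ 1 := by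
  obtain ⟨h1, h2, h3⟩ := hp
  obtain ⟨h1', h2', h3'⟩ := hq
  rw [Prod.norm_def]
  simp only [Prod.fst_sub, Prod.snd_sub, Real.norm_eq_abs]
  refine max_le (abs_le.2 ⟨?_, ?_⟩) (abs_le.2 ⟨?_, ?_⟩) <;> linarith

section Immersion

variable {φ : ℝ × ℝ → E3}

lemma nvec_ne_zero {p : ℝ × ℝ} (h : Function.Injective (fderiv ℝ φ p)) : nvec φ p ≠ 0 := by
  refine cross_ne_zero fun s t hst => ?_
  rw [← fderiv_apply_eq_tan] at hst
  have := h (hst.trans (map_zero _).symm)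
  exact ⟨congrArg Prod.fst this, congrArg Prod.snd this⟩

/-- An injective immersion of the reference triangle is bi-Lipschitz. -/
lemma exists_lower_lipschitz (hφ : ContDiff ℝ 2 φ) (hinj : InjOn φ refTriangle)
    (himm : ∀ p ∈ refTriangle, Function.Injective (fderiv ℝ φ p)) :
    ∃ c > 0, ∀ p ∈ refTriangle, ∀ q ∈ refTriangle, c * ‖p - q‖ ≤ ‖φ p - φ q‖ := by
  have key : ∃ c > 0, ∀ z ∈ refTriangle ×ˢ refTriangle, c * ‖z.1 - z.2‖ ≤ ‖φ z.1 - φ z.2‖ := by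
    refine (isCompact_refTriangle.prod isCompact_refTriangle).induction_on
      (p := fun s => ∃ c > 0, ∀ z ∈ s, c * ‖z.1 - z.2‖ ≤ ‖φ z.1 - φ z.2‖)
      ⟨1, one_pos, by simp⟩ ?_ ?_ ?_
    · rintro s t hst ⟨c, hc, h⟩
      exact ⟨c, hc, fun z hz => h z (hst hz)⟩
    · rintro s t ⟨c, hc, h⟩ ⟨d, hd, h'⟩
      refine ⟨min c d, lt_min hc hd, ?_⟩
      rintro z (hz | hz)
      · exact (mul_le_mul_of_nonneg_right (min_le_left _ _) (norm_nonneg _)).trans (h z hz)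
      · exact (mul_le_mul_of_nonneg_right (min_le_right _ _) (norm_nonneg _)).trans (h' z hz)
    · rintro ⟨p, q⟩ ⟨hp, hq⟩
      by_cases hpq : p = q
      · -- near the diagonal, the derivative decides
        subst hpq
        obtain ⟨K, hK, hanti⟩ := (fderiv ℝ φ p).toLinearMap.exists_antilipschitzWith
          (LinearMap.ker_eq_bot.2 (himm p hp))
        have hK' : (0 : ℝ) < K := hK
        have hs := ((hφ.contDiffAt (x := p)).hasStrictFDerivAt (by norm_num)).isLittleO
        have hs' := hs.def (c := (K : ℝ)⁻¹ / 2) (by positivity)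
        refine ⟨_, mem_nhdsWithin_of_mem_nhds hs', (K : ℝ)⁻¹ / 2, by positivity, ?_⟩
        rintro ⟨a, b⟩ hab
        have hab' : ‖φ a - φ b - fderiv ℝ φ p (a - b)‖ ≤ (K : ℝ)⁻¹ / 2 * ‖a - b‖ := hab
        have h1 : ‖a - b‖ ≤ K * ‖fderiv ℝ φ p (a - b)‖ := by
          have := hanti.le_mul_dist a b
          rwa [dist_eq_norm, dist_eq_norm, ← map_sub] at this
        have h2 : (K : ℝ)⁻¹ * ‖a - b‖ ≤ ‖fderiv ℝ φ p (a - b)‖ := by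
          rw [inv_mul_le_iff₀ hK']; exact h1
        have h3 := norm_sub_norm_le (fderiv ℝ φ p (a - b)) (φ a - φ b)
        rw [norm_sub_rev (fderiv ℝ φ p (a - b))] at h3
        simp only
        linarith
      · -- off the diagonal, injectivity and continuity are enough
        have h0 : 0 < ‖φ p - φ q‖ :=
          norm_pos_iff.2 (sub_ne_zero.2 fun h => hpq (hinj hp hq h))
        have hφc := hφ.continuous
        have hc : Continuous fun z : (ℝ × ℝ) × (ℝ × ℝ) => ‖φ z.1 - φ z.2‖ := by fun_prop
        have ev := (hc.tendsto (p, q)).eventually (lt_mem_nhds (half_lt_self h0))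
        refine ⟨_, inter_mem self_mem_nhdsWithin (mem_nhdsWithin_of_mem_nhds ev),
          ‖φ p - φ q‖ / 2, by positivity, ?_⟩
        rintro ⟨a, b⟩ ⟨⟨ha, hb⟩, hab⟩
        have hab' : ‖φ p - φ q‖ / 2 < ‖φ a - φ b‖ := hab
        have := norm_sub_le_one_of_mem_refTriangle ha hb
        simp only
        nlinarith
  obtain ⟨c, hc, h⟩ := key
  exact ⟨c, hc, fun p hp q hq => h (p, q) ⟨hp, hq⟩⟩

/-- The chord between two points is tangential up to second order. -/
lemma exists_inner_nvec_le_sq (hφ : ContDiff ℝ 2 φ) :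
    ∃ C, 0 ≤ C ∧ ∀ p ∈ refTriangle, ∀ q ∈ refTriangle,
      |⟪nvec φ p, φ q - φ p⟫| ≤ C * ‖q - p‖ ^ 2 := by
  have hd := contDiff_fderiv hφ
  obtain ⟨K, hK0, hK⟩ := exists_norm_le_refTriangle
    (hd.continuous_fderiv (by norm_num)).continuousOn
  obtain ⟨Kn, hKn0, hKn⟩ := exists_norm_le_refTriangle (contDiff_nvec hφ).continuous.continuousOn
  refine ⟨Kn * K, by positivity, fun p hp q hq => ?_⟩
  have h1 : ‖φ q - φ p - fderiv ℝ φ p (q - p)‖ ≤ (K * ‖q - p‖) * ‖q - p‖ := by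
    refine (convex_segment p q).norm_image_sub_le_of_norm_fderiv_le'
      (fun y _ => hφ.differentiable (by norm_num) y) (fun y hy => ?_)
      (left_mem_segment ℝ p q) (right_mem_segment ℝ p q)
    have hyT : y ∈ refTriangle := convex_refTriangle.segment_subset hp hq hy
    refine (convex_refTriangle.norm_image_sub_le_of_norm_fderiv_le
      (fun y _ => hd.differentiable (by norm_num) y) hK hp hyT).trans ?_
    gcongr
    rw [segment_eq_image'] at hy
    obtain ⟨t, ht, rfl⟩ := hy
    simp only [add_sub_cancel_left, norm_smul, Real.norm_eq_abs]
    rw [abs_of_nonneg ht.1]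
    exact mul_le_of_le_one_left (norm_nonneg _) ht.2
  have h2 : ⟪nvec φ p, fderiv ℝ φ p (q - p)⟫ = 0 := by
    have : q - p = ((q - p).1, (q - p).2) := rfl
    rw [this, fderiv_apply_eq_tan, inner_add_right, inner_smul_right, inner_smul_right, nvec,
      inner_cross_left, inner_cross_right]
    simp
  have h3 : ⟪nvec φ p, φ q - φ p⟫ = ⟪nvec φ p, φ q - φ p - fderiv ℝ φ p (q - p)⟫ := by
    rw [inner_sub_right _ (φ q - φ p), h2, sub_zero]
  rw [h3]
  calc _ ≤ ‖nvec φ p‖ * ‖φ q - φ p - fderiv ℝ φ p (q - p)‖ := abs_real_inner_le_norm _ _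
    _ ≤ Kn * ((K * ‖q - p‖) * ‖q - p‖) := by gcongr; exact hKn p hp
    _ = _ := by ring

/-- The distance of an arbitrary point of space from the points of the triangle is bounded below by
the distance of the parameters from that of a nearest point. -/
lemma exists_nearest (hφ : ContDiff ℝ 2 φ) {c : ℝ}
    (hc : ∀ p ∈ refTriangle, ∀ q ∈ refTriangle, c * ‖p - q‖ ≤ ‖φ p - φ q‖) (x : E3) :
    ∃ q ∈ refTriangle, ∀ p ∈ refTriangle, ‖x - φ q‖ ≤ ‖x - φ p‖ ∧
      c / 2 * ‖p - q‖ ≤ ‖x - φ p‖ := by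
  have hφc := hφ.continuous
  obtain ⟨q, hq, hmin⟩ := isCompact_refTriangle.exists_isMinOn
    ⟨(0, 0), by simp [refTriangle]⟩
    (by fun_prop : Continuous fun p => ‖x - φ p‖).continuousOn
  refine ⟨q, hq, fun p hp => ⟨hmin hp, ?_⟩⟩
  have h1 : ‖x - φ q‖ ≤ ‖x - φ p‖ := hmin hp
  have h2 := hc p hp q hq
  have h3 : ‖φ p - φ q‖ ≤ ‖x - φ p‖ + ‖x - φ q‖ := by
    have := norm_sub_le (x - φ q) (x - φ p)
    rw [sub_sub_sub_cancel_left] at this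
    linarith
  linarith

lemma ae_ne_refTriangle (q : ℝ × ℝ) : ∀ᵐ p ∂volume.restrict refTriangle, p ≠ q :=
  ae_restrict_of_ae (by simp [ae_iff])

lemma ae_image_ne (hinj : InjOn φ refTriangle) (x : E3) :
    ∀ᵐ p ∂volume.restrict refTriangle, φ p ≠ x := by
  rw [ae_restrict_iff' measurableSet_refTriangle, ae_iff]
  refine Set.Subsingleton.measure_zero (fun p hp q hq => ?_) _
  simp only [ne_eq, not_forall, not_not, exists_prop, mem_ofPred_eq] at hp hq
  exact hinj hp.1 hq.1 (hp.2.trans hq.2.symm)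

/-- The integral of `|x - y|^(-3/2)` over the triangle is bounded, uniformly in `x`. -/
theorem exists_integral_weakKernel_le (hφ : ContDiff ℝ 2 φ) (hinj : InjOn φ refTriangle)
    (himm : ∀ p ∈ refTriangle, Function.Injective (fderiv ℝ φ p)) :
    ∃ K, ∀ x, IntegrableOn (fun p => weakKernel ‖x - φ p‖) refTriangle ∧
      ∫ p in refTriangle, weakKernel ‖x - φ p‖ ≤ K := by
  obtain ⟨c, hc0, hc⟩ := exists_lower_lipschitz hφ hinj himm
  have hφc := hφ.continuous
  set F : ℝ × ℝ → ℝ := fun p => (√(c / 2) ^ 3)⁻¹ * (Iic (1 : ℝ)).indicator weakKernel ‖p‖ with hF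
  have hFi : Integrable F := integrable_weakKernel_plane.const_mul _
  have hF0 : ∀ p, 0 ≤ F p := fun p =>
    mul_nonneg (by positivity) (indicator_nonneg (fun _ _ => weakKernel_nonneg _) _)
  refine ⟨∫ p, F p, fun x => ?_⟩
  obtain ⟨q, hq, hqx⟩ := exists_nearest hφ hc x
  have hle : ∀ᵐ p ∂volume.restrict refTriangle, weakKernel ‖x - φ p‖ ≤ F (p - q) := by
    filter_upwards [ae_ne_refTriangle q, ae_restrict_mem measurableSet_refTriangle] with p hpq hp
    have h0 : 0 < ‖p - q‖ := norm_pos_iff.2 (sub_ne_zero.2 hpq)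
    refine (weakKernel_anti (by positivity) (hqx p hp).2).trans_eq ?_
    simp only [hF]
    rw [indicator_of_mem (by exact norm_sub_le_one_of_mem_refTriangle hp hq), weakKernel,
      weakKernel, Real.sqrt_mul (by positivity), mul_pow, mul_inv]
  have hFq := hFi.comp_sub_right q
  have hi : IntegrableOn (fun p => weakKernel ‖x - φ p‖) refTriangle := by
    refine hFq.integrableOn.mono' ?_ ?_
    · exact (measurable_weakKernel.comp (by fun_prop :
        Continuous fun p => ‖x - φ p‖).measurable).aestronglyMeasurable
    · filter_upwards [hle] with p hp
      rwa [Real.norm_eq_abs, abs_of_nonneg (weakKernel_nonneg _)]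
  refine ⟨hi, (integral_mono_ae hi hFq.integrableOn hle).trans ?_⟩
  refine (setIntegral_le_integral hFq (Eventually.of_forall fun p => hF0 _)).trans_eq ?_
  exact integral_sub_right_eq_self F q

/-- The integral of `1 / |x - y|` over the triangle is bounded, uniformly in `x`. -/
theorem exists_integral_inv_le (hφ : ContDiff ℝ 2 φ) (hinj : InjOn φ refTriangle)
    (himm : ∀ p ∈ refTriangle, Function.Injective (fderiv ℝ φ p)) :
    ∃ K, ∀ x, IntegrableOn (fun p => ‖x - φ p‖⁻¹) refTriangle ∧
      ∫ p in refTriangle, ‖x - φ p‖⁻¹ ≤ K := by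
  obtain ⟨K, hK⟩ := exists_integral_weakKernel_le hφ hinj himm
  have hφc := hφ.continuous
  refine ⟨(∫ _ in refTriangle, (1 : ℝ)) + K, fun x => ?_⟩
  have h1 : IntegrableOn (fun _ : ℝ × ℝ => (1 : ℝ)) refTriangle :=
    integrableOn_const volume_refTriangle_lt_top.ne
  have hs : IntegrableOn (fun p => 1 + weakKernel ‖x - φ p‖) refTriangle := h1.add (hK x).1
  have hi : IntegrableOn (fun p => ‖x - φ p‖⁻¹) refTriangle := by
    refine hs.mono' (by fun_prop : Measurable fun p => ‖x - φ p‖⁻¹).aestronglyMeasurable ?_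
    refine Eventually.of_forall fun p => ?_
    rw [Real.norm_eq_abs, abs_of_nonneg (by positivity)]
    exact inv_le_one_add_weakKernel (norm_nonneg _)
  refine ⟨hi, (integral_mono hi hs fun p => inv_le_one_add_weakKernel (norm_nonneg _)).trans ?_⟩
  rw [integral_add h1 (hK x).1]
  linarith [(hK x).2]

/-- The integral of `d / (d + c |q|)³` over the plane does not depend on `d`. -/
lemma integral_scaled_kernel {c d : ℝ} (hc : 0 < c) (hd : 0 < d) :
    Integrable (fun q : ℝ × ℝ => d * ((d + c * ‖q‖) ^ 3)⁻¹) ∧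
    ∫ q : ℝ × ℝ, d * ((d + c * ‖q‖) ^ 3)⁻¹
      = (c ^ 2)⁻¹ * ∫ q : ℝ × ℝ, ((1 + ‖q‖) ^ 3)⁻¹ := by
  have hJ : Integrable (fun q : ℝ × ℝ => ((1 + ‖q‖) ^ 3)⁻¹) := by
    have := integrable_one_add_norm (E := ℝ × ℝ) (μ := volume) (r := 3) (by simp; norm_num)
    refine this.congr (Eventually.of_forall fun q => ?_)
    simp only
    rw [Real.rpow_neg (by positivity)]
    norm_cast
  have e : ∀ q : ℝ × ℝ, d * ((d + c * ‖q‖) ^ 3)⁻¹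
      = (d ^ 2)⁻¹ * ((1 + ‖(c / d) • q‖) ^ 3)⁻¹ := by
    intro q
    rw [norm_smul, Real.norm_eq_abs, abs_of_pos (by positivity)]
    have h1 : 0 < d + c * ‖q‖ := by positivity
    have h2 : 1 + c / d * ‖q‖ = (d + c * ‖q‖) / d := by field_simp
    rw [h2]
    field_simp
  simp only [e]
  constructor
  · exact ((integrable_comp_smul_iff volume (fun q : ℝ × ℝ => ((1 + ‖q‖) ^ 3)⁻¹)
      (by positivity)).2 hJ).const_mul _
  · rw [integral_const_mul, Measure.integral_comp_smul_of_nonneg volume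
      (fun q : ℝ × ℝ => ((1 + ‖q‖) ^ 3)⁻¹) (c / d) (hR := by positivity)]
    simp only [Module.finrank_prod, Module.finrank_self, smul_eq_mul]
    norm_num
    field_simp

/-- The integral of `|n · (x - y)| / |x - y|³` over the triangle is bounded, uniformly in all points
`x` of space: this is, up to a factor, the unsigned solid angle at which the triangle is seen from
`x`. -/
theorem exists_integral_solidAngle_le (hφ : ContDiff ℝ 2 φ) (hinj : InjOn φ refTriangle)
    (himm : ∀ p ∈ refTriangle, Function.Injective (fderiv ℝ φ p)) :
    ∃ K, ∀ x, IntegrableOn (fun p => |⟪nvec φ p, x - φ p⟫| * (‖x - φ p‖ ^ 3)⁻¹) refTriangle ∧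
      ∫ p in refTriangle, |⟪nvec φ p, x - φ p⟫| * (‖x - φ p‖ ^ 3)⁻¹ ≤ K := by
  obtain ⟨c, hc0, hc⟩ := exists_lower_lipschitz hφ hinj himm
  obtain ⟨C, hC0, hC⟩ := exists_inner_nvec_le_sq hφ
  obtain ⟨K, hK⟩ := exists_integral_inv_le hφ hinj himm
  have ncont := (contDiff_nvec hφ).continuous
  obtain ⟨Kn, hKn0, hKn⟩ := exists_norm_le_refTriangle ncont.continuousOn
  have hφc := hφ.continuous
  set J := (((c / 2) ^ 2)⁻¹ * ∫ q : ℝ × ℝ, ((1 + ‖q‖) ^ 3)⁻¹) with hJ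
  have hJ0 : 0 ≤ J := mul_nonneg (by positivity) (integral_nonneg fun q => by positivity)
  refine ⟨Kn * (8 * J) + C / (c / 2) ^ 2 * K, fun x => ?_⟩
  obtain ⟨q, hq, hqx⟩ := exists_nearest hφ hc x
  -- `d` is the distance of `x` from the triangle, and `D` is a majorant of `d / |x - y|³`
  set d := ‖x - φ q‖ with hd
  set D : ℝ × ℝ → ℝ := fun p => 8 * (d * ((d + c / 2 * ‖p - q‖) ^ 3)⁻¹) with hD
  have hD0 : ∀ p, 0 ≤ D p := fun p => by positivity
  have hDint : Integrable D ∧ ∫ p, D p ≤ 8 * J := by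
    rcases (norm_nonneg (x - φ q)).eq_or_lt with h | h
    · have h0 : d = 0 := h.symm
      have : D = fun _ => 0 := by ext p; simp [hD, h0]
      rw [this]
      simpa using hJ0
    · obtain ⟨h1, h2⟩ := integral_scaled_kernel (c := c / 2) (half_pos hc0) h
      refine ⟨(h1.comp_sub_right q).const_mul 8, ?_⟩
      simp only [hD]
      rw [integral_const_mul, integral_sub_right_eq_self
        (fun p : ℝ × ℝ => d * ((d + c / 2 * ‖p‖) ^ 3)⁻¹) q]
      exact (congrArg (8 * ·) h2).le
  have hle : ∀ p ∈ refTriangle, |⟪nvec φ p, x - φ p⟫| * (‖x - φ p‖ ^ 3)⁻¹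
      ≤ Kn * D p + C / (c / 2) ^ 2 * ‖x - φ p‖⁻¹ := by
    intro p hp
    obtain ⟨h1, h2⟩ := hqx p hp
    rcases (norm_nonneg (x - φ p)).eq_or_lt with h | h
    · rw [← h]
      simp only [ne_eq, OfNat.ofNat_ne_zero, not_false_eq_true, zero_pow, inv_zero, mul_zero,
        add_zero]
      exact mul_nonneg hKn0 (hD0 p)
    · have e : x - φ p = (x - φ q) + (φ q - φ p) := by abel
      have b1 : |⟪nvec φ p, x - φ p⟫| ≤ Kn * d + C * ‖p - q‖ ^ 2 := by
        conv_lhs => rw [e, inner_add_right]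
        refine (abs_add_le _ _).trans (add_le_add ?_ ?_)
        · exact (abs_real_inner_le_norm _ _).trans
            (mul_le_mul_of_nonneg_right (hKn p hp) (norm_nonneg _))
        · rw [norm_sub_rev p q]; exact hC p hp q hq
      have b2 : d * (‖x - φ p‖ ^ 3)⁻¹ ≤ D p := by
        rcases (norm_nonneg (x - φ q)).eq_or_lt with h' | h'
        · have h0 : d = 0 := h'.symm
          rw [h0, zero_mul]; exact hD0 p
        · have hd' : 0 < d := h'
          have hs : d + c / 2 * ‖p - q‖ ≤ 2 * ‖x - φ p‖ := by linarith
          have hs0 : 0 < d + c / 2 * ‖p - q‖ := by positivity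
          have h3 : ((2 * ‖x - φ p‖) ^ 3)⁻¹ ≤ ((d + c / 2 * ‖p - q‖) ^ 3)⁻¹ := by gcongr
          calc d * (‖x - φ p‖ ^ 3)⁻¹ = 8 * (d * ((2 * ‖x - φ p‖) ^ 3)⁻¹) := by
                field_simp; norm_num
            _ ≤ D p := by simp only [hD]; gcongr
      have b3 : ‖p - q‖ ^ 2 * (‖x - φ p‖ ^ 3)⁻¹ ≤ ((c / 2) ^ 2)⁻¹ * ‖x - φ p‖⁻¹ := by
        have h4 : (c / 2) ^ 2 * ‖p - q‖ ^ 2 ≤ ‖x - φ p‖ ^ 2 := by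
          rw [← mul_pow]; gcongr
        have h5 : ‖p - q‖ ^ 2 ≤ ((c / 2) ^ 2)⁻¹ * ‖x - φ p‖ ^ 2 := by
          rw [le_inv_mul_iff₀ (by positivity)]; exact h4
        calc _ ≤ ((c / 2) ^ 2)⁻¹ * ‖x - φ p‖ ^ 2 * (‖x - φ p‖ ^ 3)⁻¹ := by gcongr
          _ = _ := by field_simp
      calc _ ≤ (Kn * d + C * ‖p - q‖ ^ 2) * (‖x - φ p‖ ^ 3)⁻¹ := by gcongr
        _ = Kn * (d * (‖x - φ p‖ ^ 3)⁻¹) + C * (‖p - q‖ ^ 2 * (‖x - φ p‖ ^ 3)⁻¹) := by ring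
        _ ≤ Kn * D p + C * (((c / 2) ^ 2)⁻¹ * ‖x - φ p‖⁻¹) := by gcongr
        _ = _ := by ring
  have hle' : ∀ᵐ p ∂volume.restrict refTriangle, |⟪nvec φ p, x - φ p⟫| * (‖x - φ p‖ ^ 3)⁻¹
      ≤ Kn * D p + C / (c / 2) ^ 2 * ‖x - φ p‖⁻¹ := by
    filter_upwards [ae_restrict_mem measurableSet_refTriangle] with p hp using hle p hp
  have i1 : IntegrableOn (fun p => Kn * D p) refTriangle := (hDint.1.const_mul Kn).integrableOn
  have i2 : IntegrableOn (fun p => C / (c / 2) ^ 2 * ‖x - φ p‖⁻¹) refTriangle :=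
    (hK x).1.const_mul _
  have hi : IntegrableOn (fun p => |⟪nvec φ p, x - φ p⟫| * (‖x - φ p‖ ^ 3)⁻¹) refTriangle := by
    refine (i1.add i2).mono' ?_ ?_
    · have : Continuous fun p => |⟪nvec φ p, x - φ p⟫| := by fun_prop
      have h2 : Measurable fun p => (‖x - φ p‖ ^ 3)⁻¹ := by fun_prop
      exact (this.measurable.mul h2).aestronglyMeasurable
    · filter_upwards [hle'] with p hp
      rw [Real.norm_eq_abs, abs_of_nonneg (by positivity)]
      exact hp
  refine ⟨hi, (integral_mono_ae hi (i1.add i2) hle').trans ?_⟩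
  simp only [Pi.add_apply]
  rw [integral_add i1 i2, integral_const_mul, integral_const_mul (C / (c / 2) ^ 2)]
  have h1 : ∫ p in refTriangle, D p ≤ 8 * J :=
    (setIntegral_le_integral hDint.1 (Eventually.of_forall hD0)).trans hDint.2
  exact add_le_add (mul_le_mul_of_nonneg_left h1 hKn0)
    (mul_le_mul_of_nonneg_left (hK x).2 (by positivity))

/-- The factor `n · (x - y)` is of second order in `|x - y|`, with a constant that depends on `x`.
If `x` lies on the triangle, this is `exists_inner_nvec_le_sq`; otherwise `|x - y|` is bounded
below. -/
lemma exists_inner_nvec_le (hφ : ContDiff ℝ 2 φ) (hinj : InjOn φ refTriangle)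
    (himm : ∀ p ∈ refTriangle, Function.Injective (fderiv ℝ φ p)) (x : E3) :
    ∃ C, ∀ p ∈ refTriangle, |⟪nvec φ p, x - φ p⟫| ≤ C * ‖x - φ p‖ ^ 2 := by
  obtain ⟨c, hc0, hc⟩ := exists_lower_lipschitz hφ hinj himm
  obtain ⟨C, hC0, hC⟩ := exists_inner_nvec_le_sq hφ
  obtain ⟨q, hq, hqx⟩ := exists_nearest hφ hc x
  rcases (norm_nonneg (x - φ q)).eq_or_lt with h | h
  · have hx : x = φ q := sub_eq_zero.1 (norm_eq_zero.1 h.symm)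
    refine ⟨C / c ^ 2, fun p hp => ?_⟩
    rw [hx]
    refine (hC p hp q hq).trans ?_
    have h4 : c ^ 2 * ‖q - p‖ ^ 2 ≤ ‖φ q - φ p‖ ^ 2 := by
      rw [← mul_pow]; gcongr; exact hc q hq p hp
    rw [div_mul_eq_mul_div, le_div_iff₀ (by positivity)]
    nlinarith
  · obtain ⟨Kn, hKn0, hKn⟩ := exists_norm_le_refTriangle
      (contDiff_nvec hφ).continuous.continuousOn
    refine ⟨Kn / ‖x - φ q‖, fun p hp => ?_⟩
    have h1 := (hqx p hp).1
    refine (abs_real_inner_le_norm _ _).trans ?_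
    rw [div_mul_eq_mul_div, le_div_iff₀ h]
    calc ‖nvec φ p‖ * ‖x - φ p‖ * ‖x - φ q‖ ≤ Kn * ‖x - φ p‖ * ‖x - φ p‖ := by
          gcongr; exact hKn p hp
      _ = _ := by ring

end Immersion

/-! ### The Kelvin tensor and its traction -/

section Kernels

/-- The common factor `1 / (8πμ(λ + 2μ))` of the entries of the Kelvin tensor. -/
noncomputable def kelvinConst (lam mu : ℝ) : ℝ := 1 / (8 * Real.pi * mu * (lam + 2 * mu))

lemma two_mul_kelvinConst {lam mu : ℝ} (hmu : mu ≠ 0) (hlam : lam + 2 * mu ≠ 0) :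
    2 * mu * kelvinConst lam mu * (lam + 2 * mu) = 1 / (4 * Real.pi) := by
  have := Real.pi_ne_zero
  unfold kelvinConst
  field_simp
  norm_num

lemma hasFDerivAt_inv_norm_sub {x y : E3} (h : y ≠ x) :
    HasFDerivAt (fun y => ‖x - y‖⁻¹) (((‖x - y‖ ^ 3)⁻¹) • innerSL ℝ (x - y)) y := by
  have h0 : 0 < ‖x - y‖ := norm_pos_iff.2 (sub_ne_zero.2 h.symm)
  have hq : 0 < ‖x - y‖ ^ 2 := by positivity
  have hs : √(‖x - y‖ ^ 2) = ‖x - y‖ := Real.sqrt_sq h0.le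
  have hd := (Real.hasDerivAt_sqrt hq.ne').fun_inv (by rw [hs]; exact h0.ne')
  refine ((hasFDerivAt_comp_norm_sub_sq x y hd).congr_of_eventuallyEq
    (Eventually.of_forall fun y => ?_)).congr_fderiv ?_
  · simp only [Real.sqrt_sq (norm_nonneg _)]
  · rw [hs]
    congr 1
    field_simp

lemma hasFDerivAt_inv_norm_sub_cube {x y : E3} (h : y ≠ x) :
    HasFDerivAt (fun y => (‖x - y‖ ^ 3)⁻¹) ((3 * (‖x - y‖ ^ 5)⁻¹) • innerSL ℝ (x - y)) y := by
  have h0 : 0 < ‖x - y‖ := norm_pos_iff.2 (sub_ne_zero.2 h.symm)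
  have h1 := (hasFDerivAt_inv_norm_sub h).pow 3
  refine (h1.congr_of_eventuallyEq (Eventually.of_forall fun y => (inv_pow _ _).symm)).congr_fderiv
    ?_
  ext v
  simp
  field_simp

/-- At `y = x`, both sides are zero: the function is unbounded there, hence not differentiable. -/
lemma fderiv_inv_norm_sub (x y v : E3) :
    fderiv ℝ (fun y : E3 => 1 / ‖x - y‖) y v = ⟪v, x - y⟫ * (‖x - y‖ ^ 3)⁻¹ := by
  simp only [one_div]
  by_cases h : y = x
  · subst h
    have hnd : ¬ DifferentiableAt ℝ (fun z : E3 => ‖y - z‖⁻¹) y := by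
      intro hd
      have h1 : Tendsto (fun z : E3 => ‖y - z‖⁻¹) (𝓝[≠] y) (𝓝 ‖y - y‖⁻¹) :=
        hd.continuousAt.tendsto.mono_left nhdsWithin_le_nhds
      have h2 : Tendsto (fun z : E3 => ‖y - z‖) (𝓝[≠] y) (𝓝[>] 0) := by
        refine tendsto_nhdsWithin_iff.2 ⟨?_, ?_⟩
        · have : Continuous fun z : E3 => ‖y - z‖ := by fun_prop
          simpa using (this.tendsto y).mono_left nhdsWithin_le_nhds
        · filter_upwards [self_mem_nhdsWithin] with z hz
          exact norm_pos_iff.2 (sub_ne_zero.2 (Ne.symm hz))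
      exact not_tendsto_nhds_of_tendsto_atTop (tendsto_inv_nhdsGT_zero.comp h2) _ h1
    rw [fderiv_zero_of_not_differentiableAt hnd]
    simp
  · rw [(hasFDerivAt_inv_norm_sub h).fderiv]
    rw [real_inner_comm, mul_comm]
    simp only [_root_.smul_apply, innerSL_apply_apply, smul_eq_mul]

lemma kelvinCol_eq (lam mu : ℝ) (x : E3) (k : Fin 3) (y : E3) :
    kelvinCol lam mu x k y = kelvinConst lam mu • (((lam + 3 * mu) * ‖x - y‖⁻¹) • e3 k
      + ((lam + mu) * ((‖x - y‖ ^ 3)⁻¹ * (x - y) k)) • (x - y)) := by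
  ext i
  simp only [kelvinCol, kelvin, Matrix.of_apply, kelvinConst, e3, PiLp.smul_apply, PiLp.add_apply,
    PiLp.sub_apply, smul_eq_mul, PiLp.single_apply]
  ring

lemma fderiv_kelvinCol (lam mu : ℝ) {x y : E3} (k : Fin 3) (h : y ≠ x) (v : E3) :
    fderiv ℝ (kelvinCol lam mu x k) y v = kelvinConst lam mu •
      (((lam + 3 * mu) * ((‖x - y‖ ^ 3)⁻¹ * ⟪x - y, v⟫)) • e3 k
      + (lam + mu) • ((3 * (‖x - y‖ ^ 5)⁻¹ * ⟪x - y, v⟫ * (x - y) k - (‖x - y‖ ^ 3)⁻¹ * v k)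
        • (x - y) - ((‖x - y‖ ^ 3)⁻¹ * (x - y) k) • v)) := by
  have hz : HasFDerivAt (fun y : E3 => x - y) (-ContinuousLinearMap.id ℝ E3) y :=
    (hasFDerivAt_id y).const_sub x
  have hzk : HasFDerivAt (fun y : E3 => (x - y) k)
      ((EuclideanSpace.proj k).comp (-ContinuousLinearMap.id ℝ E3)) y :=
    (EuclideanSpace.proj (𝕜 := ℝ) k).hasFDerivAt.comp y hz
  have h1 := ((hasFDerivAt_inv_norm_sub h).const_mul (lam + 3 * mu)).smul_const (e3 k)
  have h2 := (((hasFDerivAt_inv_norm_sub_cube h).mul hzk).const_mul (lam + mu)).smul hz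
  have h3 := (h1.add h2).const_smul (kelvinConst lam mu)
  have h4 : HasFDerivAt (kelvinCol lam mu x k) _ y :=
    h3.congr_of_eventuallyEq (Eventually.of_forall fun y => kelvinCol_eq lam mu x k y)
  rw [h4.fderiv]
  ext i
  simp [inner_sub_left]
  ring

lemma e3_apply (i j : Fin 3) : e3 i j = if j = i then 1 else 0 := by
  simp [e3]

lemma inner_matApply_transpose (A : Matrix (Fin 3) (Fin 3) ℝ) (a b : E3) :
    ⟪matApply Aᵀ a, b⟫ = ∑ i, ∑ k, A i k * a i * b k := by
  simp only [matApply, inner_eq_sum3, Matrix.mulVec, dotProduct, Matrix.transpose_apply,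
    Fin.sum_univ_three]
  ring

/-- The kernel of the elastic double layer potential. Only its first part is not weakly singular on
a surface with normal `n`; the other ones carry the factor `n · (x - y)`. -/
lemma inner_tractionKelvin (lam mu : ℝ) {x y : E3} (h : y ≠ x) (n a b : E3) :
    ⟪matApply (tractionKelvin lam mu x y n)ᵀ a, b⟫ = 2 * mu * kelvinConst lam mu *
      (mu * ((‖x - y‖ ^ 3)⁻¹ * (⟪n, b⟫ * ⟪x - y, a⟫ - ⟪n, a⟫ * ⟪x - y, b⟫))
        + mu * (⟪n, x - y⟫ * (‖x - y‖ ^ 3)⁻¹ * ⟪a, b⟫)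
        + (lam + mu) * (⟪n, x - y⟫ * (3 * (‖x - y‖ ^ 5)⁻¹ * (⟪x - y, b⟫ * ⟪x - y, a⟫)))) := by
  have h0 : 0 < ‖x - y‖ := norm_pos_iff.2 (sub_ne_zero.2 h.symm)
  have hq : (‖x - y‖ ^ 3)⁻¹ = (‖x - y‖ ^ 5)⁻¹ *
      ((x - y) 0 ^ 2 + (x - y) 1 ^ 2 + (x - y) 2 ^ 2) := by
    have : ‖x - y‖ ^ 2 = (x - y) 0 ^ 2 + (x - y) 1 ^ 2 + (x - y) 2 ^ 2 := by
      rw [← real_inner_self_eq_norm_sq, inner_eq_sum3]; ring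
    rw [← this]
    field_simp
  have entry : ∀ i k, tractionKelvin lam mu x y n i k = 2 * mu * kelvinConst lam mu *
      (mu * ((‖x - y‖ ^ 3)⁻¹ * (n k * (x - y) i - n i * (x - y) k))
        + mu * (⟪n, x - y⟫ * (‖x - y‖ ^ 3)⁻¹ * (if i = k then 1 else 0))
        + (lam + mu) * (⟪n, x - y⟫ * (3 * (‖x - y‖ ^ 5)⁻¹ * ((x - y) k * (x - y) i)))) := by
    intro i k
    simp only [tractionKelvin, traction, matApply, stress, Matrix.of_apply, Matrix.mulVec,
      dotProduct, fderiv_kelvinCol lam mu _ h, Fin.sum_univ_three, PiLp.smul_apply,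
      PiLp.add_apply, PiLp.sub_apply, smul_eq_mul, inner_eq_sum3, e3_apply]
    have hq' := hq
    simp only [PiLp.sub_apply] at hq'
    rw [hq']
    fin_cases i <;> fin_cases k <;> simp <;> ring
  rw [inner_matApply_transpose]
  simp only [entry, Fin.sum_univ_three, inner_eq_sum3]
  simp
  ring

lemma inner_kelvin (lam mu : ℝ) (x y a b : E3) :
    ⟪matApply (kelvin lam mu x y) a, b⟫ = kelvinConst lam mu *
      ((lam + 3 * mu) * (‖x - y‖⁻¹ * ⟪a, b⟫)
        + (lam + mu) * ((‖x - y‖ ^ 3)⁻¹ * ⟪x - y, b⟫ * ⟪a, x - y⟫)) := by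
  simp only [matApply, kelvin, Matrix.mulVec, dotProduct, Matrix.of_apply, Fin.sum_univ_three,
    inner_eq_sum3, PiLp.sub_apply, kelvinConst]
  simp
  ring

lemma inner_laplaceLineIntegrand (u : E3 → E3) (x y d b : E3) :
    ⟪laplaceLineIntegrand u x y d, b⟫ = ⟪‖x - y‖⁻¹ • cross b (u y), d⟫ := by
  simp only [laplaceLineIntegrand, inner_eq_sum3, PiLp.smul_apply, cross_apply_zero,
    cross_apply_one, cross_apply_two, smul_eq_mul]
  ring

lemma inner_kelvinLineIntegrand (lam mu : ℝ) (u : E3 → E3) (x y d b : E3) :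
    ⟪kelvinLineIntegrand lam mu u x y d, b⟫ = kelvinConst lam mu *
      ((lam + 3 * mu) * ⟪‖x - y‖⁻¹ • cross b (u y), d⟫
        + (lam + mu) * ⟪((‖x - y‖ ^ 3)⁻¹ * ⟪x - y, b⟫) • cross (x - y) (u y), d⟫) := by
  rw [kelvinLineIntegrand, inner_matApply_transpose]
  simp only [kelvinCross, Matrix.of_apply, kelvinCol_eq, Fin.sum_univ_three,
    inner_eq_sum3, PiLp.smul_apply, PiLp.add_apply, PiLp.sub_apply, cross_apply_zero,
    cross_apply_one, cross_apply_two, smul_eq_mul, e3_apply]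
  simp
  ring

/-- The Günter derivative, computed in the parameters. -/
lemma gunter_algebra (B : E3 →L[ℝ] E3) (a b : E3) (i : Fin 3) :
    ∑ j, (cross a b j * (B (e3 i)) j - cross a b i * (B (e3 j)) j)
      = (cross (B b) a - cross (B a) b) i := by
  have hB : ∀ v : E3, B v = v 0 • B (e3 0) + v 1 • B (e3 1) + v 2 • B (e3 2) := by
    intro v
    rw [← map_smul, ← map_smul, ← map_smul, ← map_add, ← map_add]
    congr 1
    apply e3_ext <;> simp [e3_apply]
  rw [hB a, hB b]
  fin_cases i <;> simp [Fin.sum_univ_three] <;> ring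

end Kernels

/-! ### One triangle of the surface -/

lemma eq_sum_inner_e3 (a : E3) : a = ∑ i, ⟪a, e3 i⟫ • e3 i := by
  rw [Fin.sum_univ_three]
  apply e3_ext <;> simp [inner_eq_sum3, e3_apply]

lemma tendsto_of_tendsto_inner {ι : Type*} {l : Filter ι} {f : ι → E3} {a : E3}
    (h : ∀ b, Tendsto (fun j => ⟪f j, b⟫) l (𝓝 ⟪a, b⟫)) : Tendsto f l (𝓝 a) := by
  rw [eq_sum_inner_e3 a]
  refine Tendsto.congr (fun j => (eq_sum_inner_e3 (f j)).symm) ?_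
  exact tendsto_finsetSum _ fun i _ => (h (e3 i)).smul_const _

lemma integrable_of_integrable_inner {α : Type*} [MeasurableSpace α] {μ : Measure α} {f : α → E3}
    (h : ∀ b, Integrable (fun a => ⟪f a, b⟫) μ) : Integrable f μ := by
  refine Integrable.congr (f := fun a => ∑ i, ⟪f a, e3 i⟫ • e3 i) ?_
    (Eventually.of_forall fun a => (eq_sum_inner_e3 (f a)).symm)
  exact integrable_finsetSum _ fun i _ => (h (e3 i)).smul_const _

lemma inner_integral_eq {α : Type*} [MeasurableSpace α] {μ : Measure α} {f : α → E3}
    (hf : Integrable f μ) (b : E3) : ⟪∫ a, f a ∂μ, b⟫ = ∫ a, ⟪f a, b⟫ ∂μ := by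
  rw [real_inner_comm, ← integral_inner hf b]
  simp only [real_inner_comm]

namespace Surface

variable (Γ : Surface) (k : Fin Γ.numFaces)

lemma continuous_chart : Continuous (Γ.chart k) := (Γ.contDiff_chart k).continuous

lemma continuous_normalVec : Continuous (Γ.normalVec k) :=
  (contDiff_nvec (Γ.contDiff_chart k)).continuous

lemma normalVec_ne_zero {p : ℝ × ℝ} (hp : p ∈ refTriangle) : Γ.normalVec k p ≠ 0 :=
  nvec_ne_zero (Γ.immersion_chart k p hp)

lemma measurable_density : Measurable fun p => ENNReal.ofReal ‖Γ.normalVec k p‖ :=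
  (Γ.continuous_normalVec k).norm.measurable.ennreal_ofReal

lemma integral_faceArea {E : Type*} [NormedAddCommGroup E] [NormedSpace ℝ E] (f : ℝ × ℝ → E) :
    ∫ p, f p ∂(Γ.faceArea k) = ∫ p in refTriangle, ‖Γ.normalVec k p‖ • f p := by
  rw [faceArea, integral_withDensity_eq_integral_toReal_smul (Γ.measurable_density k)
    (Eventually.of_forall fun _ => ENNReal.ofReal_lt_top)]
  simp only [ENNReal.toReal_ofReal (norm_nonneg _)]

lemma integrable_faceArea_iff {E : Type*} [NormedAddCommGroup E] [NormedSpace ℝ E]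
    (f : ℝ × ℝ → E) : Integrable f (Γ.faceArea k) ↔
      MeasureTheory.IntegrableOn (fun p => ‖Γ.normalVec k p‖ • f p) refTriangle := by
  rw [faceArea, integrable_withDensity_iff_integrable_smul' (Γ.measurable_density k)
    (Eventually.of_forall fun _ => ENNReal.ofReal_lt_top), MeasureTheory.IntegrableOn]
  simp only [ENNReal.toReal_ofReal (norm_nonneg _)]

instance isFiniteMeasure_faceArea : IsFiniteMeasure (Γ.faceArea k) := by
  have h : Integrable (fun _ : ℝ × ℝ => (1 : ℝ)) (Γ.faceArea k) := by
    rw [integrable_faceArea_iff]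
    have h0 : Continuous fun p => ‖Γ.normalVec k p‖ • (1 : ℝ) :=
      (Γ.continuous_normalVec k).norm.smul continuous_const
    exact h0.continuousOn.integrableOn_compact isCompact_refTriangle
  simpa [integrable_const_iff] using h

lemma faceArea_absolutelyContinuous : Γ.faceArea k ≪ volume.restrict refTriangle :=
  withDensity_absolutelyContinuous _ _

lemma ae_mem_faceArea : ∀ᵐ p ∂(Γ.faceArea k), p ∈ refTriangle :=
  (Γ.faceArea_absolutelyContinuous k).ae_le (ae_restrict_mem measurableSet_refTriangle)

variable {Γ k} {u : E3 → E3}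

lemma PiecewiseC1.contDiffOn (hu : Γ.PiecewiseC1 u) (k : Fin Γ.numFaces) :
    ContDiffOn ℝ 1 (fun p => u (Γ.chart k p)) refTriangle :=
  (hu k).comp ((Γ.contDiff_chart k).of_le (by norm_num)).contDiffOn fun p hp => ⟨p, hp, rfl⟩

/-- The Günter derivative is determined by the derivatives of the field in the parameters, although
the derivative within the triangle is not unique in the direction of the normal. -/
lemma PiecewiseC1.gunter_eq (hu : Γ.PiecewiseC1 u) (k : Fin Γ.numFaces) {p : ℝ × ℝ}
    (hp : p ∈ refTriangle) : Γ.gunter u k p = ‖Γ.normalVec k p‖⁻¹ • gunterDensity (Γ.chart k)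
      (fderivWithin ℝ (fun p => u (Γ.chart k p)) refTriangle) p := by
  have hd := ((hu k).differentiableOn (by norm_num) _
    (mem_image_of_mem (Γ.chart k) hp)).hasFDerivWithinAt
  have hφ := ((Γ.contDiff_chart k).differentiable (by norm_num) p).hasFDerivAt.hasFDerivWithinAt
    (s := refTriangle)
  have hw := (hd.comp p hφ fun q hq => ⟨q, hq, rfl⟩).fderivWithin (uniqueDiffOn_refTriangle p hp)
  have hw' : fderivWithin ℝ (fun p => u (Γ.chart k p)) refTriangle p
      = (fderivWithin ℝ u (Γ.face k) (Γ.chart k p)).comp (fderiv ℝ (Γ.chart k) p) := hw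
  have e1 : ∀ i, Γ.normal k p i = ‖Γ.normalVec k p‖⁻¹ *
      cross (tan₁ (Γ.chart k) p) (tan₂ (Γ.chart k) p) i := fun i => rfl
  ext i
  have := gunter_algebra (fderivWithin ℝ u (Γ.face k) (Γ.chart k p)) (tan₁ (Γ.chart k) p)
    (tan₂ (Γ.chart k) p) i
  simp only [gunter, gunterEntry, gunterDensity, hw', ContinuousLinearMap.comp_apply, e1,
    PiLp.smul_apply, smul_eq_mul, ← tan₁.eq_1 (Γ.chart k) p, ← tan₂.eq_1 (Γ.chart k) p]
  rw [← this, Finset.mul_sum]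
  exact Finset.sum_congr rfl fun j _ => by ring

lemma norm_smul_normal {p : ℝ × ℝ} (hp : p ∈ refTriangle) :
    ‖Γ.normalVec k p‖ • Γ.normal k p = nvec (Γ.chart k) p := by
  have := norm_ne_zero_iff.2 (Γ.normalVec_ne_zero k hp)
  rw [normal, smul_smul, mul_inv_cancel₀ this, one_smul]
  rfl

lemma norm_mul_inner_normal {p : ℝ × ℝ} (hp : p ∈ refTriangle) (a : E3) :
    ‖Γ.normalVec k p‖ * ⟪Γ.normal k p, a⟫ = ⟪nvec (Γ.chart k) p, a⟫ := by
  rw [← norm_smul_normal hp, real_inner_smul_left]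

lemma norm_mul_inner_gunter (hu : Γ.PiecewiseC1 u) {p : ℝ × ℝ} (hp : p ∈ refTriangle) (a : E3) :
    ‖Γ.normalVec k p‖ * ⟪Γ.gunter u k p, a⟫ = ⟪gunterDensity (Γ.chart k)
      (fderivWithin ℝ (fun p => u (Γ.chart k p)) refTriangle) p, a⟫ := by
  have := norm_ne_zero_iff.2 (Γ.normalVec_ne_zero k hp)
  rw [hu.gunter_eq k hp, real_inner_smul_left, ← mul_assoc, mul_inv_cancel₀ this, one_mul]

/-! ### Convergence of the surface integrals -/

lemma aestronglyMeasurable_comp_chart (hu : Γ.PiecewiseC1 u) (k : Fin Γ.numFaces) :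
    AEStronglyMeasurable (fun p => u (Γ.chart k p)) (Γ.faceArea k) :=
  ((hu.contDiffOn k).continuousOn.aestronglyMeasurable measurableSet_refTriangle).mono_ac
    (Γ.faceArea_absolutelyContinuous k)

lemma continuousOn_gunter (hu : Γ.PiecewiseC1 u) (k : Fin Γ.numFaces) :
    ContinuousOn (Γ.gunter u k) refTriangle := by
  have h1 := continuousOn_gunterDensity (Γ.contDiff_chart k)
    ((hu.contDiffOn k).continuousOn_fderivWithin uniqueDiffOn_refTriangle (by norm_num))
  have h2 : ContinuousOn (fun p => ‖Γ.normalVec k p‖⁻¹) refTriangle :=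
    (Γ.continuous_normalVec k).norm.continuousOn.inv₀
      fun p hp => norm_ne_zero_iff.2 (Γ.normalVec_ne_zero k hp)
  exact (h2.smul h1).congr fun p hp => hu.gunter_eq k hp

lemma aestronglyMeasurable_gunter (hu : Γ.PiecewiseC1 u) (k : Fin Γ.numFaces) :
    AEStronglyMeasurable (Γ.gunter u k) (Γ.faceArea k) :=
  ((continuousOn_gunter hu k).aestronglyMeasurable measurableSet_refTriangle).mono_ac
    (Γ.faceArea_absolutelyContinuous k)

lemma matApply_kelvin_eq (lam mu : ℝ) (x y a : E3) :
    matApply (kelvin lam mu x y) a = kelvinConst lam mu • (((lam + 3 * mu) * ‖x - y‖⁻¹) • a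
      + ((lam + mu) * ((‖x - y‖ ^ 3)⁻¹ * ⟪a, x - y⟫)) • (x - y)) := by
  refine ext_inner_right ℝ fun b => ?_
  rw [inner_kelvin]
  simp only [real_inner_smul_left, inner_add_left]
  ring

lemma norm_matApply_kelvin_le (lam mu : ℝ) (x y a : E3) :
    ‖matApply (kelvin lam mu x y) a‖
      ≤ |kelvinConst lam mu| * (|lam + 3 * mu| + |lam + mu|) * (‖x - y‖⁻¹ * ‖a‖) := by
  rw [matApply_kelvin_eq, norm_smul, Real.norm_eq_abs, mul_assoc]
  gcongr
  refine (norm_add_le _ _).trans ?_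
  rw [norm_smul, norm_smul, Real.norm_eq_abs, Real.norm_eq_abs, abs_mul, abs_mul, abs_mul,
    abs_of_nonneg (by positivity : 0 ≤ ‖x - y‖⁻¹), abs_of_nonneg (by positivity :
    0 ≤ (‖x - y‖ ^ 3)⁻¹), add_mul]
  refine add_le_add (by rw [mul_assoc]) ?_
  rcases (norm_nonneg (x - y)).eq_or_lt with h | h
  · rw [← h]; simp
  · calc _ ≤ |lam + mu| * ((‖x - y‖ ^ 3)⁻¹ * (‖a‖ * ‖x - y‖)) * ‖x - y‖ := by
          gcongr; exact abs_real_inner_le_norm _ _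
      _ = _ := by field_simp

section Measurability

variable {α : Type*} [MeasurableSpace α] {m : Measure α} {X : α → E3} {P : α → ℝ × ℝ}

/-- The integrands are measurable in the two variables jointly. -/
lemma aestronglyMeasurable_elasticSL (lam mu : ℝ) (hX : Measurable X) (hP : Measurable P)
    (hg : AEStronglyMeasurable (fun a => Γ.gunter u k (P a)) m) :
    AEStronglyMeasurable (fun a => Γ.elasticSLIntegrand lam mu u (X a) k (P a)) m := by
  have hz : Measurable fun a => X a - Γ.chart k (P a) :=
    hX.sub ((Γ.continuous_chart k).measurable.comp hP)
  have hn := hz.norm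
  have hz' := hz.aestronglyMeasurable (μ := m)
  simp only [elasticSLIntegrand, matApply_kelvin_eq]
  have h1 : AEStronglyMeasurable (fun a => (lam + 3 * mu) * ‖X a - Γ.chart k (P a)‖⁻¹) m :=
    (by fun_prop : Measurable _).aestronglyMeasurable
  have h2 : AEStronglyMeasurable (fun a => (‖X a - Γ.chart k (P a)‖ ^ 3)⁻¹) m :=
    (by fun_prop : Measurable _).aestronglyMeasurable
  have h3 : AEStronglyMeasurable
      (fun a => ⟪Γ.gunter u k (P a), X a - Γ.chart k (P a)⟫) m := hg.inner hz'
  exact ((h1.smul hg).add (((h2.mul h3).const_mul (lam + mu)).smul hz')).const_smul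
    (kelvinConst lam mu)

lemma aestronglyMeasurable_laplaceSL (hX : Measurable X) (hP : Measurable P)
    (hg : AEStronglyMeasurable (fun a => Γ.gunter u k (P a)) m) :
    AEStronglyMeasurable (fun a => Γ.laplaceSLIntegrand u (X a) k (P a)) m := by
  have hz : Measurable fun a => X a - Γ.chart k (P a) :=
    hX.sub ((Γ.continuous_chart k).measurable.comp hP)
  have h1 : AEStronglyMeasurable (fun a => 1 / ‖X a - Γ.chart k (P a)‖) m :=
    (measurable_const.div hz.norm).aestronglyMeasurable
  exact h1.smul hg

lemma aestronglyMeasurable_laplaceDL (hX : Measurable X) (hP : Measurable P)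
    (hg : AEStronglyMeasurable (fun a => u (Γ.chart k (P a))) m) :
    AEStronglyMeasurable (fun a => Γ.laplaceDLIntegrand u (X a) k (P a)) m := by
  have hz : Measurable fun a => X a - Γ.chart k (P a) :=
    hX.sub ((Γ.continuous_chart k).measurable.comp hP)
  simp only [laplaceDLIntegrand, fderiv_inv_norm_sub]
  have hN : Measurable fun a => Γ.normal k (P a) := by
    have := (Γ.continuous_normalVec k).measurable.comp hP
    exact this.norm.inv.smul this
  have h1 : AEStronglyMeasurable (fun a => ⟪Γ.normal k (P a), X a - Γ.chart k (P a)⟫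
      * (‖X a - Γ.chart k (P a)‖ ^ 3)⁻¹) m :=
    ((hN.inner hz).mul (hz.norm.pow_const 3).inv).aestronglyMeasurable
  exact h1.smul hg

end Measurability

/-- Integrals with a majorant whose integrals are uniformly bounded. -/
lemma integrable_and_norm_integral_le {f : ℝ × ℝ → E3} {κ : ℝ × ℝ → ℝ} {C K : ℝ} (hC : 0 ≤ C)
    (hf : AEStronglyMeasurable f (Γ.faceArea k))
    (hle : ∀ p ∈ refTriangle, ‖Γ.normalVec k p‖ * ‖f p‖ ≤ C * κ p)
    (hκ : MeasureTheory.IntegrableOn κ refTriangle) (hK : ∫ p in refTriangle, κ p ≤ K) :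
    Integrable f (Γ.faceArea k) ∧ ‖∫ p, f p ∂(Γ.faceArea k)‖ ≤ C * K := by
  have hle' : ∀ᵐ p ∂volume.restrict refTriangle,
      ‖‖Γ.normalVec k p‖ * ‖f p‖‖ ≤ C * κ p := by
    filter_upwards [ae_restrict_mem measurableSet_refTriangle] with p hp
    rw [Real.norm_eq_abs, abs_of_nonneg (by positivity)]
    exact hle p hp
  have hmeas : AEStronglyMeasurable (fun p => ‖Γ.normalVec k p‖ * ‖f p‖)
      (volume.restrict refTriangle) := by
    have hf' : AEStronglyMeasurable f ((volume.restrict refTriangle).withDensity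
        fun p => ((‖Γ.normalVec k p‖.toNNReal : NNReal) : ENNReal)) := hf
    rw [aestronglyMeasurable_withDensity_iff
      (Γ.continuous_normalVec k).norm.measurable.real_toNNReal] at hf'
    refine hf'.norm.congr (Eventually.of_forall fun p => ?_)
    simp [norm_smul]
  have hi : MeasureTheory.IntegrableOn (fun p => ‖Γ.normalVec k p‖ * ‖f p‖) refTriangle :=
    (hκ.const_mul C).mono' hmeas hle'
  have hnorm : Integrable (fun p => ‖f p‖) (Γ.faceArea k) :=
    (Γ.integrable_faceArea_iff k _).2 hi
  refine ⟨(integrable_norm_iff hf).1 hnorm, (norm_integral_le_integral_norm _).trans ?_⟩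
  rw [integral_faceArea]
  refine (integral_mono_ae hi (hκ.const_mul C) ?_).trans ?_
  · filter_upwards [ae_restrict_mem measurableSet_refTriangle] with p hp using hle p hp
  · rw [integral_const_mul]
    exact mul_le_mul_of_nonneg_left hK hC

lemma exists_elasticSL_bound (lam mu : ℝ) (hu : Γ.PiecewiseC1 u) (k : Fin Γ.numFaces) :
    ∃ K, ∀ x, Integrable (Γ.elasticSLIntegrand lam mu u x k) (Γ.faceArea k) ∧
      ‖∫ p, Γ.elasticSLIntegrand lam mu u x k p ∂(Γ.faceArea k)‖ ≤ K := by
  obtain ⟨K, hK⟩ := exists_integral_inv_le (Γ.contDiff_chart k) (Γ.injOn_chart k)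
    (Γ.immersion_chart k)
  obtain ⟨C, hC0, hC⟩ := exists_norm_le_refTriangle
    ((Γ.continuous_normalVec k).norm.continuousOn.mul (continuousOn_gunter hu k).norm)
  refine ⟨_, fun x => integrable_and_norm_integral_le (C := |kelvinConst lam mu| *
    (|lam + 3 * mu| + |lam + mu|) * C) (by positivity)
    (aestronglyMeasurable_elasticSL lam mu measurable_const measurable_id
      (aestronglyMeasurable_gunter hu k)) (fun p hp => ?_) (hK x).1 (hK x).2⟩
  have h1 := norm_matApply_kelvin_le lam mu x (Γ.chart k p) (Γ.gunter u k p)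
  have h2 : ‖Γ.normalVec k p‖ * ‖Γ.gunter u k p‖ ≤ C := (le_abs_self _).trans (hC p hp)
  calc _ ≤ ‖Γ.normalVec k p‖ * (|kelvinConst lam mu| * (|lam + 3 * mu| + |lam + mu|) *
        (‖x - Γ.chart k p‖⁻¹ * ‖Γ.gunter u k p‖)) := by gcongr; exact h1
    _ = |kelvinConst lam mu| * (|lam + 3 * mu| + |lam + mu|) *
        (‖Γ.normalVec k p‖ * ‖Γ.gunter u k p‖) * ‖x - Γ.chart k p‖⁻¹ := by ring
    _ ≤ _ := by gcongr

lemma exists_laplaceSL_bound (hu : Γ.PiecewiseC1 u) (k : Fin Γ.numFaces) :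
    ∃ K, ∀ x, Integrable (Γ.laplaceSLIntegrand u x k) (Γ.faceArea k) ∧
      ‖∫ p, Γ.laplaceSLIntegrand u x k p ∂(Γ.faceArea k)‖ ≤ K := by
  obtain ⟨K, hK⟩ := exists_integral_inv_le (Γ.contDiff_chart k) (Γ.injOn_chart k)
    (Γ.immersion_chart k)
  obtain ⟨C, hC0, hC⟩ := exists_norm_le_refTriangle
    ((Γ.continuous_normalVec k).norm.continuousOn.mul (continuousOn_gunter hu k).norm)
  refine ⟨_, fun x => integrable_and_norm_integral_le hC0
    (aestronglyMeasurable_laplaceSL measurable_const measurable_id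
      (aestronglyMeasurable_gunter hu k)) (fun p hp => ?_) (hK x).1 (hK x).2⟩
  have h2 : ‖Γ.normalVec k p‖ * ‖Γ.gunter u k p‖ ≤ C := (le_abs_self _).trans (hC p hp)
  calc _ = ‖Γ.normalVec k p‖ * ‖Γ.gunter u k p‖ * ‖x - Γ.chart k p‖⁻¹ := by
        rw [laplaceSLIntegrand, norm_smul, one_div, norm_inv, norm_norm]; ring
    _ ≤ _ := by gcongr

lemma exists_laplaceDL_bound (hu : Γ.PiecewiseC1 u) (k : Fin Γ.numFaces) :
    ∃ K, ∀ x, Integrable (Γ.laplaceDLIntegrand u x k) (Γ.faceArea k) ∧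
      ‖∫ p, Γ.laplaceDLIntegrand u x k p ∂(Γ.faceArea k)‖ ≤ K := by
  obtain ⟨K, hK⟩ := exists_integral_solidAngle_le (Γ.contDiff_chart k) (Γ.injOn_chart k)
    (Γ.immersion_chart k)
  obtain ⟨C, hC0, hC⟩ := exists_norm_le_refTriangle (hu.contDiffOn k).continuousOn
  refine ⟨_, fun x => integrable_and_norm_integral_le hC0
    (aestronglyMeasurable_laplaceDL measurable_const measurable_id
      (aestronglyMeasurable_comp_chart hu k)) (fun p hp => ?_) (hK x).1 (hK x).2⟩
  calc _ = |⟪nvec (Γ.chart k) p, x - Γ.chart k p⟫| * (‖x - Γ.chart k p‖ ^ 3)⁻¹ *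
        ‖u (Γ.chart k p)‖ := by
        rw [laplaceDLIntegrand, fderiv_inv_norm_sub, norm_smul, Real.norm_eq_abs, abs_mul,
          abs_of_nonneg (by positivity : 0 ≤ (‖x - Γ.chart k p‖ ^ 3)⁻¹),
          ← norm_mul_inner_normal hp, abs_mul, abs_norm]
        ring
    _ ≤ |⟪nvec (Γ.chart k) p, x - Γ.chart k p⟫| * (‖x - Γ.chart k p‖ ^ 3)⁻¹ * C := by
        gcongr; exact hC p hp
    _ = _ := by ring

end Surface

/-! ### The principal value on one triangle -/

/-- A weakly singular integral is the limit of the integrals over `|x - y| > ε`. -/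
lemma tendsto_integral_indicator {φ : ℝ × ℝ → E3} (hφ : Continuous φ) {x : E3}
    (hnull : ∀ᵐ p ∂volume.restrict refTriangle, φ p ≠ x) {f : ℝ × ℝ → ℝ}
    (hf : IntegrableOn f refTriangle) :
    Tendsto (fun ε => ∫ p in refTriangle, {p | ε < ‖x - φ p‖}.indicator f p) (𝓝[>] 0)
      (𝓝 (∫ p in refTriangle, f p)) := by
  refine tendsto_integral_filter_of_dominated_convergence (fun p => ‖f p‖)
    (Eventually.of_forall fun ε => ?_) (Eventually.of_forall fun ε => ?_) hf.norm ?_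
  · exact hf.aestronglyMeasurable.indicator
      (isOpen_lt continuous_const (continuous_const.sub hφ).norm).measurableSet
  · exact Eventually.of_forall fun p => norm_indicator_le_norm_self _ _
  · filter_upwards [hnull] with p hp
    refine tendsto_const_nhds.congr' ?_
    have h0 : 0 < ‖x - φ p‖ := norm_pos_iff.2 (sub_ne_zero.2 hp.symm)
    filter_upwards [mem_nhdsWithin_of_mem_nhds (Iio_mem_nhds h0)] with ε hε
    rw [indicator_of_mem (by exact hε)]

section KernelParts

variable (φ w : ℝ × ℝ → E3) (x b : E3)

/-- The part of the kernel of the double layer potential (applied to `w`, paired with `b` and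
multiplied by the area density) that is a tangential derivative of `1 / |x - y|`. -/
noncomputable def tangentialPart (p : ℝ × ℝ) : ℝ := (‖x - φ p‖ ^ 3)⁻¹ *
  (⟪nvec φ p, b⟫ * ⟪x - φ p, w p⟫ - ⟪nvec φ p, w p⟫ * ⟪x - φ p, b⟫)

/-- The part of the kernel of the double layer potential that is the normal derivative of
`1 / |x - y|`. -/
noncomputable def normalPart (p : ℝ × ℝ) : ℝ :=
  ⟪nvec φ p, x - φ p⟫ * (‖x - φ p‖ ^ 3)⁻¹ * ⟪w p, b⟫

/-- The part of the kernel of the double layer potential with the dyad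
`(x - y) ⊗ (x - y) / |x - y|⁵`. -/
noncomputable def dyadPart (p : ℝ × ℝ) : ℝ := ⟪nvec φ p, x - φ p⟫ *
  (3 * (‖x - φ p‖ ^ 5)⁻¹ * (⟪x - φ p, b⟫ * ⟪x - φ p, w p⟫))

variable {φ w x}

lemma integrableOn_kernel_parts (hφ : ContDiff ℝ 2 φ) (wc : ContinuousOn w refTriangle)
    (hint : IntegrableOn (fun p => ‖x - φ p‖⁻¹) refTriangle)
    (hnull : ∀ᵐ p ∂volume.restrict refTriangle, φ p ≠ x)
    {C : ℝ} (hC : ∀ p ∈ refTriangle, |⟪nvec φ p, x - φ p⟫| ≤ C * ‖x - φ p‖ ^ 2) :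
    (∀ ε > 0, IntegrableOn ({p | ε < ‖x - φ p‖}.indicator (tangentialPart φ w x b)) refTriangle) ∧
    IntegrableOn (normalPart φ w x b) refTriangle ∧
    IntegrableOn (dyadPart φ w x b) refTriangle := by
  have hφc := hφ.continuous
  have hT := ae_restrict_mem (μ := volume) measurableSet_refTriangle
  have nc : ContinuousOn (nvec φ) refTriangle := (contDiff_nvec hφ).continuous.continuousOn
  have zc : ContinuousOn (fun p => x - φ p) refTriangle := (continuous_const.sub hφc).continuousOn
  have rm : ∀ n : ℕ, AEStronglyMeasurable (fun p => (‖x - φ p‖ ^ n)⁻¹)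
      (volume.restrict refTriangle) := fun n =>
    ((continuous_const.sub hφc).norm.measurable.pow_const n).inv.aestronglyMeasurable
  have hmeas : ∀ {f : ℝ × ℝ → ℝ}, ContinuousOn f refTriangle →
      AEStronglyMeasurable f (volume.restrict refTriangle) :=
    fun hf => hf.aestronglyMeasurable measurableSet_refTriangle
  obtain ⟨Kw, hKw0, hKw⟩ := exists_norm_le_refTriangle wc
  obtain ⟨Kn, hKn0, hKn⟩ := exists_norm_le_refTriangle nc
  have nzc : ContinuousOn (fun p => ⟪nvec φ p, x - φ p⟫) refTriangle := nc.inner zc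
  have wbc : ContinuousOn (fun p => ⟪w p, b⟫) refTriangle := wc.inner continuousOn_const
  have zbwc : ContinuousOn (fun p => ⟪x - φ p, b⟫ * ⟪x - φ p, w p⟫) refTriangle :=
    (zc.inner continuousOn_const).mul (zc.inner wc)
  have sc : ContinuousOn (fun p => ⟪nvec φ p, b⟫ * ⟪x - φ p, w p⟫
      - ⟪nvec φ p, w p⟫ * ⟪x - φ p, b⟫) refTriangle :=
    ((nc.inner continuousOn_const).mul (zc.inner wc)).sub
      ((nc.inner wc).mul (zc.inner continuousOn_const))
  have Sm : AEStronglyMeasurable (tangentialPart φ w x b) (volume.restrict refTriangle) :=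
    (rm 3).mul (hmeas sc)
  have Dm : AEStronglyMeasurable (normalPart φ w x b) (volume.restrict refTriangle) :=
    ((hmeas nzc).mul (rm 3)).mul (hmeas wbc)
  have Em : AEStronglyMeasurable (dyadPart φ w x b) (volume.restrict refTriangle) :=
    (hmeas nzc).mul (((rm 5).const_mul 3).mul (hmeas zbwc))
  have b1 : ∀ p ∈ refTriangle, |⟪nvec φ p, x - φ p⟫| ≤ |C| * ‖x - φ p‖ ^ 2 := fun p hp =>
    (hC p hp).trans (mul_le_mul_of_nonneg_right (le_abs_self C) (sq_nonneg _))
  have b2 : ∀ p, |⟪x - φ p, b⟫| ≤ ‖x - φ p‖ * ‖b‖ := fun p => abs_real_inner_le_norm _ _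
  have b3 : ∀ p ∈ refTriangle, |⟪x - φ p, w p⟫| ≤ ‖x - φ p‖ * Kw := fun p hp =>
    (abs_real_inner_le_norm _ _).trans (mul_le_mul_of_nonneg_left (hKw p hp) (norm_nonneg _))
  have b4 : ∀ p ∈ refTriangle, |⟪w p, b⟫| ≤ Kw * ‖b‖ := fun p hp =>
    (abs_real_inner_le_norm _ _).trans (mul_le_mul_of_nonneg_right (hKw p hp) (norm_nonneg _))
  have b5 : ∀ p ∈ refTriangle, |⟪nvec φ p, w p⟫| ≤ Kn * Kw := fun p hp =>
    (abs_real_inner_le_norm _ _).trans (mul_le_mul (hKn p hp) (hKw p hp) (norm_nonneg _) hKn0)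
  have b6 : ∀ p ∈ refTriangle, |⟪nvec φ p, b⟫| ≤ Kn * ‖b‖ := fun p hp =>
    (abs_real_inner_le_norm _ _).trans (mul_le_mul_of_nonneg_right (hKn p hp) (norm_nonneg _))
  have Di : IntegrableOn (normalPart φ w x b) refTriangle := by
    refine (hint.const_mul (|C| * (Kw * ‖b‖))).mono' Dm ?_
    filter_upwards [hT, hnull] with p hp hpx
    have h0 : 0 < ‖x - φ p‖ := norm_pos_iff.2 (sub_ne_zero.2 hpx.symm)
    rw [Real.norm_eq_abs, normalPart, abs_mul, abs_mul,
      abs_of_pos (by positivity : 0 < (‖x - φ p‖ ^ 3)⁻¹)]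
    calc _ ≤ (|C| * ‖x - φ p‖ ^ 2) * (‖x - φ p‖ ^ 3)⁻¹ * (Kw * ‖b‖) := by
          gcongr
          · exact b1 p hp
          · exact b4 p hp
      _ = _ := by field_simp
  have Ei : IntegrableOn (dyadPart φ w x b) refTriangle := by
    refine (hint.const_mul (|C| * (3 * (Kw * ‖b‖)))).mono' Em ?_
    filter_upwards [hT, hnull] with p hp hpx
    have h0 : 0 < ‖x - φ p‖ := norm_pos_iff.2 (sub_ne_zero.2 hpx.symm)
    rw [Real.norm_eq_abs, dyadPart, abs_mul, abs_mul, abs_mul ⟪x - φ p, b⟫,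
      abs_of_pos (by positivity : 0 < 3 * (‖x - φ p‖ ^ 5)⁻¹)]
    calc _ ≤ (|C| * ‖x - φ p‖ ^ 2) * (3 * (‖x - φ p‖ ^ 5)⁻¹ *
          ((‖x - φ p‖ * ‖b‖) * (‖x - φ p‖ * Kw))) := by
          gcongr
          · exact b1 p hp
          · exact b2 p
          · exact b3 p hp
      _ = _ := by field_simp
  have hset : ∀ ε : ℝ, MeasurableSet {p | ε < ‖x - φ p‖} := fun ε =>
    (isOpen_lt continuous_const (continuous_const.sub hφc).norm).measurableSet
  refine ⟨fun ε hε => ?_, Di, Ei⟩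
  refine (hint.const_mul (ε⁻¹ * (2 * (Kn * Kw * ‖b‖)))).mono' (Sm.indicator (hset ε)) ?_
  filter_upwards [hT] with p hp
  by_cases hpε : ε < ‖x - φ p‖
  · have h0 : 0 < ‖x - φ p‖ := hε.trans hpε
    rw [indicator_of_mem (by exact hpε), Real.norm_eq_abs, tangentialPart, abs_mul,
      abs_of_pos (by positivity : 0 < (‖x - φ p‖ ^ 3)⁻¹)]
    calc _ ≤ (‖x - φ p‖ ^ 3)⁻¹ * (|⟪nvec φ p, b⟫| * |⟪x - φ p, w p⟫|
          + |⟪nvec φ p, w p⟫| * |⟪x - φ p, b⟫|) := by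
          rw [← abs_mul, ← abs_mul]; gcongr; exact abs_sub _ _
      _ ≤ (‖x - φ p‖ ^ 3)⁻¹ * ((Kn * ‖b‖) * (‖x - φ p‖ * Kw)
          + (Kn * Kw) * (‖x - φ p‖ * ‖b‖)) := by
          gcongr
          · exact b6 p hp
          · exact b3 p hp
          · exact b5 p hp
          · exact b2 p
      _ = ‖x - φ p‖⁻¹ * (2 * (Kn * Kw * ‖b‖)) * ‖x - φ p‖⁻¹ := by field_simp; ring
      _ ≤ _ := by
          gcongr
  · rw [indicator_of_notMem (by exact hpε), norm_zero]
    positivity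

end KernelParts

lemma circulation_add {φ : ℝ × ℝ → E3} {V W : ℝ × ℝ → E3} (hφ : ContDiff ℝ 2 φ)
    (hV : ∀ i, ContinuousOn (fun t => V (refEdge i t)) (Icc 0 1))
    (hW : ∀ i, ContinuousOn (fun t => W (refEdge i t)) (Icc 0 1)) (a b : ℝ) :
    circulation φ (fun p => a • V p + b • W p) = a * circulation φ V + b * circulation φ W := by
  have hd := fun i => (continuous_deriv_edge hφ i).continuousOn (s := Icc 0 1)
  have key : ∀ U : ℝ × ℝ → E3, (∀ i, ContinuousOn (fun t => U (refEdge i t)) (Icc 0 1)) → ∀ i,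
      IntervalIntegrable (fun t => ⟪U (refEdge i t), deriv (fun τ => φ (refEdge i τ)) t⟫)
        volume 0 1 := by
    intro U hU i
    refine ContinuousOn.intervalIntegrable ?_
    rw [uIcc_of_le zero_le_one]
    exact (hU i).inner (hd i)
  simp only [circulation, Finset.mul_sum]
  rw [← Finset.sum_add_distrib]
  refine Finset.sum_congr rfl fun i _ => ?_
  rw [← intervalIntegral.integral_const_mul, ← intervalIntegral.integral_const_mul,
    ← intervalIntegral.integral_add ((key V hV i).const_mul a) ((key W hW i).const_mul b)]
  simp only [inner_add_left, real_inner_smul_left]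

lemma continuousOn_refEdge_comp {E : Type*} [TopologicalSpace E] {f : ℝ × ℝ → E}
    (hf : ContinuousOn f refTriangle) (i : Fin 3) :
    ContinuousOn (fun t => f (refEdge i t)) (Icc 0 1) :=
  hf.comp (continuous_refEdge i).continuousOn fun _ ht => refEdge_mem i ht

namespace Surface

variable {Γ : Surface} {k : Fin Γ.numFaces} {u : E3 → E3} {x : E3}

/-- The boundary integral of one triangle, in which edges are not distinguished from each other. -/
noncomputable def faceLineIntegral (Γ : Surface) (k : Fin Γ.numFaces) (F : E3 → E3 → E3) : E3 :=
  ∑ i, ∫ t in (0 : ℝ)..1, F (Γ.edge (k, i) t) (deriv (Γ.edge (k, i)) t)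

lemma continuous_edge (a : Fin Γ.numFaces × Fin 3) : Continuous (Γ.edge a) :=
  (Γ.continuous_chart a.1).comp (continuous_refEdge a.2)

lemma continuousOn_comp_edge (hu : Γ.PiecewiseC1 u) (a : Fin Γ.numFaces × Fin 3) :
    ContinuousOn (fun t => u (Γ.edge a t)) (Icc 0 1) :=
  continuousOn_refEdge_comp (hu.contDiffOn a.1).continuousOn a.2

lemma continuous_deriv_edge' (a : Fin Γ.numFaces × Fin 3) : Continuous (deriv (Γ.edge a)) :=
  continuous_deriv_edge (Γ.contDiff_chart a.1) a.2

lemma laplaceLineIntegrand_eq (u : E3 → E3) (x y d : E3) :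
    laplaceLineIntegrand u x y d = ‖x - y‖⁻¹ • cross (u y) d := by
  rw [laplaceLineIntegrand, one_div]

lemma kelvinLineIntegrand_eq (lam mu : ℝ) (u : E3 → E3) (x y d : E3) :
    kelvinLineIntegrand lam mu u x y d = kelvinConst lam mu •
      (((lam + 3 * mu) * ‖x - y‖⁻¹) • cross (u y) d
        + ((lam + mu) * ((‖x - y‖ ^ 3)⁻¹ * ⟪cross (x - y) (u y), d⟫)) • (x - y)) := by
  refine ext_inner_right ℝ fun b => ?_
  rw [inner_kelvinLineIntegrand]
  simp only [real_inner_smul_left, inner_add_left]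
  have : ⟪cross (u y) d, b⟫ = ⟪cross b (u y), d⟫ := by
    simp only [inner_eq_sum3, cross_apply_zero, cross_apply_one, cross_apply_two]; ring
  rw [this]
  ring

lemma intervalIntegrable_laplaceLine (hu : Γ.PiecewiseC1 u) (a : Fin Γ.numFaces × Fin 3)
    (hx : ∀ t ∈ Icc (0 : ℝ) 1, Γ.edge a t ≠ x) :
    IntervalIntegrable (fun t => laplaceLineIntegrand u x (Γ.edge a t) (deriv (Γ.edge a) t))
      volume 0 1 := by
  refine ContinuousOn.intervalIntegrable ?_
  rw [uIcc_of_le zero_le_one]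
  simp only [laplaceLineIntegrand_eq]
  have h1 : ContinuousOn (fun t => ‖x - Γ.edge a t‖⁻¹) (Icc 0 1) :=
    ((continuous_const.sub (continuous_edge a)).norm.continuousOn).inv₀
      fun t ht => norm_ne_zero_iff.2 (sub_ne_zero.2 (hx t ht).symm)
  exact h1.smul ((continuousOn_comp_edge hu a).cross (continuous_deriv_edge' a).continuousOn)

lemma intervalIntegrable_kelvinLine (lam mu : ℝ) (hu : Γ.PiecewiseC1 u)
    (a : Fin Γ.numFaces × Fin 3) (hx : ∀ t ∈ Icc (0 : ℝ) 1, Γ.edge a t ≠ x) :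
    IntervalIntegrable (fun t => kelvinLineIntegrand lam mu u x (Γ.edge a t) (deriv (Γ.edge a) t))
      volume 0 1 := by
  refine ContinuousOn.intervalIntegrable ?_
  rw [uIcc_of_le zero_le_one]
  simp only [kelvinLineIntegrand_eq]
  have hz : ContinuousOn (fun t => x - Γ.edge a t) (Icc 0 1) :=
    (continuous_const.sub (continuous_edge a)).continuousOn
  have hne : ∀ t ∈ Icc (0 : ℝ) 1, ‖x - Γ.edge a t‖ ≠ 0 :=
    fun t ht => norm_ne_zero_iff.2 (sub_ne_zero.2 (hx t ht).symm)
  have hud := continuousOn_comp_edge hu a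
  have hd := (continuous_deriv_edge' a).continuousOn (s := Icc 0 1)
  have h1 : ContinuousOn (fun t => (lam + 3 * mu) * ‖x - Γ.edge a t‖⁻¹) (Icc 0 1) :=
    continuousOn_const.mul (hz.norm.inv₀ hne)
  have h3 : ContinuousOn (fun t => (lam + mu) * ((‖x - Γ.edge a t‖ ^ 3)⁻¹ *
      ⟪cross (x - Γ.edge a t) (u (Γ.edge a t)), deriv (Γ.edge a) t⟫)) (Icc 0 1) :=
    continuousOn_const.mul (((hz.norm.pow 3).inv₀ fun t ht => pow_ne_zero _ (hne t ht)).mul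
      ((hz.cross hud).inner hd))
  exact ((h1.smul (hud.cross hd)).add (h3.smul hz)).const_smul (kelvinConst lam mu)

lemma inner_intervalIntegral {f : ℝ → E3} (hf : IntervalIntegrable f volume 0 1) (b : E3) :
    ⟪∫ t in (0 : ℝ)..1, f t, b⟫ = ∫ t in (0 : ℝ)..1, ⟪f t, b⟫ := by
  rw [intervalIntegrable_iff_integrableOn_Ioc_of_le zero_le_one] at hf
  rw [intervalIntegral.integral_of_le zero_le_one, intervalIntegral.integral_of_le zero_le_one,
    inner_integral_eq hf]

lemma inner_faceLineIntegral_laplace (hu : Γ.PiecewiseC1 u)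
    (hx : ∀ i, ∀ t ∈ Icc (0 : ℝ) 1, Γ.edge (k, i) t ≠ x) (b : E3) :
    ⟪Γ.faceLineIntegral k (laplaceLineIntegrand u x), b⟫ = circulation (Γ.chart k)
      (fun p => ‖x - Γ.chart k p‖⁻¹ • cross b (u (Γ.chart k p))) := by
  rw [faceLineIntegral, sum_inner]
  refine Finset.sum_congr rfl fun i _ => ?_
  rw [inner_intervalIntegral (intervalIntegrable_laplaceLine hu (k, i) (hx i))]
  simp only [inner_laplaceLineIntegrand]
  rfl

lemma inner_faceLineIntegral_kelvin (lam mu : ℝ) (hu : Γ.PiecewiseC1 u)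
    (hx : ∀ i, ∀ t ∈ Icc (0 : ℝ) 1, Γ.edge (k, i) t ≠ x) (b : E3) :
    ⟪Γ.faceLineIntegral k (kelvinLineIntegrand lam mu u x), b⟫ = kelvinConst lam mu *
      ((lam + 3 * mu) * circulation (Γ.chart k)
          (fun p => ‖x - Γ.chart k p‖⁻¹ • cross b (u (Γ.chart k p)))
        + (lam + mu) * circulation (Γ.chart k)
          (fun p => ((‖x - Γ.chart k p‖ ^ 3)⁻¹ * ⟪x - Γ.chart k p, b⟫) •
            cross (x - Γ.chart k p) (u (Γ.chart k p)))) := by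
  have hz : ∀ i, ContinuousOn (fun t => x - Γ.chart k (refEdge i t)) (Icc 0 1) := fun i =>
    (continuous_const.sub (continuous_edge (k, i))).continuousOn
  have hne : ∀ i, ∀ t ∈ Icc (0 : ℝ) 1, ‖x - Γ.chart k (refEdge i t)‖ ≠ 0 :=
    fun i t ht => norm_ne_zero_iff.2 (sub_ne_zero.2 (hx i t ht).symm)
  have hud := fun i => continuousOn_comp_edge hu (k, i)
  rw [← circulation_add (Γ.contDiff_chart k)
    (fun i => ((hz i).norm.inv₀ (hne i)).smul (continuousOn_const.cross (hud i)))
    (fun i => ContinuousOn.smul (f := fun t => (‖x - Γ.chart k (refEdge i t)‖ ^ 3)⁻¹ *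
      ⟪x - Γ.chart k (refEdge i t), b⟫)
      ((((hz i).norm.pow 3).inv₀ fun t ht => pow_ne_zero _ (hne i t ht)).mul
      ((hz i).inner continuousOn_const)) ((hz i).cross (hud i)))]
  rw [faceLineIntegral, sum_inner, circulation, Finset.mul_sum]
  refine Finset.sum_congr rfl fun i _ => ?_
  rw [inner_intervalIntegral (intervalIntegrable_kelvinLine lam mu hu (k, i) (hx i)),
    ← intervalIntegral.integral_const_mul]
  simp only [inner_kelvinLineIntegrand, inner_add_left, real_inner_smul_left]
  rfl

/-- The part of the surface integral of the double layer potential over one triangle and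
`|x - y| > ε`. -/
noncomputable def truncatedFace (Γ : Surface) (lam mu : ℝ) (u : E3 → E3) (x : E3)
    (k : Fin Γ.numFaces) (ε : ℝ) : E3 :=
  ∫ p in {p | ε < ‖x - Γ.chart k p‖},
    matApply (tractionKelvin lam mu x (Γ.chart k p) (Γ.normal k p))ᵀ (u (Γ.chart k p))
      ∂(Γ.faceArea k)

/-- The contribution of one triangle to the regularized form. -/
noncomputable def regularizedFace (Γ : Surface) (lam mu : ℝ) (u : E3 → E3) (x : E3)
    (k : Fin Γ.numFaces) : E3 :=
  (2 * mu) • ∫ p, Γ.elasticSLIntegrand lam mu u x k p ∂(Γ.faceArea k)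
    - (1 / (4 * Real.pi)) • ∫ p, Γ.laplaceSLIntegrand u x k p ∂(Γ.faceArea k)
    + (1 / (4 * Real.pi)) • ∫ p, Γ.laplaceDLIntegrand u x k p ∂(Γ.faceArea k)
    - (1 / (4 * Real.pi)) • Γ.faceLineIntegral k (laplaceLineIntegrand u x)
    + (2 * mu) • Γ.faceLineIntegral k (kelvinLineIntegrand lam mu u x)

/-- On a single triangle, the principal value exists off the edges and is given by the regularized
form, with a line integral over all three edges. -/
theorem tendsto_truncatedFace {lam mu : ℝ} (hmu : mu ≠ 0) (hlam : lam + 2 * mu ≠ 0)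
    (hu : Γ.PiecewiseC1 u) (k : Fin Γ.numFaces)
    (hx : ∀ i, ∀ t ∈ Icc (0 : ℝ) 1, Γ.edge (k, i) t ≠ x) :
    Tendsto (Γ.truncatedFace lam mu u x k) (𝓝[>] 0) (𝓝 (Γ.regularizedFace lam mu u x k)) := by
  refine tendsto_of_tendsto_inner fun b => ?_
  have hφ := Γ.contDiff_chart k
  have hφc := Γ.continuous_chart k
  have hw := hu.contDiffOn k
  have hnull := ae_image_ne (Γ.injOn_chart k) x
  obtain ⟨K₁, hK₁⟩ := exists_integral_inv_le hφ (Γ.injOn_chart k) (Γ.immersion_chart k)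
  have hint := (hK₁ x).1
  obtain ⟨C, hC⟩ := exists_inner_nvec_le hφ (Γ.injOn_chart k) (Γ.immersion_chart k) x
  have hkp := fun c => integrableOn_kernel_parts (x := x) c hφ hw.continuousOn hint hnull hC
  have hset : ∀ ε : ℝ, MeasurableSet {p | ε < ‖x - Γ.chart k p‖} := fun ε =>
    (isOpen_lt continuous_const (continuous_const.sub hφc).norm).measurableSet
  set w : ℝ × ℝ → E3 := fun p => u (Γ.chart k p) with hwdef
  -- the truncated integrand, paired with a vector
  have hker : ∀ ε : ℝ, 0 < ε → ∀ c : E3, ∀ p ∈ refTriangle,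
      ‖Γ.normalVec k p‖ • ⟪{p | ε < ‖x - Γ.chart k p‖}.indicator (fun p => matApply
        (tractionKelvin lam mu x (Γ.chart k p) (Γ.normal k p))ᵀ (u (Γ.chart k p))) p, c⟫
      = 2 * mu * kelvinConst lam mu *
        (mu * {p | ε < ‖x - Γ.chart k p‖}.indicator (tangentialPart (Γ.chart k) w x c) p
        + mu * {p | ε < ‖x - Γ.chart k p‖}.indicator (normalPart (Γ.chart k) w x c) p
        + (lam + mu) * {p | ε < ‖x - Γ.chart k p‖}.indicator (dyadPart (Γ.chart k) w x c) p) := by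
    intro ε hε c p hp
    by_cases hpε : ε < ‖x - Γ.chart k p‖
    · have hne : Γ.chart k p ≠ x := by
        intro h
        rw [h, sub_self, norm_zero] at hpε
        exact absurd hpε hε.not_gt
      simp only [indicator_of_mem (show p ∈ {p | ε < ‖x - Γ.chart k p‖} from hpε)]
      rw [inner_tractionKelvin lam mu hne]
      simp only [tangentialPart, normalPart, dyadPart, ← norm_mul_inner_normal hp, smul_eq_mul,
        hwdef]
      ring
    · simp only [indicator_of_notMem (show p ∉ {p | ε < ‖x - Γ.chart k p‖} from hpε),
        inner_zero_left, mul_zero, add_zero, smul_zero]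
  have hsum : ∀ ε : ℝ, 0 < ε → ∀ c : E3, MeasureTheory.IntegrableOn (fun p =>
        2 * mu * kelvinConst lam mu *
        (mu * {p | ε < ‖x - Γ.chart k p‖}.indicator (tangentialPart (Γ.chart k) w x c) p
        + mu * {p | ε < ‖x - Γ.chart k p‖}.indicator (normalPart (Γ.chart k) w x c) p
        + (lam + mu) * {p | ε < ‖x - Γ.chart k p‖}.indicator (dyadPart (Γ.chart k) w x c) p))
        refTriangle := fun ε hε c =>
    (((((hkp c).1 ε hε).const_mul mu).add (((hkp c).2.1.indicator (hset ε)).const_mul mu)).add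
      (((hkp c).2.2.indicator (hset ε)).const_mul (lam + mu))).const_mul _
  have hvec : ∀ ε : ℝ, 0 < ε → Integrable ({p | ε < ‖x - Γ.chart k p‖}.indicator (fun p => matApply
        (tractionKelvin lam mu x (Γ.chart k p) (Γ.normal k p))ᵀ (u (Γ.chart k p))))
        (Γ.faceArea k) := by
    intro ε hε
    refine integrable_of_integrable_inner fun c => ?_
    rw [integrable_faceArea_iff]
    exact (hsum ε hε c).congr_fun (fun p hp => (hker ε hε c p hp).symm) measurableSet_refTriangle
  have hsplit : ∀ ε : ℝ, 0 < ε → ⟪Γ.truncatedFace lam mu u x k ε, b⟫ = 2 * mu * kelvinConst lam mu *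
      (mu * (∫ p in refTriangle, {p | ε < ‖x - Γ.chart k p‖}.indicator
          (tangentialPart (Γ.chart k) w x b) p)
        + mu * (∫ p in refTriangle, {p | ε < ‖x - Γ.chart k p‖}.indicator
          (normalPart (Γ.chart k) w x b) p)
        + (lam + mu) * ∫ p in refTriangle, {p | ε < ‖x - Γ.chart k p‖}.indicator
          (dyadPart (Γ.chart k) w x b) p) := by
    intro ε hε
    rw [truncatedFace, ← integral_indicator (hset ε), inner_integral_eq (hvec ε hε),
      integral_faceArea, setIntegral_congr_fun measurableSet_refTriangle
      (fun p hp => hker ε hε b p hp), integral_const_mul, integral_add, integral_add,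
      integral_const_mul, integral_const_mul, integral_const_mul]
    · exact ((hkp b).1 ε hε).const_mul mu
    · exact ((hkp b).2.1.indicator (hset ε)).const_mul mu
    · exact (((hkp b).1 ε hε).const_mul mu).add (((hkp b).2.1.indicator (hset ε)).const_mul mu)
    · exact ((hkp b).2.2.indicator (hset ε)).const_mul (lam + mu)
  -- the limits of the three parts
  have hedge : ∀ i, ∀ t ∈ Icc (0 : ℝ) 1, Γ.chart k (refEdge i t) ≠ x := hx
  have L1 := tendsto_integral_truncated hφ hw b hint hnull hedge
  have L2 := tendsto_integral_indicator hφc hnull (hkp b).2.1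
  have L3 := tendsto_integral_indicator hφc hnull (hkp b).2.2
  have L := (((L1.const_mul mu).add (L2.const_mul mu)).add (L3.const_mul (lam + mu))).const_mul
    (2 * mu * kelvinConst lam mu)
  refine (L.congr' ?_).trans_eq ?_
  · filter_upwards [self_mem_nhdsWithin] with ε hε using (hsplit ε hε).symm
  congr 1
  have hB := integral_dyad_by_parts hφ hw (fun p hp => Γ.normalVec_ne_zero k hp) b hint hnull
    hedge hC
  have hBsub : ∫ p in refTriangle, ⟪nvec (Γ.chart k) p, x - Γ.chart k p⟫ *
      (3 * (‖x - Γ.chart k p‖ ^ 5)⁻¹ * (⟪x - Γ.chart k p, b⟫ * ⟪x - Γ.chart k p, w p⟫)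
        - (‖x - Γ.chart k p‖ ^ 3)⁻¹ * ⟪w p, b⟫)
      = (∫ p in refTriangle, dyadPart (Γ.chart k) w x b p)
        - ∫ p in refTriangle, normalPart (Γ.chart k) w x b p := by
    rw [← integral_sub (hkp b).2.2 (hkp b).2.1]
    refine integral_congr_ae (Eventually.of_forall fun p => ?_)
    simp only [dyadPart, normalPart]
    ring
  -- the surface integrals of the regularized form
  obtain ⟨_, hE⟩ := exists_elasticSL_bound lam mu hu k
  obtain ⟨_, hL⟩ := exists_laplaceSL_bound hu k
  obtain ⟨_, hDL⟩ := exists_laplaceDL_bound hu k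
  set m := gunterDensity (Γ.chart k) (fderivWithin ℝ w refTriangle) with hm
  have eL : ⟪∫ p, Γ.laplaceSLIntegrand u x k p ∂(Γ.faceArea k), b⟫
      = ∫ p in refTriangle, ‖x - Γ.chart k p‖⁻¹ * ⟪m p, b⟫ := by
    rw [inner_integral_eq (hL x).1, integral_faceArea]
    refine setIntegral_congr_fun measurableSet_refTriangle fun p hp => ?_
    simp only [laplaceSLIntegrand, real_inner_smul_left, smul_eq_mul, one_div]
    rw [mul_left_comm, norm_mul_inner_gunter hu hp]
  have eD : ⟪∫ p, Γ.laplaceDLIntegrand u x k p ∂(Γ.faceArea k), b⟫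
      = ∫ p in refTriangle, normalPart (Γ.chart k) w x b p := by
    rw [inner_integral_eq (hDL x).1, integral_faceArea]
    refine setIntegral_congr_fun measurableSet_refTriangle fun p hp => ?_
    simp only [laplaceDLIntegrand, fderiv_inv_norm_sub, real_inner_smul_left, smul_eq_mul,
      normalPart, ← norm_mul_inner_normal hp, hwdef]
    ring
  have eE : ⟪∫ p, Γ.elasticSLIntegrand lam mu u x k p ∂(Γ.faceArea k), b⟫
      = kelvinConst lam mu * ((lam + 3 * mu) *
        (∫ p in refTriangle, ‖x - Γ.chart k p‖⁻¹ * ⟪m p, b⟫)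
        + (lam + mu) * ∫ p in refTriangle, (‖x - Γ.chart k p‖ ^ 3)⁻¹ * ⟪x - Γ.chart k p, b⟫ *
          ⟪m p, x - Γ.chart k p⟫) := by
    have hsl : MeasureTheory.IntegrableOn
        (fun p => ‖x - Γ.chart k p‖⁻¹ * ⟪m p, b⟫) refTriangle := by
      have := (Γ.integrable_faceArea_iff k _).1 ((hL x).1.inner_const (𝕜 := ℝ) b)
      refine this.congr_fun (fun p hp => ?_) measurableSet_refTriangle
      simp only [laplaceSLIntegrand, real_inner_smul_left, smul_eq_mul, one_div]
      rw [mul_left_comm, norm_mul_inner_gunter hu hp]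
    have hdy : MeasureTheory.IntegrableOn (fun p => (‖x - Γ.chart k p‖ ^ 3)⁻¹ *
        ⟪x - Γ.chart k p, b⟫ * ⟪m p, x - Γ.chart k p⟫) refTriangle := by
      have hmc : ContinuousOn m refTriangle := continuousOn_gunterDensity hφ
        (hw.continuousOn_fderivWithin uniqueDiffOn_refTriangle (by norm_num))
      obtain ⟨C', hC'0, hC'⟩ := exists_norm_le_refTriangle hmc
      have hz : Continuous fun p => x - Γ.chart k p := continuous_const.sub hφc
      have hz' := hz.aestronglyMeasurable (μ := volume.restrict refTriangle)
      have h1 : AEStronglyMeasurable (fun p => (‖x - Γ.chart k p‖ ^ 3)⁻¹ *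
          ⟪x - Γ.chart k p, b⟫) (volume.restrict refTriangle) :=
        (((hz.norm.pow 3).measurable.inv).mul
          (hz.inner continuous_const).measurable).aestronglyMeasurable
      have h2 : AEStronglyMeasurable (fun p => ⟪m p, x - Γ.chart k p⟫)
          (volume.restrict refTriangle) :=
        (hmc.aestronglyMeasurable measurableSet_refTriangle).inner hz'
      refine (hint.const_mul (‖b‖ * C')).mono' (h1.mul h2) ?_
      filter_upwards [ae_restrict_mem measurableSet_refTriangle] with p hp
      rw [Real.norm_eq_abs, abs_mul, abs_mul, abs_of_nonneg (by positivity :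
        0 ≤ (‖x - Γ.chart k p‖ ^ 3)⁻¹)]
      rcases (norm_nonneg (x - Γ.chart k p)).eq_or_lt with h | h
      · rw [← h]; simp
      · calc _ ≤ (‖x - Γ.chart k p‖ ^ 3)⁻¹ * (‖x - Γ.chart k p‖ * ‖b‖) *
              (‖m p‖ * ‖x - Γ.chart k p‖) := by
              gcongr <;> exact abs_real_inner_le_norm _ _
          _ = ‖b‖ * ‖m p‖ * ‖x - Γ.chart k p‖⁻¹ := by field_simp
          _ ≤ _ := by gcongr; exact hC' p hp
    rw [inner_integral_eq (hE x).1, integral_faceArea, ← integral_const_mul (lam + 3 * mu),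
      ← integral_const_mul (lam + mu),
      ← integral_add (hsl.const_mul _) (hdy.const_mul _), ← integral_const_mul]
    refine setIntegral_congr_fun measurableSet_refTriangle fun p hp => ?_
    have hg : ∀ c, ‖Γ.normalVec k p‖ * ⟪Γ.gunter u k p, c⟫ = ⟪m p, c⟫ :=
      norm_mul_inner_gunter hu hp
    simp only [elasticSLIntegrand, inner_kelvin, smul_eq_mul, ← hg]
    ring
  rw [regularizedFace]
  simp only [inner_add_left, inner_sub_left, real_inner_smul_left]
  rw [inner_faceLineIntegral_laplace hu hx, inner_faceLineIntegral_kelvin lam mu hu hx, eL, eD, eE]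
  rw [hBsub] at hB
  -- the constants match because `μ + (λ + μ) = λ + 2μ` and `(λ + 3μ) - (λ + 2μ) = μ`
  rw [← two_mul_kelvinConst hmu hlam]
  linear_combination (2 * mu * kelvinConst lam mu * (lam + mu)) * hB

end Surface

/-! ### The edges of the surface -/

lemma volume_refEdge (i : Fin 3) : volume (refEdge i '' Icc 0 1) = 0 := by
  have h0 : volume ({0} : Set ℝ) = 0 := Real.volume_singleton
  fin_cases i
  · refine measure_mono_null (t := univ ×ˢ {0}) ?_ ?_
    · rintro _ ⟨t, -, rfl⟩
      simp [refEdge_zero]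
    · rw [Measure.volume_eq_prod, Measure.prod_prod, h0, mul_zero]
  · refine measure_mono_null (t := {p : ℝ × ℝ | p.1 + p.2 = 1}) ?_ ?_
    · rintro _ ⟨t, -, rfl⟩
      simp [refEdge_one]
    · have hm : MeasurableSet {p : ℝ × ℝ | p.1 + p.2 = 1} :=
        (isClosed_eq (by fun_prop) continuous_const).measurableSet
      rw [Measure.volume_eq_prod, Measure.measure_prod_null hm]
      refine Eventually.of_forall fun s => ?_
      have : Prod.mk s ⁻¹' {p : ℝ × ℝ | p.1 + p.2 = 1} = {1 - s} := by
        ext t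
        simp only [mem_preimage, mem_ofPred_eq, mem_singleton_iff]
        constructor <;> intro h <;> linarith
      simp [this]
  · refine measure_mono_null (t := {0} ×ˢ univ) ?_ ?_
    · rintro _ ⟨t, -, rfl⟩
      simp [refEdge_two]
    · rw [Measure.volume_eq_prod, Measure.prod_prod, h0, zero_mul]

lemma refVertex_mem_refEdge (i : Fin 3) : refVertex i ∈ refEdge i '' Icc 0 1 :=
  ⟨0, by simp, by simp [refEdge_eq]⟩

/-- The midpoint of an edge lies on no other edge. -/
lemma eq_of_midpoint_mem_refEdge {i j : Fin 3} {t : ℝ} (h : refEdge i t = refEdge j (1 / 2)) :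
    i = j := by
  fin_cases i <;> fin_cases j <;>
    simp [refEdge_zero, refEdge_one, refEdge_two] at h ⊢ <;> linarith

lemma midpoint_refEdge_ne_refVertex (i j : Fin 3) : refEdge i (1 / 2) ≠ refVertex j := by
  fin_cases i <;> fin_cases j <;>
    (simp [refEdge_zero, refEdge_one, refEdge_two, refVertex]; try norm_num)

lemma refEdge_zero_ne_one (i : Fin 3) : refEdge i 0 ≠ refEdge i 1 := by
  fin_cases i <;> simp [refEdge_zero, refEdge_one, refEdge_two]

lemma OppositeEdges.symm {f g : ℝ × ℝ → E3} {i j : Fin 3} (h : OppositeEdges f g i j) :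
    OppositeEdges g f j i := by
  intro t ht
  rw [h (1 - t) ⟨by linarith [ht.2], by linarith [ht.1]⟩, sub_sub_cancel]

namespace Surface

variable {Γ : Surface}

lemma one_half_mem_Icc : (1 / 2 : ℝ) ∈ Icc (0 : ℝ) 1 := by constructor <;> norm_num

/-- At most one triangle is attached to another one along a given edge. A third triangle would run
through the edge in the same direction as the second one. -/
lemma oppositeEdges_unique {k l l' : Fin Γ.numFaces} {i j j' : Fin 3}
    (h : OppositeEdges (Γ.chart k) (Γ.chart l) i j)
    (h' : OppositeEdges (Γ.chart k) (Γ.chart l') i j') : (l, j) = (l', j') := by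
  have key : ∀ t ∈ Icc (0 : ℝ) 1, Γ.chart l (refEdge j t) = Γ.chart l' (refEdge j' t) :=
    fun t ht => by
      rw [h.symm t ht, h'.symm t ht]
  rcases eq_or_ne l l' with rfl | hne
  · rw [eq_of_midpoint_mem_refEdge (Γ.injOn_chart l (refEdge_mem j one_half_mem_Icc)
      (refEdge_mem j' one_half_mem_Icc) (key _ one_half_mem_Icc))]
  · exfalso
    rcases Γ.conforming l l' hne _ (refEdge_mem j one_half_mem_Icc) _
      (refEdge_mem j' one_half_mem_Icc) (key _ one_half_mem_Icc) with ⟨⟨m, hm⟩, -⟩ |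
      ⟨i₁, j₁, ho, t, -, ht⟩
    · exact midpoint_refEdge_ne_refVertex j m hm.symm
    · obtain rfl := eq_of_midpoint_mem_refEdge ht
      have hj : ∀ t ∈ Icc (0 : ℝ) 1, refEdge j₁ (1 - t) = refEdge j' t := fun t ht =>
        Γ.injOn_chart l' (refEdge_mem j₁ ⟨by linarith [ht.2], by linarith [ht.1]⟩)
          (refEdge_mem j' ht) ((ho t ht).symm.trans (key t ht))
      obtain rfl := eq_of_midpoint_mem_refEdge (hj _ one_half_mem_Icc)
      refine refEdge_zero_ne_one j₁ ?_
      rw [← hj 0 (by simp), sub_zero]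

/-- The two line integrals over a common edge of two triangles cancel. -/
lemma integral_edge_add_integral_edge {F : E3 → E3 → E3} (hF : ∀ y d, F y (-d) = -F y d)
    {a b : Fin Γ.numFaces × Fin 3} (h : OppositeEdges (Γ.chart a.1) (Γ.chart b.1) a.2 b.2) :
    (∫ t in (0 : ℝ)..1, F (Γ.edge a t) (deriv (Γ.edge a) t))
      + ∫ t in (0 : ℝ)..1, F (Γ.edge b t) (deriv (Γ.edge b) t) = 0 := by
  have h1 : ∫ t in (0 : ℝ)..1, F (Γ.edge a t) (deriv (Γ.edge a) t)
      = ∫ t in (0 : ℝ)..1, -F (Γ.edge b (1 - t)) (deriv (Γ.edge b) (1 - t)) := by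
    rw [intervalIntegral.integral_of_le zero_le_one, intervalIntegral.integral_of_le zero_le_one,
      integral_Ioc_eq_integral_Ioo, integral_Ioc_eq_integral_Ioo]
    refine setIntegral_congr_fun measurableSet_Ioo fun t ht => ?_
    have he : Γ.edge a =ᶠ[𝓝 t] fun s => Γ.edge b (1 - s) := by
      filter_upwards [Icc_mem_nhds ht.1 ht.2] with s hs using h s hs
    rw [he.deriv_eq, deriv_comp_const_sub, hF, he.eq_of_nhds]
  rw [h1, intervalIntegral.integral_neg, intervalIntegral.integral_comp_sub_left
    (fun t => F (Γ.edge b t) (deriv (Γ.edge b) t))]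
  simp

/-- Summed over all triangles, the line integrals over the edges reduce to the integral over the
boundary curve. -/
lemma sum_faceLineIntegral {F : E3 → E3 → E3} (hF : ∀ y d, F y (-d) = -F y d) :
    ∑ k, Γ.faceLineIntegral k F = Γ.lineIntegral F := by
  classical
  simp only [faceLineIntegral]
  rw [← Fintype.sum_prod_type' (f := fun k i => ∫ t in (0 : ℝ)..1,
      F (Γ.edge (k, i) t) (deriv (Γ.edge (k, i)) t)),
    ← Finset.sum_filter_not_add_sum_filter _ fun a => Γ.IsInteriorEdge a]
  have hcancel : ∑ a ∈ Finset.univ.filter fun a => Γ.IsInteriorEdge a,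
      ∫ t in (0 : ℝ)..1, F (Γ.edge a t) (deriv (Γ.edge a) t) = 0 := by
    have hex : ∀ a ∈ Finset.univ.filter fun a => Γ.IsInteriorEdge a, ∃ b : Fin Γ.numFaces × Fin 3,
        b.1 ≠ a.1 ∧ OppositeEdges (Γ.chart a.1) (Γ.chart b.1) a.2 b.2 := by
      intro a ha
      obtain ⟨l, j, hl, ho⟩ := (Finset.mem_filter.1 ha).2
      exact ⟨(l, j), hl, ho⟩
    choose g hg hgo using hex
    refine Finset.sum_involution g (fun a ha => integral_edge_add_integral_edge hF (hgo a ha))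
      (fun a ha _ h => hg a ha (by rw [h]))
      (fun a ha => Finset.mem_filter.2 ⟨Finset.mem_univ _, a.1, a.2, (hg a ha).symm,
        (hgo a ha).symm⟩) fun a ha => ?_
    exact oppositeEdges_unique (hgo _ _) (hgo a ha).symm
  rw [hcancel, add_zero, lineIntegral, boundaryEdges]

lemma isCompact_carrier : IsCompact Γ.carrier :=
  isCompact_iUnion fun k => isCompact_refTriangle.image (Γ.continuous_chart k)

/-- Almost all points of the surface lie on no edge of any triangle. -/
lemma ae_area_ne_edge : ∀ᵐ x ∂Γ.area, x ∈ Γ.carrier ∧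
    ∀ a, ∀ t ∈ Icc (0 : ℝ) 1, Γ.edge a t ≠ x := by
  have hset : MeasurableSet {x | ∀ a, ∀ t ∈ Icc (0 : ℝ) 1, Γ.edge a t ≠ x} := by
    have : {x | ∀ a, ∀ t ∈ Icc (0 : ℝ) 1, Γ.edge a t ≠ x} = (⋃ a, Γ.edge a '' Icc 0 1)ᶜ := by
      ext x; simp
    rw [this]
    exact (isCompact_iUnion fun a => isCompact_Icc.image
      (continuous_edge a)).isClosed.measurableSet.compl
  have hset' : MeasurableSet {x | x ∈ Γ.carrier ∧ ∀ a, ∀ t ∈ Icc (0 : ℝ) 1, Γ.edge a t ≠ x} :=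
    Γ.isCompact_carrier.isClosed.measurableSet.inter hset
  rw [area, ae_iff, Measure.finsetSum_apply]
  refine Finset.sum_eq_zero fun k _ => ?_
  rw [← ae_iff, ae_map_iff (Γ.continuous_chart k).aemeasurable hset']
  -- almost all parameters are off the edges of the reference triangle
  have hnull : ∀ᵐ p ∂Γ.faceArea k, ∀ i, p ∉ refEdge i '' Icc 0 1 := by
    refine (Γ.faceArea_absolutelyContinuous k).ae_le (ae_restrict_of_ae ?_)
    exact ae_all_iff.2 fun i => measure_eq_zero_iff_ae_notMem.1 (volume_refEdge i)
  filter_upwards [hnull, Γ.ae_mem_faceArea k] with p hp hpT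
  refine ⟨mem_iUnion.2 ⟨k, mem_image_of_mem _ hpT⟩, fun ⟨l, i⟩ t ht h => ?_⟩
  change Γ.chart l (refEdge i t) = Γ.chart k p at h
  rcases eq_or_ne k l with rfl | hne
  · exact hp i ⟨t, ht, Γ.injOn_chart k (refEdge_mem i ht) hpT h⟩
  · rcases Γ.conforming k l hne p hpT _ (refEdge_mem i ht) h.symm with ⟨⟨m, hm⟩, -⟩ |
      ⟨i₁, -, -, hi⟩
    · exact hp m (hm ▸ refVertex_mem_refEdge m)
    · exact hp i₁ hi

/-! ### The regularized form of the potential -/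

/-- The double layer potential exists, and is given by the regularized form, at all points of space
off the edges. -/
theorem hasDoubleLayer {u : E3 → E3} {x : E3} {lam mu : ℝ} (hmu : mu ≠ 0)
    (hlam : lam + 2 * mu ≠ 0) (hu : Γ.PiecewiseC1 u)
    (hx : ∀ a, ∀ t ∈ Icc (0 : ℝ) 1, Γ.edge a t ≠ x) :
    Γ.HasDoubleLayer lam mu u x ((2 * mu) • Γ.integral (Γ.elasticSLIntegrand lam mu u x)
      - (1 / (4 * Real.pi)) • Γ.integral (Γ.laplaceSLIntegrand u x)
      + (1 / (4 * Real.pi)) • Γ.integral (Γ.laplaceDLIntegrand u x)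
      - (1 / (4 * Real.pi)) • Γ.lineIntegral (laplaceLineIntegrand u x)
      + (2 * mu) • Γ.lineIntegral (kelvinLineIntegrand lam mu u x)) := by
  have h := tendsto_finsetSum Finset.univ fun k _ =>
    tendsto_truncatedFace hmu hlam hu k fun i => hx (k, i)
  refine h.trans_eq ?_
  congr 1
  rw [← sum_faceLineIntegral (F := laplaceLineIntegrand u x), ← sum_faceLineIntegral
    (F := kelvinLineIntegrand lam mu u x)]
  · simp only [regularizedFace, integral, Finset.sum_add_distrib, Finset.sum_sub_distrib,
      Finset.smul_sum]
  · intro y d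
    simp only [kelvinLineIntegrand_eq, ← crossL_apply, map_neg, inner_neg_right, mul_neg, smul_neg,
      neg_smul, ← neg_add]
  · intro y d
    simp only [laplaceLineIntegrand_eq, ← crossL_apply, map_neg, smul_neg]

end Surface

/-! ### Square integrability of the line integrals -/

lemma integrable_inner_of_memLp_two {α : Type*} [MeasurableSpace α] {μ : Measure α} {f g : α → E3}
    (hf : MemLp f 2 μ) (hg : MemLp g 2 μ) : Integrable (fun a => ⟪f a, g a⟫) μ := by
  refine (hf.norm.integrable_mul hg.norm).mono' (hf.1.inner hg.1) (Eventually.of_forall fun a => ?_)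
  exact abs_real_inner_le_norm _ _

lemma lintegral_inv_sqrt_abs_lt_top :
    ∫⁻ s, (Icc (-1 : ℝ) 1).indicator (fun s => ENNReal.ofReal (√|s|)⁻¹) s < ⊤ := by
  have h1 : IntegrableOn (fun y : ℝ => y ^ (-(1 / 2) : ℝ)) (Ioc 0 1) := by
    have := intervalIntegral.intervalIntegrable_rpow' (a := 0) (b := 1)
      (r := (-(1 / 2) : ℝ)) (by norm_num)
    rwa [intervalIntegrable_iff_integrableOn_Ioc_of_le zero_le_one] at this
  have h2 : Integrable (fun s : ℝ => (Iic (1 : ℝ)).indicator (fun y => (√y)⁻¹) ‖s‖) := by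
    rw [integrable_fun_norm_addHaar volume (f := (Iic (1 : ℝ)).indicator fun y => (√y)⁻¹)]
    refine ((h1.integrable_indicator measurableSet_Ioc).integrableOn (s := Ioi 0)).congr_fun
      (fun y hy => ?_) measurableSet_Ioi
    have hy0 : 0 < y := hy
    by_cases hy1 : y ≤ 1
    · rw [indicator_of_mem (show y ∈ Ioc (0 : ℝ) 1 from ⟨hy0, hy1⟩)]
      simp only [Module.finrank_self]
      rw [indicator_of_mem (by exact hy1), Real.rpow_neg hy0.le, ← Real.sqrt_eq_rpow]
      simp
    · rw [indicator_of_notMem (fun h => hy1 h.2), indicator_of_notMem (by exact hy1), smul_zero]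
  refine lt_of_eq_of_lt (lintegral_congr fun s => ?_) h2.lintegral_lt_top
  by_cases hs : |s| ≤ 1
  · rw [indicator_of_mem (by exact abs_le.1 hs), indicator_of_mem (by exact hs), Real.norm_eq_abs]
  · rw [indicator_of_notMem (s := Icc (-1) 1) (fun h => hs (abs_le.2 h)),
      indicator_of_notMem (by exact hs), ENNReal.ofReal_zero]

/-- The kernel `|t - t'|^{-1/2}` is integrable over the unit square. -/
lemma lintegral_inv_sqrt_sub_lt_top (c : ℝ) (hc : 0 < c) :
    ∫⁻ q, ENNReal.ofReal (√(c * |q.1 - q.2|))⁻¹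
      ∂((volume.restrict (Ioc (0 : ℝ) 1)).prod (volume.restrict (Ioc (0 : ℝ) 1))) < ⊤ := by
  set S := ∫⁻ s, (Icc (-1 : ℝ) 1).indicator (fun s => ENNReal.ofReal (√|s|)⁻¹) s with hS
  have hSt : S < ⊤ := lintegral_inv_sqrt_abs_lt_top
  rw [lintegral_prod _ (by fun_prop)]
  have hle : ∀ t ∈ Ioc (0 : ℝ) 1, ∫⁻ s in Ioc (0 : ℝ) 1, ENNReal.ofReal (√(c * |t - s|))⁻¹
      ≤ ENNReal.ofReal (√c)⁻¹ * S := by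
    intro t ht
    have : ∀ s, ENNReal.ofReal (√(c * |t - s|))⁻¹
        = ENNReal.ofReal (√c)⁻¹ * ENNReal.ofReal (√|t - s|)⁻¹ := fun s => by
      rw [Real.sqrt_mul hc.le, mul_inv, ENNReal.ofReal_mul (by positivity)]
    simp only [this]
    rw [lintegral_const_mul _ (by fun_prop)]
    gcongr
    rw [← lintegral_indicator measurableSet_Ioc, hS]
    refine le_trans (lintegral_mono fun s => ?_) (lintegral_sub_left_eq_self _ t).le
    by_cases hs : s ∈ Ioc (0 : ℝ) 1
    · rw [indicator_of_mem hs, indicator_of_mem (s := Icc (-1) 1)]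
      exact ⟨by linarith [ht.1, hs.2], by linarith [ht.2, hs.1]⟩
    · rw [indicator_of_notMem hs]
      exact zero_le
  refine (setLIntegral_mono measurable_const hle).trans_lt ?_
  simp only [lintegral_const, Measure.restrict_apply_univ, Real.volume_Ioc, sub_zero,
    ENNReal.ofReal_one, mul_one]
  exact ENNReal.mul_lt_top ENNReal.ofReal_lt_top hSt

/-- For points `e`, `e'` with `|e - e'| ≥ d`, the product of the two Newtonian kernels is dominated
by less singular ones: `|x - e|⁻¹ |x - e'|⁻¹ ≤ d^{-1/2} (|x - e|^{-3/2} + |x - e'|^{-3/2})`. -/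
lemma inv_mul_inv_le {r r' d : ℝ} (hr : 0 ≤ r) (hr' : 0 ≤ r') (hd : 0 < d) (h : d ≤ r + r') :
    r⁻¹ * r'⁻¹ ≤ (√d)⁻¹ * (weakKernel r + weakKernel r') := by
  have hR : 0 ≤ (√d)⁻¹ * (weakKernel r + weakKernel r') :=
    mul_nonneg (by positivity) (add_nonneg (weakKernel_nonneg _) (weakKernel_nonneg _))
  rcases hr.eq_or_lt with rfl | hr
  · simpa using hR
  rcases hr'.eq_or_lt with rfl | hr'
  · simpa using hR
  have hs := Real.sqrt_pos.2 hr
  have hs' := Real.sqrt_pos.2 hr'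
  have hsd := Real.sqrt_pos.2 hd
  have h1 : √d ≤ √r + √r' := by
    rw [Real.sqrt_le_left (by positivity)]
    nlinarith [Real.sq_sqrt hr.le, Real.sq_sqrt hr'.le, mul_pos hs hs']
  have e : r = √r ^ 2 := (Real.sq_sqrt hr.le).symm
  have e' : r' = √r' ^ 2 := (Real.sq_sqrt hr'.le).symm
  rw [← div_eq_inv_mul (_ + _), le_div_iff₀ hsd]
  unfold weakKernel
  set a := (√r)⁻¹ with ha
  set b := (√r')⁻¹ with hb
  have ha0 : 0 < a := inv_pos.2 hs
  have hb0 : 0 < b := inv_pos.2 hs'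
  calc r⁻¹ * r'⁻¹ * √d ≤ r⁻¹ * r'⁻¹ * (√r + √r') := by gcongr
    _ = a * b ^ 2 + a ^ 2 * b := by
        rw [ha, hb]
        nth_rewrite 1 [e]
        nth_rewrite 1 [e']
        field_simp
    -- `a b² + a² b ≤ a³ + b³`
    _ ≤ a ^ 3 + b ^ 3 := by nlinarith [mul_nonneg (add_pos ha0 hb0).le (sq_nonneg (a - b))]
    _ = _ := by rw [ha, hb, inv_pow, inv_pow]

/-- An operator bound of Schur type: if the products of two values of a kernel `k` are dominated by
`D q (W x q.1 + W x q.2)`, where `W` has uniformly bounded integrals, then the square integral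
of the potential with kernel `k` is controlled by the integral of `D`. -/
lemma lintegral_sq_le_of_mul_le {α β : Type*} [MeasurableSpace α] [MeasurableSpace β]
    {μ : Measure α} {ν : Measure β} [SFinite μ] [SFinite ν] {k W : α → β → ENNReal}
    {D : β × β → ENNReal} {K : ENNReal} (hk : ∀ x, Measurable (k x))
    (hW : Measurable (Function.uncurry W)) (hD : Measurable D) (hK : ∀ t, ∫⁻ x, W x t ∂μ ≤ K)
    (h : ∀ x, ∀ᵐ q ∂ν.prod ν, k x q.1 * k x q.2 ≤ D q * (W x q.1 + W x q.2)) :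
    ∫⁻ x, (∫⁻ t, k x t ∂ν) ^ 2 ∂μ ≤ (∫⁻ q, D q ∂ν.prod ν) * (K + K) := by
  have hW1 : Measurable fun z : α × β × β => W z.1 z.2.1 :=
    hW.comp (measurable_fst.prodMk (measurable_fst.comp measurable_snd))
  have hW2 : Measurable fun z : α × β × β => W z.1 z.2.2 :=
    hW.comp (measurable_fst.prodMk (measurable_snd.comp measurable_snd))
  calc _ ≤ ∫⁻ x, ∫⁻ q, D q * (W x q.1 + W x q.2) ∂ν.prod ν ∂μ := by
        refine lintegral_mono fun x => ?_
        rw [sq, ← lintegral_prod_mul (hk x).aemeasurable (hk x).aemeasurable]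
        exact lintegral_mono_ae (h x)
    _ = ∫⁻ q, ∫⁻ x, D q * (W x q.1 + W x q.2) ∂μ ∂ν.prod ν := by
        refine lintegral_lintegral_swap (Measurable.aemeasurable ?_)
        exact (hD.comp measurable_snd).mul (hW1.add hW2)
    _ ≤ ∫⁻ q, D q * (K + K) ∂ν.prod ν := by
        refine lintegral_mono fun q => ?_
        have m1 : Measurable fun x => W x q.1 := hW.of_uncurry_right
        have m2 : Measurable fun x => W x q.2 := hW.of_uncurry_right
        rw [lintegral_const_mul (D q) (f := fun x => W x q.1 + W x q.2) (m1.add m2),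
          lintegral_add_left m1]
        gcongr
        · exact hK _
        · exact hK _
    _ = (∫⁻ q, D q ∂ν.prod ν) * (K + K) := lintegral_mul_const _ hD

namespace Surface

variable {Γ : Surface} {u : E3 → E3}

instance isFiniteMeasure_area : IsFiniteMeasure Γ.area := by
  unfold area
  infer_instance

lemma exists_lintegral_weakKernel_area_le (Γ : Surface) :
    ∃ K < ⊤, ∀ y, ∫⁻ x, ENNReal.ofReal (weakKernel ‖x - y‖) ∂Γ.area ≤ K := by
  have hk : ∀ k, ∃ K < ⊤, ∀ y, ∫⁻ p, ENNReal.ofReal (weakKernel ‖Γ.chart k p - y‖)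
      ∂Γ.faceArea k ≤ K := by
    intro k
    obtain ⟨K, hK⟩ := exists_integral_weakKernel_le (Γ.contDiff_chart k) (Γ.injOn_chart k)
      (Γ.immersion_chart k)
    obtain ⟨C, hC0, hC⟩ := exists_norm_le_refTriangle (Γ.continuous_normalVec k).continuousOn
    refine ⟨ENNReal.ofReal C * ENNReal.ofReal K,
      ENNReal.mul_lt_top ENNReal.ofReal_lt_top ENNReal.ofReal_lt_top, fun y => ?_⟩
    have hm : Measurable fun p => ENNReal.ofReal (weakKernel ‖Γ.chart k p - y‖) :=
      (measurable_weakKernel.comp ((Γ.continuous_chart k).sub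
        continuous_const).norm.measurable).ennreal_ofReal
    rw [faceArea, lintegral_withDensity_eq_lintegral_mul _ (Γ.measurable_density k) hm]
    calc _ ≤ ∫⁻ p in refTriangle,
          ENNReal.ofReal C * ENNReal.ofReal (weakKernel ‖Γ.chart k p - y‖) := by
          refine setLIntegral_mono (hm.const_mul _) fun p hp => ?_
          exact mul_le_mul_left (ENNReal.ofReal_le_ofReal (hC p hp)) _
      _ = ENNReal.ofReal C * ENNReal.ofReal (∫ p in refTriangle, weakKernel ‖y - Γ.chart k p‖) := by
          rw [lintegral_const_mul _ hm, ofReal_integral_eq_lintegral_ofReal (hK y).1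
            (Eventually.of_forall fun _ => weakKernel_nonneg _)]
          simp only [norm_sub_rev y]
      _ ≤ _ := by gcongr; exact (hK y).2
  choose K hK hKle using hk
  refine ⟨∑ k, K k, ENNReal.sum_lt_top.2 fun k _ => hK k, fun y => ?_⟩
  rw [area, lintegral_finsetSum_measure]
  refine Finset.sum_le_sum fun k _ => ?_
  rw [lintegral_map _ (Γ.continuous_chart k).measurable]
  · exact hKle k y
  · exact (measurable_weakKernel.comp (by fun_prop)).ennreal_ofReal

lemma exists_edge_lower_lipschitz (a : Fin Γ.numFaces × Fin 3) : ∃ c > 0,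
    ∀ s ∈ Icc (0 : ℝ) 1, ∀ t ∈ Icc (0 : ℝ) 1, c * |s - t| ≤ ‖Γ.edge a s - Γ.edge a t‖ := by
  obtain ⟨c, hc0, hc⟩ := exists_lower_lipschitz (Γ.contDiff_chart a.1) (Γ.injOn_chart a.1)
    (Γ.immersion_chart a.1)
  refine ⟨c, hc0, fun s hs t ht => ?_⟩
  have h := hc _ (refEdge_mem a.2 hs) _ (refEdge_mem a.2 ht)
  have hn : ∀ i, ‖refDir i‖ = 1 := by
    intro i
    fin_cases i <;> simp [refDir, refVertex, Prod.norm_def]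
  rwa [refEdge_eq, refEdge_eq, add_sub_add_left_eq_sub, ← sub_smul, norm_smul, hn, mul_one,
    Real.norm_eq_abs, ← refEdge_eq, ← refEdge_eq] at h

/-- The single layer potential of an edge, which is logarithmically singular at the edge, is square
integrable over the surface. -/
lemma lintegral_sq_edge_lt_top (a : Fin Γ.numFaces × Fin 3) :
    ∫⁻ x, (∫⁻ t in Ioc (0 : ℝ) 1, ENNReal.ofReal ‖x - Γ.edge a t‖⁻¹) ^ 2 ∂Γ.area < ⊤ := by
  obtain ⟨K, hKt, hK⟩ := exists_lintegral_weakKernel_area_le Γ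
  obtain ⟨c, hc0, hc⟩ := exists_edge_lower_lipschitz a
  have he := continuous_edge a
  have hdiag : ∀ᵐ q ∂(volume.restrict (Ioc (0 : ℝ) 1)).prod (volume.restrict (Ioc (0 : ℝ) 1)),
      q.1 ≠ q.2 := by
    rw [ae_iff]
    simp only [not_not, ne_eq]
    rw [Measure.measure_prod_null (measurableSet_eq_fun measurable_fst measurable_snd)]
    refine Eventually.of_forall fun s => ?_
    have : Prod.mk s ⁻¹' {q : ℝ × ℝ | q.1 = q.2} = {s} := by
      ext t; simp [eq_comm]
    simp [this]
  have hmem : ∀ᵐ q ∂(volume.restrict (Ioc (0 : ℝ) 1)).prod (volume.restrict (Ioc (0 : ℝ) 1)),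
      q.1 ∈ Ioc (0 : ℝ) 1 ∧ q.2 ∈ Ioc (0 : ℝ) 1 := by
    rw [Measure.prod_restrict]
    exact ae_restrict_mem (measurableSet_Ioc.prod measurableSet_Ioc)
  refine (lintegral_sq_le_of_mul_le (k := fun x t => ENNReal.ofReal ‖x - Γ.edge a t‖⁻¹)
    (W := fun x t => ENNReal.ofReal (weakKernel ‖x - Γ.edge a t‖))
    (D := fun q => ENNReal.ofReal (√(c * |q.1 - q.2|))⁻¹) (fun x => by fun_prop) ?_ (by fun_prop)
    (fun t => hK (Γ.edge a t)) fun x => ?_).trans_lt (ENNReal.mul_lt_top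
      (lintegral_inv_sqrt_sub_lt_top c hc0) (ENNReal.add_lt_top.2 ⟨hKt, hKt⟩))
  · exact (measurable_weakKernel.comp (by fun_prop :
      Measurable fun z : E3 × ℝ => ‖z.1 - Γ.edge a z.2‖)).ennreal_ofReal
  · filter_upwards [hdiag, hmem] with q hq hqm
    have hlow := hc q.1 (Ioc_subset_Icc_self hqm.1) q.2 (Ioc_subset_Icc_self hqm.2)
    have htri : ‖Γ.edge a q.1 - Γ.edge a q.2‖ ≤ ‖x - Γ.edge a q.1‖ + ‖x - Γ.edge a q.2‖ := by
      rw [norm_sub_rev x (Γ.edge a q.1)]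
      exact norm_sub_le_norm_sub_add_norm_sub _ _ _
    have hpos : 0 < c * |q.1 - q.2| := mul_pos hc0 (abs_pos.2 (sub_ne_zero.2 hq))
    rw [← ENNReal.ofReal_mul (by positivity), ← ENNReal.ofReal_add (weakKernel_nonneg _)
      (weakKernel_nonneg _), ← ENNReal.ofReal_mul (by positivity)]
    exact ENNReal.ofReal_le_ofReal
      (inv_mul_inv_le (norm_nonneg _) (norm_nonneg _) hpos (hlow.trans htri))

/-- A line integral over an edge whose integrand is bounded by a multiple of `|x - y|⁻¹` is square
integrable over the surface, as a function of `x`. -/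
lemma memLp_edgeIntegral (a : Fin Γ.numFaces × Fin 3) {H : E3 → ℝ → E3} {C : ℝ}
    (hH : AEStronglyMeasurable (Function.uncurry H)
      (Γ.area.prod (volume.restrict (Ioc (0 : ℝ) 1))))
    (hle : ∀ x, ∀ t ∈ Ioc (0 : ℝ) 1, ‖H x t‖ ≤ C * ‖x - Γ.edge a t‖⁻¹) (hC : 0 ≤ C) :
    MemLp (fun x => ∫ t in (0 : ℝ)..1, H x t) 2 Γ.area := by
  have hm : AEStronglyMeasurable (fun x => ∫ t in (0 : ℝ)..1, H x t) Γ.area := by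
    simp only [intervalIntegral.integral_of_le zero_le_one]
    exact hH.integral_prod_right'
  rw [memLp_two_iff_integrable_sq_norm hm]
  refine ⟨hm.norm.pow 2, ?_⟩
  have hb : ∀ x, ‖‖∫ t in (0 : ℝ)..1, H x t‖ ^ 2‖ₑ ≤ ENNReal.ofReal C ^ 2 *
      (∫⁻ t in Ioc (0 : ℝ) 1, ENNReal.ofReal ‖x - Γ.edge a t‖⁻¹) ^ 2 := by
    intro x
    have hk : Measurable fun t => ENNReal.ofReal ‖x - Γ.edge a t‖⁻¹ := by
      have := continuous_edge a
      fun_prop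
    rw [enorm_pow, enorm_norm, ← mul_pow, intervalIntegral.integral_of_le zero_le_one,
      ← lintegral_const_mul _ hk]
    gcongr
    refine (enorm_integral_le_lintegral_enorm _).trans (setLIntegral_mono (hk.const_mul _) ?_)
    intro t ht
    rw [← ENNReal.ofReal_mul hC, ← ofReal_norm]
    exact ENNReal.ofReal_le_ofReal (hle x t ht)
  refine (lintegral_mono hb).trans_lt ?_
  rw [lintegral_const_mul' _ _ (by finiteness)]
  exact ENNReal.mul_lt_top (by finiteness) (lintegral_sq_edge_lt_top a)

lemma exists_norm_edge_density_le (hu : Γ.PiecewiseC1 u) (a : Fin Γ.numFaces × Fin 3) :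
    ∃ C, 0 ≤ C ∧ ∀ t ∈ Icc (0 : ℝ) 1, ‖u (Γ.edge a t)‖ * ‖deriv (Γ.edge a) t‖ ≤ C := by
  obtain ⟨C, hC⟩ := isCompact_Icc.exists_bound_of_continuousOn
    ((continuousOn_comp_edge hu a).norm.mul (continuous_deriv_edge' a).continuousOn.norm)
  exact ⟨max C 0, le_max_right _ _,
    fun t ht => ((le_abs_self _).trans (hC t ht)).trans (le_max_left _ _)⟩

lemma norm_laplaceLineIntegrand_le (u : E3 → E3) (x y d : E3) :
    ‖laplaceLineIntegrand u x y d‖ ≤ ‖u y‖ * ‖d‖ * ‖x - y‖⁻¹ := by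
  rw [laplaceLineIntegrand_eq, norm_smul, norm_inv, norm_norm, mul_comm]
  gcongr
  exact norm_cross_le _ _

lemma norm_kelvinLineIntegrand_le (lam mu : ℝ) (u : E3 → E3) (x y d : E3) :
    ‖kelvinLineIntegrand lam mu u x y d‖ ≤ |kelvinConst lam mu| *
      (|lam + 3 * mu| + |lam + mu|) * (‖u y‖ * ‖d‖) * ‖x - y‖⁻¹ := by
  rw [kelvinLineIntegrand_eq, norm_smul, Real.norm_eq_abs, mul_assoc, mul_assoc]
  gcongr
  refine (norm_add_le _ _).trans ?_
  rw [norm_smul, norm_smul, Real.norm_eq_abs, Real.norm_eq_abs, abs_mul, abs_mul, abs_mul,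
    abs_of_nonneg (by positivity : 0 ≤ ‖x - y‖⁻¹), abs_of_nonneg (by positivity :
    0 ≤ (‖x - y‖ ^ 3)⁻¹), add_mul]
  refine add_le_add ?_ ?_
  · calc _ ≤ |lam + 3 * mu| * ‖x - y‖⁻¹ * (‖u y‖ * ‖d‖) := by gcongr; exact norm_cross_le _ _
      _ = _ := by ring
  rcases (norm_nonneg (x - y)).eq_or_lt with h | h
  · rw [← h]; simp
  · have h1 : |⟪cross (x - y) (u y), d⟫| ≤ ‖x - y‖ * ‖u y‖ * ‖d‖ :=
      (abs_real_inner_le_norm _ _).trans (by gcongr; exact norm_cross_le _ _)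
    calc _ ≤ |lam + mu| * ((‖x - y‖ ^ 3)⁻¹ * (‖x - y‖ * ‖u y‖ * ‖d‖)) * ‖x - y‖ := by gcongr
      _ = _ := by field_simp

lemma memLp_lineIntegral_laplace (hu : Γ.PiecewiseC1 u) :
    MemLp (fun x => Γ.lineIntegral (laplaceLineIntegrand u x)) 2 Γ.area := by
  refine memLp_finsetSum _ fun a _ => ?_
  obtain ⟨C, hC0, hC⟩ := exists_norm_edge_density_le hu a
  refine memLp_edgeIntegral a (C := C) ?_ (fun x t ht => ?_) hC0
  · have hud : AEStronglyMeasurable (fun z : E3 × ℝ => u (Γ.edge a z.2))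
        (Γ.area.prod (volume.restrict (Ioc (0 : ℝ) 1))) :=
      (((continuousOn_comp_edge hu a).mono Ioc_subset_Icc_self).aestronglyMeasurable
        measurableSet_Ioc).comp_snd
    have hd : AEStronglyMeasurable (fun z : E3 × ℝ => deriv (Γ.edge a) z.2)
        (Γ.area.prod (volume.restrict (Ioc (0 : ℝ) 1))) :=
      ((continuous_deriv_edge' a).comp continuous_snd).aestronglyMeasurable
    have hr : Measurable fun z : E3 × ℝ => ‖z.1 - Γ.edge a z.2‖⁻¹ := by
      have := continuous_edge a
      fun_prop
    simp only [Function.uncurry_def, laplaceLineIntegrand_eq]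
    exact hr.aestronglyMeasurable.smul (hud.cross hd)
  · refine (norm_laplaceLineIntegrand_le _ _ _ _).trans ?_
    gcongr
    exact hC t (Ioc_subset_Icc_self ht)

lemma memLp_lineIntegral_kelvin (lam mu : ℝ) (hu : Γ.PiecewiseC1 u) :
    MemLp (fun x => Γ.lineIntegral (kelvinLineIntegrand lam mu u x)) 2 Γ.area := by
  refine memLp_finsetSum _ fun a _ => ?_
  obtain ⟨C, hC0, hC⟩ := exists_norm_edge_density_le hu a
  refine memLp_edgeIntegral a (C := |kelvinConst lam mu| * (|lam + 3 * mu| + |lam + mu|) * C)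
    ?_ (fun x t ht => ?_) (by positivity)
  · have hud : AEStronglyMeasurable (fun z : E3 × ℝ => u (Γ.edge a z.2))
        (Γ.area.prod (volume.restrict (Ioc (0 : ℝ) 1))) :=
      (((continuousOn_comp_edge hu a).mono Ioc_subset_Icc_self).aestronglyMeasurable
        measurableSet_Ioc).comp_snd
    have hd : AEStronglyMeasurable (fun z : E3 × ℝ => deriv (Γ.edge a) z.2)
        (Γ.area.prod (volume.restrict (Ioc (0 : ℝ) 1))) :=
      ((continuous_deriv_edge' a).comp continuous_snd).aestronglyMeasurable
    have hz : Continuous fun z : E3 × ℝ => z.1 - Γ.edge a z.2 :=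
      continuous_fst.sub ((continuous_edge a).comp continuous_snd)
    have hz' := hz.aestronglyMeasurable (μ := Γ.area.prod (volume.restrict (Ioc (0 : ℝ) 1)))
    have h1 : AEStronglyMeasurable (fun z : E3 × ℝ => (lam + 3 * mu) * ‖z.1 - Γ.edge a z.2‖⁻¹)
        (Γ.area.prod (volume.restrict (Ioc (0 : ℝ) 1))) :=
      (hz.norm.measurable.inv.const_mul _).aestronglyMeasurable
    have h2 : AEStronglyMeasurable (fun z : E3 × ℝ => (‖z.1 - Γ.edge a z.2‖ ^ 3)⁻¹)
        (Γ.area.prod (volume.restrict (Ioc (0 : ℝ) 1))) :=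
      ((hz.norm.pow 3).measurable.inv).aestronglyMeasurable
    have h3 : AEStronglyMeasurable (fun z : E3 × ℝ =>
        ⟪cross (z.1 - Γ.edge a z.2) (u (Γ.edge a z.2)), deriv (Γ.edge a) z.2⟫)
        (Γ.area.prod (volume.restrict (Ioc (0 : ℝ) 1))) :=
      (hz'.cross hud).inner hd
    simp only [Function.uncurry_def, kelvinLineIntegrand_eq]
    exact ((h1.smul (hud.cross hd)).add
      (((h2.mul h3).const_mul (lam + mu)).smul hz')).const_smul (kelvinConst lam mu)
  · refine (norm_kelvinLineIntegrand_le _ _ _ _ _ _).trans ?_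
    gcongr
    exact hC t (Ioc_subset_Icc_self ht)

/-! ### Square integrability of the surface integrals -/

lemma memLp_integral {F : E3 → Fin Γ.numFaces → ℝ × ℝ → E3}
    (hF : ∀ k, AEStronglyMeasurable (fun z : E3 × ℝ × ℝ => F z.1 k z.2)
      (Γ.area.prod (Γ.faceArea k)))
    (hb : ∀ k, ∃ K, ∀ x, Integrable (F x k) (Γ.faceArea k) ∧
      ‖∫ p, F x k p ∂(Γ.faceArea k)‖ ≤ K) :
    MemLp (fun x => Γ.integral (F x)) 2 Γ.area := by
  refine memLp_finsetSum _ fun k _ => ?_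
  obtain ⟨K, hK⟩ := hb k
  exact MemLp.of_bound (hF k).integral_prod_right' K (Eventually.of_forall fun x => (hK x).2)

lemma memLp_integral_elasticSL (lam mu : ℝ) (hu : Γ.PiecewiseC1 u) :
    MemLp (fun x => Γ.integral (Γ.elasticSLIntegrand lam mu u x)) 2 Γ.area :=
  memLp_integral (fun k => aestronglyMeasurable_elasticSL lam mu measurable_fst measurable_snd
    (aestronglyMeasurable_gunter hu k).comp_snd) (exists_elasticSL_bound lam mu hu)

lemma memLp_integral_laplaceSL (hu : Γ.PiecewiseC1 u) :
    MemLp (fun x => Γ.integral (Γ.laplaceSLIntegrand u x)) 2 Γ.area :=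
  memLp_integral (fun k => aestronglyMeasurable_laplaceSL measurable_fst measurable_snd
    (aestronglyMeasurable_gunter hu k).comp_snd) (exists_laplaceSL_bound hu)

lemma memLp_integral_laplaceDL (hu : Γ.PiecewiseC1 u) :
    MemLp (fun x => Γ.integral (Γ.laplaceDLIntegrand u x)) 2 Γ.area :=
  memLp_integral (fun k => aestronglyMeasurable_laplaceDL measurable_fst measurable_snd
    (aestronglyMeasurable_comp_chart hu k).comp_snd) (exists_laplaceDL_bound hu)

lemma IsClosedSurface.lineIntegral_eq_zero (h : Γ.IsClosedSurface) (F : E3 → E3 → E3) :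
    Γ.lineIntegral F = 0 := by
  classical
  have : Γ.boundaryEdges = ∅ := by
    rw [boundaryEdges, Finset.filter_eq_empty_iff]
    exact fun a _ => not_not.2 (h a)
  rw [lineIntegral, this, Finset.sum_empty]

end Surface

/-! ### Pairing with a square integrable field -/

theorem mainTheorem1 (Γ : Surface) (lam mu : ℝ) (hmu : mu ≠ 0) (hlam : lam + 2 * mu ≠ 0)
    (u v : E3 → E3) (hu : Γ.PiecewiseC1 u) (hv : MemLp v 2 Γ.area) :
    -- the double layer potential exists as a principal value, and its Galerkin form converges
    (∀ᵐ x ∂Γ.area, ∃ L, Γ.HasDoubleLayer lam mu u x L) ∧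
    Integrable (fun x => ⟪v x, Γ.doubleLayer lam mu u x⟫) Γ.area ∧
    -- the three surface integrals over `y` are weakly singular: they converge absolutely
    (∀ x ∈ Γ.carrier, Γ.IntegrableOn (Γ.elasticSLIntegrand lam mu u x) ∧
      Γ.IntegrableOn (Γ.laplaceSLIntegrand u x) ∧ Γ.IntegrableOn (Γ.laplaceDLIntegrand u x)) ∧
    -- the two line integrals over `y` converge absolutely for almost every `x`
    (∀ᵐ x ∂Γ.area, Γ.LineIntegrable (laplaceLineIntegrand u x) ∧
      Γ.LineIntegrable (kelvinLineIntegrand lam mu u x)) ∧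
    -- the five integrals over `x` converge absolutely
    Integrable (fun x => ⟪v x, Γ.integral (Γ.elasticSLIntegrand lam mu u x)⟫) Γ.area ∧
    Integrable (fun x => ⟪v x, Γ.integral (Γ.laplaceSLIntegrand u x)⟫) Γ.area ∧
    Integrable (fun x => ⟪v x, Γ.integral (Γ.laplaceDLIntegrand u x)⟫) Γ.area ∧
    Integrable (fun x => ⟪v x, Γ.lineIntegral (laplaceLineIntegrand u x)⟫) Γ.area ∧
    Integrable (fun x => ⟪v x, Γ.lineIntegral (kelvinLineIntegrand lam mu u x)⟫) Γ.area ∧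
    -- the regularized form
    ∫ x, ⟪v x, Γ.doubleLayer lam mu u x⟫ ∂Γ.area =
      2 * mu * ∫ x, ⟪v x, Γ.integral (Γ.elasticSLIntegrand lam mu u x)⟫ ∂Γ.area
      - 1 / (4 * Real.pi) * ∫ x, ⟪v x, Γ.integral (Γ.laplaceSLIntegrand u x)⟫ ∂Γ.area
      + 1 / (4 * Real.pi) * ∫ x, ⟪v x, Γ.integral (Γ.laplaceDLIntegrand u x)⟫ ∂Γ.area
      - 1 / (4 * Real.pi) * ∫ x, ⟪v x, Γ.lineIntegral (laplaceLineIntegrand u x)⟫ ∂Γ.area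
      + 2 * mu * ∫ x, ⟪v x, Γ.lineIntegral (kelvinLineIntegrand lam mu u x)⟫ ∂Γ.area ∧
    -- both line integral terms vanish for a closed surface
    (Γ.IsClosedSurface →
      ∫ x, ⟪v x, Γ.lineIntegral (laplaceLineIntegrand u x)⟫ ∂Γ.area = 0 ∧
      ∫ x, ⟪v x, Γ.lineIntegral (kelvinLineIntegrand lam mu u x)⟫ ∂Γ.area = 0) := by
  have hae := Γ.ae_area_ne_edge
  let E : E3 → E3 := fun x => Γ.integral (Γ.elasticSLIntegrand lam mu u x)
  let S : E3 → E3 := fun x => Γ.integral (Γ.laplaceSLIntegrand u x)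
  let D : E3 → E3 := fun x => Γ.integral (Γ.laplaceDLIntegrand u x)
  let A : E3 → E3 := fun x => Γ.lineIntegral (laplaceLineIntegrand u x)
  let B : E3 → E3 := fun x => Γ.lineIntegral (kelvinLineIntegrand lam mu u x)
  have iE : Integrable (fun x => ⟪v x, E x⟫) Γ.area :=
    integrable_inner_of_memLp_two hv (Surface.memLp_integral_elasticSL lam mu hu)
  have iS : Integrable (fun x => ⟪v x, S x⟫) Γ.area :=
    integrable_inner_of_memLp_two hv (Surface.memLp_integral_laplaceSL hu)
  have iD : Integrable (fun x => ⟪v x, D x⟫) Γ.area :=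
    integrable_inner_of_memLp_two hv (Surface.memLp_integral_laplaceDL hu)
  have iA : Integrable (fun x => ⟪v x, A x⟫) Γ.area :=
    integrable_inner_of_memLp_two hv (Surface.memLp_lineIntegral_laplace hu)
  have iB : Integrable (fun x => ⟪v x, B x⟫) Γ.area :=
    integrable_inner_of_memLp_two hv (Surface.memLp_lineIntegral_kelvin lam mu hu)
  have hK : ∀ᵐ x ∂Γ.area, ⟪v x, Γ.doubleLayer lam mu u x⟫ =
      2 * mu * ⟪v x, E x⟫ - 1 / (4 * Real.pi) * ⟪v x, S x⟫ + 1 / (4 * Real.pi) * ⟪v x, D x⟫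
        - 1 / (4 * Real.pi) * ⟪v x, A x⟫ + 2 * mu * ⟪v x, B x⟫ := by
    filter_upwards [hae] with x hx
    rw [Surface.doubleLayer, (Surface.hasDoubleLayer hmu hlam hu hx.2).limUnder_eq]
    simp only [inner_add_right, inner_sub_right, real_inner_smul_right, E, S, D, A, B]
  have i1 : Integrable (fun x => 2 * mu * ⟪v x, E x⟫ - 1 / (4 * Real.pi) * ⟪v x, S x⟫) Γ.area :=
    (iE.const_mul (2 * mu)).sub (iS.const_mul (1 / (4 * Real.pi)))
  have i2 : Integrable (fun x => 2 * mu * ⟪v x, E x⟫ - 1 / (4 * Real.pi) * ⟪v x, S x⟫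
      + 1 / (4 * Real.pi) * ⟪v x, D x⟫) Γ.area :=
    i1.add (iD.const_mul (1 / (4 * Real.pi)))
  have i3 : Integrable (fun x => 2 * mu * ⟪v x, E x⟫ - 1 / (4 * Real.pi) * ⟪v x, S x⟫
      + 1 / (4 * Real.pi) * ⟪v x, D x⟫ - 1 / (4 * Real.pi) * ⟪v x, A x⟫) Γ.area :=
    i2.sub (iA.const_mul (1 / (4 * Real.pi)))
  refine ⟨?_, (i3.add (iB.const_mul (2 * mu))).congr (hK.mono fun x hx => hx.symm),
    fun x _ => ⟨fun k => ?_, fun k => ?_, fun k => ?_⟩, ?_, iE, iS, iD, iA, iB, ?_, fun hc => ?_⟩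
  · filter_upwards [hae] with x hx using ⟨_, Surface.hasDoubleLayer hmu hlam hu hx.2⟩
  · exact ((Surface.exists_elasticSL_bound lam mu hu k).choose_spec x).1
  · exact ((Surface.exists_laplaceSL_bound hu k).choose_spec x).1
  · exact ((Surface.exists_laplaceDL_bound hu k).choose_spec x).1
  · filter_upwards [hae] with x hx
    exact ⟨fun a _ => Surface.intervalIntegrable_laplaceLine hu a (hx.2 a),
      fun a _ => Surface.intervalIntegrable_kelvinLine lam mu hu a (hx.2 a)⟩
  · rw [integral_congr_ae hK, integral_add i3 (iB.const_mul _),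
      integral_sub i2 (iA.const_mul _), integral_add i1 (iD.const_mul _),
      integral_sub (iE.const_mul _) (iS.const_mul _)]
    simp only [integral_const_mul, E, S, D, A, B]
  · simp [hc.lineIntegral_eq_zero]
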